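/- **Conventions.** A *computable metric space* is a complete metric space $(\mathbb Y,d)$ with a dense sequence $(y_i)_{i\in\mathbb N}$ of *basic points* such that $(i,j)\mapsto d(y_i,y_j)$ is a computable sequence of reals. $\mathbb N$, $\mathbb R$ and $\mathbb N^{\mathbb N}$ carry their usual metrics and basic points, and products carry the maximum metric and pairs of basic points. A *Cauchy name* of a point $y$ is an $h\in\mathbb N^{\mathbb N}$ such that $d(y_{h(j)},y_{h(i)})\le 2^{-i}$ for all $j\ge i$ and $y=\lim_i y_{h(i)}$. A function $f\colon K\to\mathbb Z$ with $K\subseteq\mathbb Y$ is *computable* if some partial computable $F\colon{\subseteq}\,\mathbb N^{\mathbb N}\to\mathbb N^{\mathbb N}$ sends every Cauchy name of every $y\in K$ to a Cauchy name of $f(y)$. A set is *effectively closed* if its complement is the union of a computable set of open balls with basic centres and rational radii. A function $t\colon\mathbb Y\to(-\infty,\infty]$ is *lower semicomputable* if $t(y)=\sup_n g(n,y)$ for some computable $g\colon\mathbb N\times\mathbb Y\to\mathbb R$. For a computable metric space $\mathbb X$, let $\mathcal M(\mathbb X)$ be the set of finite Borel measures on $\mathbb X$. Its metric is $d(\mu,\nu)=\sum_i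 2^{-i}\bigl(1-e^{-|\int f_i\,d\mu-\int f_i\,d\nu|}\bigr)$, where $(f_i)$ is an effective enumeration of the closure under $\max$, $\min$ and rational linear combinations of the constant function $1$ and the functions that, for a basic point $x$ and rationals $0<r<s$, equal $1$ where $d(x,y)\le r$, equal $\frac{s-d(x,y)}{s-r}$ where $r<d(x,y)\le s$, and equal $0$ elsewhere. Its basic points are the measures $q_1\delta_{x_1}+\dots+q_n\delta_{x_n}$ with $q_j\in\mathbb Q^{+}$ and $x_j$ basic points of $\mathbb X$. The notions of the previous paragraph apply to it through this metric and these basic points. Let $\mathbb B$ be a computable metric space. A *uniform Schnorr integral test* is a lower semicomputable $t\colon\mathbb B\times\mathcal M(\mathbb X)\times\mathbb X\to[0,\infty]$ such that $\int t(b,\nu,x)\,d\nu(x)<\infty$ for all $b$ and $\nu$, and $(b,\nu)\mapsto\int t(b,\nu,x)\,d\nu(x)$ is computable. For $b\in\mathbb B$ and $\mu\in\mathcal M(\mathbb X)$, let $\mathsf{SR}_\mu^{b}$ be the set of $x\in\mathbb X$ with $t(b,\mu,x)<\infty$ for every such test $t$. A point $h$ *uniformly computes* a point $c$ if there are an effectively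 closed set $K$ with $h\in K$ and a computable map $f$ on $K$ with $f(h)=c$. **Theorem.** Let $\mathbb A$ and $\mathbb X$ be computable metric spaces, and let $a\in\mathbb A$, $\mu\in\mathcal M(\mathbb X)$ and $x\in\mathbb X$. The following are equivalent: 1. $x\in\mathsf{SR}_\mu^{h}$ for some Cauchy name $h\in\mathbb N^{\mathbb N}$ of the pair $(a,\mu)$; 2. $x\in\mathsf{SR}_\mu^{h}$ for some $h\in\mathbb N^{\mathbb N}$ that uniformly computes $(a,\mu)$; 3. $x\in\mathsf{SR}_\mu^{a}$. -/

import Mathlib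

open MeasureTheory Filter Topology
open scoped ENNReal NNReal

namespace SchnorrRandomness

/-! ### Coding of rationals, computable functionals on Baire space -/

/-- A computable surjective enumeration of the rationals: the code `⟨a, ⟨b, c⟩⟩` stands for
`(a - b) / (c + 1)`. -/
def ratOf (n : ℕ) : ℚ :=
  ((n.unpair.1 : ℚ) - (n.unpair.2.unpair.1 : ℚ)) / ((n.unpair.2.unpair.2 : ℚ) + 1)

/-- A computable surjective enumeration of the positive rationals: the code `⟨a, b⟩` stands for
`(a + 1) / (b + 1)`. -/
def posRatOf (n : ℕ) : ℚ := ((n.unpair.1 : ℚ) + 1) / ((n.unpair.2 : ℚ) + 1)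

/-- The finite initial segment `h 0, …, h (k - 1)` of `h`. -/
def initialSegment (h : ℕ → ℕ) (k : ℕ) : List ℕ := (List.range k).map h

/-- Partial computable maps from Baire space to Baire space (type-two computability): there is a
computable function `φ` such that `F h n` is found by feeding `φ` longer and longer initial segments
of the oracle `h` (together with the argument `n`) until it answers for the first time; `F h n` is
undefined if it never answers. The domain of the map is the set of `h` with `F h` total. -/
def ComputableFunctional (F : (ℕ → ℕ) → ℕ →. ℕ) : Prop :=
  ∃ φ : List ℕ → ℕ → Option ℕ, Computable₂ φ ∧
    ∀ h n, F h n = Nat.rfindOpt (fun k => φ (initialSegment h k) n)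

/-- Computable functions `ℕ → ℝ`: a computable sequence of rationals `g n i`, `i = 0, 1, …`
(given by codes) with `|g n j - g n i| ≤ 2⁻ⁱ` for `j ≥ i` converges to `f n`. -/
def ComputableRealSeq (f : ℕ → ℝ) : Prop :=
  ∃ c : ℕ → ℕ → ℕ, Computable₂ c ∧
    (∀ n i j, i ≤ j → |ratOf (c n j) - ratOf (c n i)| ≤ (1 / 2 : ℚ) ^ i) ∧
    ∀ n, Tendsto (fun i => (ratOf (c n i) : ℝ)) atTop (𝓝 (f n))

/-! ### Computable metric spaces -/

/-- The data of a sequence of basic points. -/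
class BasicPoints (X : Type*) where
  /-- the `i`-th basic point -/
  basic : ℕ → X

open BasicPoints (basic)

/-- Computable metric spaces: a complete metric space with a dense sequence of basic points whose
mutual distances are computable. -/
class IsComputableMetricSpace (X : Type*) [MetricSpace X] [BasicPoints X] : Prop where
  complete : CompleteSpace X
  dense : DenseRange (basic : ℕ → X)
  computable_dist :
    ComputableRealSeq (fun n => dist (basic n.unpair.1 : X) (basic n.unpair.2))

/-- Products carry the maximum metric and the pairs of basic points. -/
instance instBasicPointsProd {X Y : Type*} [BasicPoints X] [BasicPoints Y] :
    BasicPoints (X × Y) where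
  basic n := (basic n.unpair.1, basic n.unpair.2)

instance instBasicPointsNat : BasicPoints ℕ where
  basic n := n

/-- The basic points of `ℝ` are the rationals. -/
noncomputable instance instBasicPointsReal : BasicPoints ℝ where
  basic n := (ratOf n : ℝ)

/-- Baire space with its usual metric: `dist g h = 2⁻ⁿ`, with `n` the first place where `g` and `h`
differ. -/
noncomputable instance instMetricSpaceBaire : MetricSpace (ℕ → ℕ) := PiNat.metricSpaceNatNat

/-- The basic points of Baire space are the sequences that are eventually zero. -/
instance instBasicPointsBaire : BasicPoints (ℕ → ℕ) where
  basic n := fun k => (Denumerable.ofNat (List ℕ) n).getD k 0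

section Computability

variable {X Y : Type*} [PseudoMetricSpace X] [BasicPoints X] [PseudoMetricSpace Y] [BasicPoints Y]

/-- `h` is a Cauchy name for `y`. -/
def IsCauchyName (h : ℕ → ℕ) (y : X) : Prop :=
  (∀ i j, i ≤ j → dist (basic (h j) : X) (basic (h i)) ≤ (1 / 2 : ℝ) ^ i) ∧
    Tendsto (fun i => (basic (h i) : X)) atTop (𝓝 y)

/-- The restriction of `f` to `A` is computable: a partial computable map on Baire space sends
every Cauchy name of every `x ∈ A` to a Cauchy name of `f x`. -/
def ComputableOn (f : X → Y) (A : Set X) : Prop :=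
  ∃ F : (ℕ → ℕ) → ℕ →. ℕ, ComputableFunctional F ∧
    ∀ x ∈ A, ∀ h, IsCauchyName h x → ∃ g : ℕ → ℕ, (∀ n, g n ∈ F h n) ∧ IsCauchyName g (f x)

/-- The computable maps between two spaces. -/
def ComputableMap (f : X → Y) : Prop := ComputableOn f Set.univ

/-- The basic open ball with code `⟨i, ⟨p, q⟩⟩`: centre the `i`-th basic point, rational radius
`(p + 1) / (q + 1)`. -/
def basicBall (X : Type*) [PseudoMetricSpace X] [BasicPoints X] (n : ℕ) : Set X :=
  Metric.ball (basic n.unpair.1) (posRatOf n.unpair.2 : ℝ)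

/-- Effectively open sets: unions of computable sets of basic open balls. -/
def EffectivelyOpen (U : Set X) : Prop :=
  ∃ A : ℕ → Prop, ComputablePred A ∧ U = {x | ∃ n, A n ∧ x ∈ basicBall X n}

/-- Effectively closed sets. -/
def EffectivelyClosed (C : Set X) : Prop := EffectivelyOpen Cᶜ

/-- Lower semicomputable functions: suprema of computable sequences of computable real-valued
functions. -/
def LowerSemicomputable (f : X → EReal) : Prop :=
  ∃ g : ℕ × X → ℝ, ComputableMap g ∧ ∀ x, f x = ⨆ n, ((g (n, x) : ℝ) : EReal)

/-- `a` uniformly computes `b`: some computable map defined on an effectively closed set that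
contains `a` sends `a` to `b`. -/
def UniformlyComputes (a : X) (b : Y) : Prop :=
  ∃ K : Set X, EffectivelyClosed K ∧ a ∈ K ∧ ∃ f : X → Y, ComputableOn f K ∧ f a = b

end Computability

/-! ### The space of finite Borel measures -/

section Measures

variable {X : Type*} [PseudoMetricSpace X] [BasicPoints X]

/-- The basic bump function: `1` on the closed ball of radius `r` around `x`, `0` off the ball of
radius `s > r`, and `(s - dist x y) / (s - r)` in between. -/
noncomputable def bump (x : X) (r s : ℝ) (y : X) : ℝ :=
  if dist x y ≤ r then 1 else if dist x y ≤ s then (s - dist x y) / (s - r) else 0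

/-- An effective enumeration of the basic functions, that is, of the closure of the basic bump
functions and the constant `1` under `max`, `min` and rational linear combinations. Code `0` is the
constant `1`; a code `n + 1` is split into the operation `n % 5` (bump function, maximum, minimum,
sum, rational multiple) and the code `n / 5` of its arguments. -/
noncomputable def basicFun (X : Type*) [PseudoMetricSpace X] [BasicPoints X] : ℕ → X → ℝ
  | 0 => fun _ => 1
  | n + 1 =>
    have _h₁ : (n / 5).unpair.1 < n + 1 :=
      Nat.lt_succ_of_le ((Nat.unpair_left_le _).trans (Nat.div_le_self n 5))
    have _h₂ : (n / 5).unpair.2 < n + 1 :=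
      Nat.lt_succ_of_le ((Nat.unpair_right_le _).trans (Nat.div_le_self n 5))
    match n % 5 with
    | 0 => bump (basic (n / 5).unpair.1) (posRatOf (n / 5).unpair.2.unpair.1 : ℝ)
        ((posRatOf (n / 5).unpair.2.unpair.1 : ℝ) + (posRatOf (n / 5).unpair.2.unpair.2 : ℝ))
    | 1 => fun y => max (basicFun X (n / 5).unpair.1 y) (basicFun X (n / 5).unpair.2 y)
    | 2 => fun y => min (basicFun X (n / 5).unpair.1 y) (basicFun X (n / 5).unpair.2 y)
    | 3 => fun y => basicFun X (n / 5).unpair.1 y + basicFun X (n / 5).unpair.2 y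
    | _ => fun y => (ratOf (n / 5).unpair.1 : ℝ) * basicFun X (n / 5).unpair.2 y
termination_by n => n

/-- The space of finite measures on `X` (Borel measures, when `X` carries its Borel σ-algebra). It is
a copy of Mathlib's `FiniteMeasure X`, to be equipped with a metric of its own. -/
def Measures (X : Type*) [MeasurableSpace X] : Type _ := FiniteMeasure X

variable [MeasurableSpace X]

/-- The underlying measure. -/
def Measures.toMeasure (μ : Measures X) : Measure X := Subtype.val μ

/-- The integral of the `i`-th basic function. -/
noncomputable def basicIntegral (μ : Measures X) (i : ℕ) : ℝ := ∫ x, basicFun X i x ∂μ.toMeasure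

/-- The `i`-th term of the distance of two measures. -/
noncomputable def measureDistTerm (μ ν : Measures X) (i : ℕ) : ℝ :=
  (1 / 2 : ℝ) ^ i * (1 - Real.exp (-|basicIntegral μ i - basicIntegral ν i|))

theorem measureDistTerm_nonneg (μ ν : Measures X) (i : ℕ) : 0 ≤ measureDistTerm μ ν i := by
  have h : Real.exp (-|basicIntegral μ i - basicIntegral ν i|) ≤ 1 := by simp
  exact mul_nonneg (by positivity) (by linarith)

theorem measureDistTerm_le (μ ν : Measures X) (i : ℕ) : measureDistTerm μ ν i ≤ (1 / 2 : ℝ) ^ i := by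
  have h := Real.exp_pos (-|basicIntegral μ i - basicIntegral ν i|)
  exact mul_le_of_le_one_right (by positivity) (by linarith)

theorem summable_measureDistTerm (μ ν : Measures X) : Summable (measureDistTerm μ ν) :=
  Summable.of_nonneg_of_le (measureDistTerm_nonneg μ ν) (measureDistTerm_le μ ν)
    summable_geometric_two

theorem measureDistTerm_triangle (μ ν ρ : Measures X) (i : ℕ) :
    measureDistTerm μ ρ i ≤ measureDistTerm μ ν i + measureDistTerm ν ρ i := by
  have key : ∀ a b c : ℝ, 0 ≤ a → 0 ≤ b → c ≤ a + b →
      1 - Real.exp (-c) ≤ (1 - Real.exp (-a)) + (1 - Real.exp (-b)) := by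
    intro a b c ha hb hc
    have h₁ : Real.exp (-(a + b)) ≤ Real.exp (-c) := Real.exp_le_exp.2 (by linarith)
    have h₂ : Real.exp (-(a + b)) = Real.exp (-a) * Real.exp (-b) := by
      rw [← Real.exp_add]; ring_nf
    have h₃ : Real.exp (-a) ≤ 1 := by simpa using ha
    have h₄ : Real.exp (-b) ≤ 1 := by simpa using hb
    nlinarith [mul_nonneg (sub_nonneg.2 h₃) (sub_nonneg.2 h₄)]
  unfold measureDistTerm
  rw [← mul_add]
  exact mul_le_mul_of_nonneg_left
    (key _ _ _ (abs_nonneg _) (abs_nonneg _) (abs_sub_le _ _ _)) (by positivity)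

/-- The metric `d(μ, ν) = ∑ᵢ 2⁻ⁱ (1 - exp (-|∫ fᵢ dμ - ∫ fᵢ dν|))`, with `fᵢ` the `i`-th basic
function. -/
noncomputable instance instPseudoMetricSpaceMeasures : PseudoMetricSpace (Measures X) where
  dist μ ν := ∑' i, measureDistTerm μ ν i
  dist_self μ := by simp [measureDistTerm]
  dist_comm μ ν := by simp [measureDistTerm, abs_sub_comm]
  dist_triangle μ ν ρ := by
    rw [← (summable_measureDistTerm μ ν).tsum_add (summable_measureDistTerm ν ρ)]
    exact (summable_measureDistTerm μ ρ).tsum_le_tsum (measureDistTerm_triangle μ ν ρ)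
      ((summable_measureDistTerm μ ν).add (summable_measureDistTerm ν ρ))

/-- The unit point mass. -/
noncomputable def pointMass (x : X) : FiniteMeasure X := ⟨Measure.dirac x, inferInstance⟩

/-- The basic measures `q₁ δ_{x₁} + ⋯ + qₙ δ_{xₙ}` with `qⱼ` positive rationals and `xⱼ` basic
points. A code stands for the list of the codes of the pairs `(xⱼ, qⱼ)`. -/
noncomputable instance instBasicPointsMeasures : BasicPoints (Measures X) where
  basic n := (((Denumerable.ofNat (List ℕ) n).map fun m =>
    Real.toNNReal (posRatOf m.unpair.2 : ℝ) • pointMass (basic m.unpair.1 : X)).sum :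
      FiniteMeasure X)

end Measures

/-! ### Uniform Schnorr randomness -/

section Randomness

variable {A X : Type*} [PseudoMetricSpace A] [BasicPoints A] [PseudoMetricSpace X] [BasicPoints X]
  [MeasurableSpace X]

/-- Uniform Schnorr integral tests: lower semicomputable functions `t (a, μ, x) ∈ [0, ∞]` whose
integrals `∫ t (a, μ, x) dμ(x)` are finite and a computable function of `(a, μ)`. -/
structure IsUniformSchnorrTest (t : A × Measures X × X → ℝ≥0∞) : Prop where
  lowerSemicomputable : LowerSemicomputable fun p => (t p : EReal)
  lintegral_lt_top : ∀ (a : A) (μ : Measures X), ∫⁻ x, t (a, μ, x) ∂μ.toMeasure < ∞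
  computable_integral : ComputableMap fun p : A × Measures X =>
    (∫⁻ x, t (p.1, p.2, x) ∂p.2.toMeasure).toReal

/-- The set of points that are uniformly Schnorr `μ`-random relative to the oracle `a`. -/
def SR (μ : Measures X) (a : A) : Set X :=
  {x | ∀ t : A × Measures X × X → ℝ≥0∞, IsUniformSchnorrTest t → t (a, μ, x) < ∞}

end Randomness

end SchnorrRandomness

namespace SchnorrRandomness

open BasicPoints (basic)

/-! ### Closure properties of computable functions -/

attribute [fun_prop] Computable

section ComputableClosure

variable {α β γ σ : Type*} [Primcodable α] [Primcodable β] [Primcodable γ] [Primcodable σ]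

attribute [fun_prop] Computable.id Computable.const Computable.fst Computable.snd Computable.encode

@[fun_prop] theorem computable_comp {f : β → σ} {g : α → β} (hf : Computable f)
    (hg : Computable g) : Computable fun a => f (g a) := hf.comp hg

@[fun_prop] theorem computable_mk {f : α → β} {g : α → γ} (hf : Computable f) (hg : Computable g) :
    Computable fun a => (f a, g a) := hf.pair hg

@[fun_prop] theorem computable_fst {f : α → β × γ} (hf : Computable f) :
    Computable fun a => (f a).1 := Computable.fst.comp hf

@[fun_prop] theorem computable_snd {f : α → β × γ} (hf : Computable f) :
    Computable fun a => (f a).2 := Computable.snd.comp hf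

@[fun_prop] theorem computable_nat_add {f g : α → ℕ} (hf : Computable f) (hg : Computable g) :
    Computable fun a => f a + g a := Primrec.nat_add.to_comp.comp hf hg

@[fun_prop] theorem computable_nat_sub {f g : α → ℕ} (hf : Computable f) (hg : Computable g) :
    Computable fun a => f a - g a := Primrec.nat_sub.to_comp.comp hf hg

@[fun_prop] theorem computable_nat_mul {f g : α → ℕ} (hf : Computable f) (hg : Computable g) :
    Computable fun a => f a * g a := Primrec.nat_mul.to_comp.comp hf hg

@[fun_prop] theorem computable_nat_div {f g : α → ℕ} (hf : Computable f) (hg : Computable g) :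
    Computable fun a => f a / g a := Primrec.nat_div.to_comp.comp hf hg

@[fun_prop] theorem computable_nat_mod {f g : α → ℕ} (hf : Computable f) (hg : Computable g) :
    Computable fun a => f a % g a := Primrec.nat_mod.to_comp.comp hf hg

@[fun_prop] theorem computable_natPair {f g : α → ℕ} (hf : Computable f) (hg : Computable g) :
    Computable fun a => Nat.pair (f a) (g a) := Primrec₂.natPair.to_comp.comp hf hg

@[fun_prop] theorem computable_unpair {f : α → ℕ} (hf : Computable f) :
    Computable fun a => (f a).unpair := Computable.unpair.comp hf

@[fun_prop] theorem computable_decide_le {f g : α → ℕ} (hf : Computable f) (hg : Computable g) :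
    Computable fun a => decide (f a ≤ g a) := Primrec.nat_le.decide.to_comp.comp hf hg

@[fun_prop] theorem computable_decide_lt {f g : α → ℕ} (hf : Computable f) (hg : Computable g) :
    Computable fun a => decide (f a < g a) := Primrec.nat_lt.decide.to_comp.comp hf hg

@[fun_prop] theorem computable_decide_eq [DecidableEq σ] {f g : α → σ} (hf : Computable f)
    (hg : Computable g) : Computable fun a => decide (f a = g a) :=
  (Primrec.eq.decide (α := σ)).to_comp.comp hf hg

@[fun_prop] theorem computable_and {f g : α → Bool} (hf : Computable f) (hg : Computable g) :
    Computable fun a => (f a && g a) := Primrec.and.to_comp.comp hf hg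

@[fun_prop] theorem computable_or {f g : α → Bool} (hf : Computable f) (hg : Computable g) :
    Computable fun a => (f a || g a) := Primrec.or.to_comp.comp hf hg

@[fun_prop] theorem computable_not {f : α → Bool} (hf : Computable f) :
    Computable fun a => !(f a) := Primrec.not.to_comp.comp hf

@[fun_prop] theorem computable_ite {p : α → Prop} [DecidablePred p] {f g : α → σ}
    (hp : Computable fun a => decide (p a)) (hf : Computable f) (hg : Computable g) :
    Computable fun a => if p a then f a else g a :=
  (Computable.cond hp hf hg).of_eq fun a => by by_cases h : p a <;> simp [h]

@[fun_prop] theorem computable_length {f : α → List β} (hf : Computable f) :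
    Computable fun a => (f a).length := Computable.list_length.comp hf

@[fun_prop] theorem computable_take {n : α → ℕ} {f : α → List β} (hn : Computable n)
    (hf : Computable f) : Computable fun a => (f a).take (n a) :=
  Primrec.list_take.to_comp.comp hn hf

@[fun_prop] theorem computable_getD {f : α → List β} {n : α → ℕ} (d : β) (hf : Computable f)
    (hn : Computable n) : Computable fun a => (f a).getD (n a) d :=
  (Primrec.list_getD d).to_comp.comp hf hn

@[fun_prop] theorem computable_ofNat {f : α → ℕ} (hf : Computable f) :
    Computable fun a => Denumerable.ofNat (List ℕ) (f a) := (Computable.ofNat (List ℕ)).comp hf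

@[fun_prop] theorem computable_option_some {f : α → β} (hf : Computable f) :
    Computable fun a => some (f a) := Computable.option_some.comp hf

theorem computable_any_range {f : α × ℕ → Bool} (hf : Computable f) {n : α → ℕ}
    (hn : Computable n) : Computable fun a => (List.range (n a)).any fun i => f (a, i) := by
  have h : Computable₂ fun (a : α) (p : ℕ × Bool) => (p.2 || f (a, p.1)) := by
    unfold Computable₂; fun_prop
  refine (Computable.nat_rec hn (Computable.const false) h).of_eq fun a => ?_
  generalize n a = m
  induction m with
  | zero => rfl
  | succ m ih => simp [List.range_succ, ← ih]

theorem computable_all_range {f : α × ℕ → Bool} (hf : Computable f) {n : α → ℕ}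
    (hn : Computable n) : Computable fun a => (List.range (n a)).all fun i => f (a, i) := by
  refine (computable_not (computable_any_range (computable_not hf) hn)).of_eq fun a => ?_
  simp [List.all_eq_not_any_not]

theorem computable_map_range {f : α × ℕ → β} (hf : Computable f) {n : α → ℕ}
    (hn : Computable n) : Computable fun a => (List.range (n a)).map fun i => f (a, i) := by
  have h : Computable₂ fun (a : α) (p : ℕ × List β) => p.2 ++ [f (a, p.1)] := by
    have : Computable fun q : α × ℕ × List β => (q.2.2, f (q.1, q.2.1)) := by fun_prop
    exact Computable.list_concat.comp (computable_fst this) (computable_snd this)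
  refine (Computable.nat_rec hn (Computable.const []) h).of_eq fun a => ?_
  generalize n a = m
  induction m with
  | zero => rfl
  | succ m ih => simp [List.range_succ, ← ih]

end ComputableClosure

/-- A computable function is determined by any code of a partial recursive function that acts as it
does on encodings, and there are countably many codes. -/
theorem countable_computable (α σ : Type*) [Primcodable α] [Primcodable σ] :
    {f : α → σ | Computable f}.Countable := by
  have h : ∀ f : α → σ, Computable f → ∃ c : Nat.Partrec.Code, ∀ a : α,
      c.eval (Encodable.encode a) = Part.some (Encodable.encode (f a)) := by
    intro f hf
    obtain ⟨c, hc⟩ := Nat.Partrec.Code.exists_code.1 hf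
    exact ⟨c, fun a => by simp [hc]⟩
  choose! c hc using h
  refine Set.MapsTo.countable_of_injOn (f := c) (t := Set.univ) (Set.mapsTo_univ _ _)
    (fun f hf g hg e => ?_) Set.countable_univ
  funext a
  have h1 := hc f hf a
  rw [e, hc g hg a] at h1
  exact (Encodable.encode_injective (Part.some_inj.1 h1)).symm

/-! ### The rationals as a type of finite objects -/

section Rationals

theorem ratOf_pair (a b c : ℕ) :
    ratOf (Nat.pair a (Nat.pair b c)) = ((a : ℚ) - b) / ((c : ℚ) + 1) := by
  simp [ratOf]

theorem ratOf_surjective : Function.Surjective ratOf := by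
  intro q
  refine ⟨Nat.pair q.num.toNat (Nat.pair (-q.num).toNat (q.den - 1)), ?_⟩
  rw [ratOf_pair]
  have h1 : ((q.den - 1 : ℕ) : ℚ) + 1 = q.den := by
    have := q.den_pos
    exact_mod_cast Nat.succ_pred_eq_of_pos this
  have h2 : ((q.num.toNat : ℕ) : ℚ) - ((-q.num).toNat : ℕ) = (q.num : ℚ) := by
    have := Int.toNat_sub_toNat_neg q.num
    exact_mod_cast this
  rw [h1, h2, Rat.num_div_den]

/-- Comparison of rationals through their codes. -/
def codeLe (m n : ℕ) : Prop :=
  m.unpair.1 * (n.unpair.2.unpair.2 + 1) + n.unpair.2.unpair.1 * (m.unpair.2.unpair.2 + 1) ≤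
    n.unpair.1 * (m.unpair.2.unpair.2 + 1) + m.unpair.2.unpair.1 * (n.unpair.2.unpair.2 + 1)

theorem codeLe_iff (m n : ℕ) : codeLe m n ↔ ratOf m ≤ ratOf n := by
  unfold codeLe ratOf
  rw [div_le_div_iff₀ (by positivity) (by positivity), ← Nat.cast_le (α := ℚ)]
  push_cast
  constructor <;> intro h <;> linarith

instance : DecidableRel codeLe := fun _ _ => inferInstanceAs (Decidable (_ ≤ _))

theorem primrecRel_codeLe : PrimrecRel codeLe := by
  have l {f g : ℕ × ℕ → ℕ} (hf : Primrec f) (hg : Primrec g) :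
      Primrec fun p : ℕ × ℕ => f p * (g p + 1) :=
    Primrec.nat_mul.comp hf (Primrec.succ.comp hg)
  have u1 {f : ℕ × ℕ → ℕ} (hf : Primrec f) : Primrec fun p => (f p).unpair.1 :=
    Primrec.fst.comp (Primrec.unpair.comp hf)
  have u2 {f : ℕ × ℕ → ℕ} (hf : Primrec f) : Primrec fun p => (f p).unpair.2 :=
    Primrec.snd.comp (Primrec.unpair.comp hf)
  exact Primrec.nat_le.comp
    (Primrec.nat_add.comp (l (u1 .fst) (u2 (u2 .snd))) (l (u1 (u2 .snd)) (u2 (u2 .fst))))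
    (Primrec.nat_add.comp (l (u1 .snd) (u2 (u2 .fst))) (l (u1 (u2 .fst)) (u2 (u2 .snd))))

open Classical in
/-- The least code of a rational. -/
noncomputable def leastCode (q : ℚ) : ℕ := Nat.find (ratOf_surjective q)

theorem ratOf_leastCode (q : ℚ) : ratOf (leastCode q) = q := by
  classical exact Nat.find_spec (ratOf_surjective q)

theorem leastCode_le {n : ℕ} {q : ℚ} (h : ratOf n = q) : leastCode q ≤ n := by
  classical exact Nat.find_min' (ratOf_surjective q) h

/-- Equality of coded rationals is decidable, so the least equivalent code is found by a bounded
search. Searching for the largest `k` such that `n - k` is equivalent to `n` turns this into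
`Nat.findGreatest`, which is primitive recursive. -/
theorem leastCode_ratOf (n : ℕ) : leastCode (ratOf n) =
    n - Nat.findGreatest (fun k => codeLe (n - k) n ∧ codeLe n (n - k)) n := by
  have hle : leastCode (ratOf n) ≤ n := leastCode_le rfl
  have key : Nat.findGreatest (fun k => codeLe (n - k) n ∧ codeLe n (n - k)) n =
      n - leastCode (ratOf n) := by
    rw [Nat.findGreatest_eq_iff]
    refine ⟨Nat.sub_le _ _, fun _ => ?_, fun k hk hkn h => ?_⟩
    · rw [codeLe_iff, codeLe_iff, Nat.sub_sub_self hle, ratOf_leastCode]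
      exact ⟨le_rfl, le_rfl⟩
    · rw [codeLe_iff, codeLe_iff] at h
      have := leastCode_le (le_antisymm h.1 h.2)
      omega
  omega

/-- `ratOf` is not injective, so encoding needs a canonical code; the least one is primitive
recursive in any other. With this choice `ratOf` is the decoding map, and all later searches over
rationals are searches over codes. -/
noncomputable instance primcodableRat : Primcodable ℚ where
  encode := leastCode
  decode n := some (ratOf n)
  encodek q := congrArg some (ratOf_leastCode q)
  prim := by
    have h : Primrec fun n => Nat.findGreatest (fun k => codeLe (n - k) n ∧ codeLe n (n - k)) n := by
      refine Primrec.nat_findGreatest (p := fun n k => codeLe (n - k) n ∧ codeLe n (n - k)) .id ?_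
      have hs : Primrec fun p : ℕ × ℕ => p.1 - p.2 := Primrec.nat_sub.comp .fst .snd
      exact (primrecRel_codeLe.comp hs .fst).and (primrecRel_codeLe.comp .fst hs)
    have h' : Primrec fun n => Nat.succ (leastCode (ratOf n)) :=
      (Primrec.succ.comp (Primrec.nat_sub.comp .id h)).of_eq fun n => by rw [leastCode_ratOf]; rfl
    exact Primrec.nat_iff.1 h'

variable {α : Type*} [Primcodable α]

@[fun_prop] theorem computable_ratOf {f : α → ℕ} (hf : Computable f) :
    Computable fun a => ratOf (f a) := by
  have : Computable fun a => primcodableRat.decode (f a) :=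
    (Computable.decode (α := ℚ)).comp hf
  exact Computable.option_some_iff.1 this

@[fun_prop] theorem computable_leastCode {f : α → ℚ} (hf : Computable f) :
    Computable fun a => leastCode (f a) := (Computable.encode (α := ℚ)).comp hf

theorem computable_rat_mk {u v w : α → ℕ} (hu : Computable u) (hv : Computable v)
    (hw : Computable w) : Computable fun a => ((u a : ℚ) - v a) / ((w a : ℚ) + 1) := by
  have h : Computable fun a => ratOf (Nat.pair (u a) (Nat.pair (v a) (w a))) := by fun_prop
  exact h.of_eq fun a => ratOf_pair _ _ _

/-- Reduces arithmetic of rationals to arithmetic of natural numbers, the components being read off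
from the least code. -/
theorem exists_computable_components {f : α → ℚ} (hf : Computable f) :
    ∃ u v w : α → ℕ, Computable u ∧ Computable v ∧ Computable w ∧
      ∀ a, f a = ((u a : ℚ) - v a) / ((w a : ℚ) + 1) :=
  ⟨fun a => (leastCode (f a)).unpair.1, fun a => (leastCode (f a)).unpair.2.unpair.1,
    fun a => (leastCode (f a)).unpair.2.unpair.2, by fun_prop, by fun_prop, by fun_prop,
    fun a => (ratOf_leastCode (f a)).symm⟩

@[fun_prop] theorem computable_rat_add {f g : α → ℚ} (hf : Computable f) (hg : Computable g) :
    Computable fun a => f a + g a := by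
  obtain ⟨u, v, w, hu, hv, hw, h⟩ := exists_computable_components hf
  obtain ⟨u', v', w', hu', hv', hw', h'⟩ := exists_computable_components hg
  refine (computable_rat_mk (u := fun a => u a * (w' a + 1) + u' a * (w a + 1))
    (v := fun a => v a * (w' a + 1) + v' a * (w a + 1)) (w := fun a => w a * w' a + w a + w' a)
    (by fun_prop) (by fun_prop) (by fun_prop)).of_eq fun a => ?_
  rw [h, h', div_add_div _ _ (by positivity) (by positivity)]
  push_cast
  congr 1 <;> ring

@[fun_prop] theorem computable_rat_mul {f g : α → ℚ} (hf : Computable f) (hg : Computable g) :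
    Computable fun a => f a * g a := by
  obtain ⟨u, v, w, hu, hv, hw, h⟩ := exists_computable_components hf
  obtain ⟨u', v', w', hu', hv', hw', h'⟩ := exists_computable_components hg
  refine (computable_rat_mk (u := fun a => u a * u' a + v a * v' a)
    (v := fun a => u a * v' a + v a * u' a) (w := fun a => w a * w' a + w a + w' a)
    (by fun_prop) (by fun_prop) (by fun_prop)).of_eq fun a => ?_
  rw [h, h', div_mul_div_comm]
  push_cast
  congr 1 <;> ring

@[fun_prop] theorem computable_rat_neg {f : α → ℚ} (hf : Computable f) :
    Computable fun a => -f a := by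
  have := computable_rat_mul (Computable.const (-1 : ℚ)) hf
  simpa using this

@[fun_prop] theorem computable_rat_sub {f g : α → ℚ} (hf : Computable f) (hg : Computable g) :
    Computable fun a => f a - g a := by
  simpa [sub_eq_add_neg] using computable_rat_add hf (computable_rat_neg hg)

@[fun_prop] theorem computable_natCast {f : α → ℕ} (hf : Computable f) :
    Computable fun a => (f a : ℚ) := by
  have h : Computable fun n : ℕ => ratOf (Nat.pair n (Nat.pair 0 0)) := by fun_prop
  exact (h.comp hf).of_eq fun a => by simp [ratOf_pair]

@[fun_prop] theorem computable_rat_decide_le {f g : α → ℚ} (hf : Computable f)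
    (hg : Computable g) : Computable fun a => decide (f a ≤ g a) := by
  have h : Computable fun a => decide (codeLe (leastCode (f a)) (leastCode (g a))) :=
    primrecRel_codeLe.decide.to_comp.comp (computable_leastCode hf) (computable_leastCode hg)
  exact h.of_eq fun a => by simp [codeLe_iff, ratOf_leastCode]

@[fun_prop] theorem computable_rat_decide_lt {f g : α → ℚ} (hf : Computable f)
    (hg : Computable g) : Computable fun a => decide (f a < g a) := by
  refine (computable_not (computable_rat_decide_le hg hf)).of_eq fun a => ?_
  rw [← decide_not, decide_eq_decide, not_le]

@[fun_prop] theorem computable_rat_max {f g : α → ℚ} (hf : Computable f) (hg : Computable g) :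
    Computable fun a => max (f a) (g a) := by
  simp only [max_def]; fun_prop

@[fun_prop] theorem computable_rat_min {f g : α → ℚ} (hf : Computable f) (hg : Computable g) :
    Computable fun a => min (f a) (g a) := by
  simp only [min_def]; fun_prop

@[fun_prop] theorem computable_rat_inv {f : α → ℚ} (hf : Computable f) :
    Computable fun a => (f a)⁻¹ := by
  obtain ⟨u, v, w, hu, hv, hw, h⟩ := exists_computable_components hf
  -- The inverse of `(u - v) / (w + 1)` is `± (w + 1) / |u - v|`, with the sign carried by the
  -- numerator. In truncated subtraction `u - v + (v - u)` is `|u - v|`, and `1` is removed because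
  -- a coded denominator is a successor.
  have h1 : Computable fun a => if f a = 0 then (0 : ℚ) else
      (((if v a < u a then w a + 1 else 0 : ℕ) : ℚ) - (if v a < u a then 0 else w a + 1 : ℕ)) /
        (((u a - v a + (v a - u a) - 1 : ℕ) : ℚ) + 1) :=
    computable_ite (by fun_prop) (by fun_prop)
      (computable_rat_mk (by fun_prop) (by fun_prop) (by fun_prop))
  refine h1.of_eq fun a => ?_
  split_ifs with h2 h3
  · simp [h2]
  · rw [h, inv_div, show u a - v a + (v a - u a) - 1 = u a - (v a + 1) by omega, Nat.cast_sub h3]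
    push_cast
    congr 1 <;> ring
  · have h4 : u a ≠ v a := fun e => h2 (by rw [h, e]; simp)
    rw [h, inv_div, show u a - v a + (v a - u a) - 1 = v a - (u a + 1) by omega,
      Nat.cast_sub (by omega)]
    push_cast
    rw [← neg_div_neg_eq]
    congr 1 <;> ring

@[fun_prop] theorem computable_rat_div {f g : α → ℚ} (hf : Computable f) (hg : Computable g) :
    Computable fun a => f a / g a := by
  simpa [div_eq_mul_inv] using computable_rat_mul hf (computable_rat_inv hg)

theorem computable_rat_prod_range {f : α × ℕ → ℚ} (hf : Computable f) {n : α → ℕ}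
    (hn : Computable n) : Computable fun a => ∏ i ∈ Finset.range (n a), f (a, i) := by
  have h : Computable₂ fun (a : α) (p : ℕ × ℚ) => p.2 * f (a, p.1) := by
    unfold Computable₂; fun_prop
  refine (Computable.nat_rec hn (Computable.const 1) h).of_eq fun a => ?_
  generalize n a = m
  induction m with
  | zero => rfl
  | succ m ih => simp [Finset.prod_range_succ, ← ih]

theorem computable_rat_sum_range {f : α × ℕ → ℚ} (hf : Computable f) {n : α → ℕ}
    (hn : Computable n) : Computable fun a => ∑ i ∈ Finset.range (n a), f (a, i) := by
  have h : Computable₂ fun (a : α) (p : ℕ × ℚ) => p.2 + f (a, p.1) := by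
    unfold Computable₂; fun_prop
  refine (Computable.nat_rec hn (Computable.const 0) h).of_eq fun a => ?_
  generalize n a = m
  induction m with
  | zero => rfl
  | succ m ih => simp [Finset.sum_range_succ, ← ih]

@[fun_prop] theorem computable_rat_pow {f : α → ℚ} {n : α → ℕ} (hf : Computable f)
    (hn : Computable n) : Computable fun a => f a ^ n a := by
  have := computable_rat_prod_range (f := fun p : α × ℕ => f p.1) (by fun_prop) hn
  simpa using this

@[fun_prop] theorem computable_posRatOf {f : α → ℕ} (hf : Computable f) :
    Computable fun a => posRatOf (f a) := by
  unfold posRatOf; fun_prop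

@[fun_prop] theorem computable_nat_pow {f n : α → ℕ} (hf : Computable f) (hn : Computable n) :
    Computable fun a => f a ^ n a := by
  have h : Computable₂ fun (a : α) (p : ℕ × ℕ) => p.2 * f a := by
    unfold Computable₂; fun_prop
  refine (Computable.nat_rec hn (Computable.const 1) h).of_eq fun a => ?_
  generalize n a = m
  induction m with
  | zero => rfl
  | succ m ih => simp [pow_succ, ← ih]

theorem posRatOf_pos (n : ℕ) : 0 < posRatOf n := by
  unfold posRatOf; positivity

end Rationals

/-! ### Relations semidecidable in an oracle -/

section InitialSegment

@[simp] theorem length_initialSegment (h : ℕ → ℕ) (k : ℕ) : (initialSegment h k).length = k := by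
  simp [initialSegment]

@[simp] theorem take_initialSegment (h : ℕ → ℕ) (k l : ℕ) :
    (initialSegment h k).take l = initialSegment h (min l k) := by
  simp [initialSegment, ← List.map_take, List.take_range]

theorem getD_initialSegment (h : ℕ → ℕ) {j k : ℕ} (hj : j < k) :
    (initialSegment h k).getD j 0 = h j := by
  simp [initialSegment, hj]

theorem eq_initialSegment_iff (h : ℕ → ℕ) (l : List ℕ) :
    l = initialSegment h l.length ↔ ∀ j < l.length, h j = l.getD j 0 := by
  constructor
  · intro e j hj
    conv_rhs => rw [e]
    rw [getD_initialSegment h hj]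
  · intro H
    refine List.ext_getElem (by simp) fun j h1 h2 => ?_
    simp [initialSegment, H j h1, h1]

end InitialSegment

section Semidecidable

variable {I J α β γ : Type*} [Primcodable α] [Primcodable β] [Primcodable γ] {o : I → ℕ → ℕ}

/-- The relation `R i a` is semidecidable, uniformly in the finite object `a`, relative to the
oracle `o i`: a computable test accepts some initial segment of the oracle. -/
def SemidecidableIn (o : I → ℕ → ℕ) (R : I → α → Prop) : Prop :=
  ∃ f : List ℕ × α → Bool, Computable f ∧
    (∀ i a k l, k ≤ l → f (initialSegment (o i) k, a) = true →
      f (initialSegment (o i) l, a) = true) ∧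
    ∀ i a, R i a ↔ ∃ k, f (initialSegment (o i) k, a) = true

namespace SemidecidableIn

variable {R S : I → α → Prop}

theorem congr (hR : SemidecidableIn o R) (h : ∀ i a, S i a ↔ R i a) : SemidecidableIn o S := by
  obtain rfl : S = R := by ext i a; exact h i a
  exact hR

/-- Dovetailing: all shorter prefixes and all witnesses up to the length of the prefix are tried.
This makes acceptance monotone in the prefix even when `f` itself is not. -/
theorem mk {f : List ℕ × α × ℕ → Bool} (hf : Computable f)
    (h : ∀ i a, R i a ↔ ∃ k n, f (initialSegment (o i) k, a, n) = true) : SemidecidableIn o R := by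
  refine ⟨fun p => (List.range (p.1.length + 1)).any fun k =>
    (List.range (p.1.length + 1)).any fun n => f (p.1.take k, p.2, n), ?_, ?_, ?_⟩
  · have h1 : Computable fun q : (List ℕ × α) × ℕ =>
        (List.range (q.1.1.length + 1)).any fun n => f (q.1.1.take q.2, q.1.2, n) :=
      computable_any_range (f := fun q : ((List ℕ × α) × ℕ) × ℕ =>
        f (q.1.1.1.take q.1.2, q.1.1.2, q.2)) (by fun_prop) (by fun_prop)
    exact computable_any_range h1 (by fun_prop)
  · intro i a k l hkl
    simp only [List.any_eq_true, List.mem_range, length_initialSegment, take_initialSegment]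
    rintro ⟨j, hj, n, hn, e⟩
    refine ⟨j, by omega, n, by omega, ?_⟩
    rwa [min_eq_left (by omega)] at e ⊢
  · intro i a
    rw [h]
    simp only [List.any_eq_true, List.mem_range, length_initialSegment, take_initialSegment]
    constructor
    · rintro ⟨k, n, e⟩
      exact ⟨max k n, k, by omega, n, by omega, by rwa [min_eq_left (le_max_left _ _)]⟩
    · rintro ⟨k, j, _, n, _, e⟩
      exact ⟨_, _, e⟩

theorem of_computable {b : α → Bool} (hb : Computable b) :
    SemidecidableIn o fun _ a => b a = true :=
  ⟨fun p => b p.2, by fun_prop, fun _ _ _ _ _ h => h, fun i a => by simp⟩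

theorem of_decide {p : α → Prop} [DecidablePred p] (hp : Computable fun a => decide (p a)) :
    SemidecidableIn o fun _ a => p a :=
  (of_computable hp).congr fun i a => by simp

theorem segment {b : List ℕ × α → Bool} (hb : Computable b) {n : α → ℕ} (hn : Computable n) :
    SemidecidableIn o fun i a => b (initialSegment (o i) (n a), a) = true := by
  refine ⟨fun p => decide (n p.2 ≤ p.1.length) && b (p.1.take (n p.2), p.2), by fun_prop, ?_, ?_⟩
  · intro i a k l hkl
    simp only [Bool.and_eq_true, decide_eq_true_eq, length_initialSegment, take_initialSegment]
    rintro ⟨h1, h2⟩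
    rw [min_eq_left h1] at h2
    exact ⟨h1.trans hkl, by rwa [min_eq_left (h1.trans hkl)]⟩
  · intro i a
    simp only [Bool.and_eq_true, decide_eq_true_eq, length_initialSegment, take_initialSegment]
    constructor
    · intro h; exact ⟨n a, le_rfl, by rwa [min_self]⟩
    · rintro ⟨k, h1, h2⟩; rwa [min_eq_left h1] at h2

theorem apply_eq {n v : α → ℕ} (hn : Computable n) (hv : Computable v) :
    SemidecidableIn o fun i a => o i (n a) = v a := by
  refine (segment (b := fun p => decide (p.1.getD (n p.2) 0 = v p.2)) (by fun_prop)
    (n := fun a => n a + 1) (by fun_prop)).congr fun i a => ?_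
  rw [decide_eq_true_eq, getD_initialSegment _ (Nat.lt_succ_self _)]

theorem and (hR : SemidecidableIn o R) (hS : SemidecidableIn o S) :
    SemidecidableIn o fun i a => R i a ∧ S i a := by
  obtain ⟨f, hf, mf, ef⟩ := hR
  obtain ⟨g, hg, mg, eg⟩ := hS
  refine ⟨fun p => f p && g p, by fun_prop, ?_, fun i a => ?_⟩
  · intro i a k l hkl
    simp only [Bool.and_eq_true]
    exact fun h => ⟨mf i a k l hkl h.1, mg i a k l hkl h.2⟩
  · simp only [Bool.and_eq_true, ef, eg]
    constructor
    · rintro ⟨⟨k, hk⟩, l, hl⟩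
      exact ⟨max k l, mf i a _ _ (le_max_left _ _) hk, mg i a _ _ (le_max_right _ _) hl⟩
    · rintro ⟨k, hk, hl⟩; exact ⟨⟨k, hk⟩, k, hl⟩

theorem or (hR : SemidecidableIn o R) (hS : SemidecidableIn o S) :
    SemidecidableIn o fun i a => R i a ∨ S i a := by
  obtain ⟨f, hf, mf, ef⟩ := hR
  obtain ⟨g, hg, mg, eg⟩ := hS
  refine ⟨fun p => f p || g p, by fun_prop, ?_, fun i a => ?_⟩
  · intro i a k l hkl
    simp only [Bool.or_eq_true]
    exact Or.imp (mf i a k l hkl) (mg i a k l hkl)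
  · simp only [Bool.or_eq_true, ef, eg, ← exists_or]

theorem comp (hR : SemidecidableIn o R) {g : β → α} (hg : Computable g) :
    SemidecidableIn o fun i b => R i (g b) := by
  obtain ⟨f, hf, mf, ef⟩ := hR
  exact ⟨fun p => f (p.1, g p.2), by fun_prop, fun i b k l => mf i (g b) k l, fun i b => ef i (g b)⟩

theorem proj {R : I → α × β → Prop} (hR : SemidecidableIn o R) :
    SemidecidableIn o fun i a => ∃ b, R i (a, b) := by
  obtain ⟨f, hf, mf, ef⟩ := hR
  have hc : Computable₂ fun (q : List ℕ × α × ℕ) (b : β) => f (q.1, q.2.1, b) := by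
    unfold Computable₂; fun_prop
  have h : Computable fun q : List ℕ × α × ℕ =>
      (((Encodable.decode q.2.2 : Option β).map fun b => f (q.1, q.2.1, b))).getD false :=
    Computable.option_getD (Computable.option_map
      (Computable.decode.comp (by fun_prop : Computable fun q : List ℕ × α × ℕ => q.2.2)) hc)
      (Computable.const false)
  refine mk h fun i a => ?_
  constructor
  · rintro ⟨b, hb⟩
    obtain ⟨k, hk⟩ := (ef i (a, b)).1 hb
    exact ⟨k, Encodable.encode b, by simpa using hk⟩
  · rintro ⟨k, n, hn⟩
    cases e : (Encodable.decode n : Option β) with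
    | none => simp [e] at hn
    | some b => exact ⟨b, (ef i (a, b)).2 ⟨k, by simpa [e] using hn⟩⟩

theorem ex {R : I → α → β → Prop} (hR : SemidecidableIn o fun i (p : α × β) => R i p.1 p.2) :
    SemidecidableIn o fun i a => ∃ b, R i a b := hR.proj

/-- By monotonicity of acceptance, one prefix that is long enough serves finitely many instances at
once. -/
theorem ball {R : I → α → ℕ → Prop} (hR : SemidecidableIn o fun i (p : α × ℕ) => R i p.1 p.2)
    {n : α → ℕ} (hn : Computable n) : SemidecidableIn o fun i a => ∀ j < n a, R i a j := by
  obtain ⟨f, hf, mf, ef⟩ := hR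
  refine ⟨fun p => (List.range (n p.2)).all fun j => f (p.1, p.2, j),
    computable_all_range (f := fun q : (List ℕ × α) × ℕ => f (q.1.1, q.1.2, q.2)) (by fun_prop)
      (by fun_prop), ?_, ?_⟩
  · intro i a k l hkl
    simp only [List.all_eq_true, List.mem_range]
    exact fun h j hj => mf i (a, j) k l hkl (h j hj)
  · intro i a
    simp only [List.all_eq_true, List.mem_range]
    constructor
    · intro h
      have h' : ∀ j < n a, ∃ k, f (initialSegment (o i) k, a, j) = true :=
        fun j hj => (ef i (a, j)).1 (h j hj)
      choose! K hK using h'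
      refine ⟨(Finset.range (n a)).sup K, fun j hj => ?_⟩
      exact mf i (a, j) _ _ (Finset.le_sup (Finset.mem_range.2 hj)) (hK j hj)
    · rintro ⟨k, hk⟩ j hj
      exact (ef i (a, j)).2 ⟨k, hk j hj⟩

theorem ex_lt {R : I → α → ℕ → Prop} (hR : SemidecidableIn o fun i (p : α × ℕ) => R i p.1 p.2)
    {n : α → ℕ} (hn : Computable n) : SemidecidableIn o fun i a => ∃ j < n a, R i a j :=
  ex ((of_decide (p := fun p : α × ℕ => p.2 < n p.1) (by fun_prop)).and hR)

/-- Substituting a value that is found by a semidecidable graph. -/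
theorem subst_value {R : I → α × β → Prop} (hR : SemidecidableIn o R) {g : I → α → β}
    (hg : SemidecidableIn o fun i (p : α × β) => g i p.1 = p.2) :
    SemidecidableIn o fun i a => R i (a, g i a) := by
  refine (hg.and hR).proj.congr fun i a => ?_
  constructor
  · exact fun h => ⟨_, rfl, h⟩
  · rintro ⟨b, hb, h⟩
    obtain rfl : g i a = b := hb
    exact h

/-- Substituting an oracle computed from the given one. -/
theorem subst {oJ : J → ℕ → ℕ} {R : J → β → Prop} (hR : SemidecidableIn oJ R) {φ : I → α → J}
    (hφ : SemidecidableIn o fun i (p : α × ℕ × ℕ) => oJ (φ i p.1) p.2.1 = p.2.2) :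
    SemidecidableIn o fun i (p : α × β) => R (φ i p.1) p.2 := by
  obtain ⟨f, hf, mf, ef⟩ := hR
  -- A finite list is guessed and verified to be an initial segment of the computed oracle; the
  -- given test is then run on it.
  have h1 : SemidecidableIn o fun i (p : (α × β) × List ℕ) =>
      (∀ j < p.2.length, oJ (φ i p.1.1) j = p.2.getD j 0) ∧ f (p.2, p.1.2) = true :=
    (ball (hφ.comp (g := fun p : ((α × β) × List ℕ) × ℕ => (p.1.1.1, p.2, p.1.2.getD p.2 0))
      (by fun_prop)) (by fun_prop)).and (of_computable (by fun_prop))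
  refine h1.proj.congr fun i p => ?_
  rw [ef]
  constructor
  · rintro ⟨k, hk⟩
    refine ⟨initialSegment (oJ (φ i p.1)) k, ?_, hk⟩
    rw [← eq_initialSegment_iff]; simp
  · rintro ⟨l, hl, h2⟩
    rw [← eq_initialSegment_iff] at hl
    exact ⟨l.length, by rwa [← hl]⟩

/-- A total semidecidable relation has a selector whose graph is semidecidable. -/
theorem exists_selector {R : I → α × ℕ → Prop} (hR : SemidecidableIn o R)
    (htot : ∀ i a, ∃ v, R i (a, v)) :
    ∃ G : I → α → ℕ, SemidecidableIn o (fun i (p : α × ℕ) => G i p.1 = p.2) ∧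
      ∀ i a, R i (a, G i a) := by
  classical
  obtain ⟨f, hf, mf, ef⟩ := hR
  -- The number `m` codes a prefix length together with a candidate value. Acceptance at exactly
  -- this length is decided by a finite part of the oracle, and so is rejection; hence being the
  -- first accepted `m` is semidecidable. Being the least `v` that satisfies the relation would not
  -- be in general.
  have hex : ∀ i a, ∃ m : ℕ, f (initialSegment (o i) m.unpair.1, a, m.unpair.2) = true ∧
      ∀ l < m, ¬f (initialSegment (o i) l.unpair.1, a, l.unpair.2) = true := by
    intro i a
    obtain ⟨v, hv⟩ := htot i a
    obtain ⟨k, hk⟩ := (ef i (a, v)).1 hv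
    have h : ∃ m : ℕ, f (initialSegment (o i) m.unpair.1, a, m.unpair.2) = true :=
      ⟨Nat.pair k v, by simpa using hk⟩
    exact ⟨Nat.find h, Nat.find_spec h, fun l hl => Nat.find_min h hl⟩
  choose M hM hM' using hex
  refine ⟨fun i a => (M i a).unpair.2, ?_, fun i a => (ef i _).2 ⟨_, hM i a⟩⟩
  have h1 : SemidecidableIn o fun i (p : (α × ℕ) × ℕ) =>
      f (initialSegment (o i) p.2.unpair.1, p.1.1, p.2.unpair.2) = true :=
    segment (b := fun q : List ℕ × (α × ℕ) × ℕ => f (q.1, q.2.1.1, q.2.2.unpair.2))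
      (n := fun q => q.2.unpair.1) (by fun_prop) (by fun_prop)
  have h2 : SemidecidableIn o fun i (p : ((α × ℕ) × ℕ) × ℕ) =>
      (!f (initialSegment (o i) p.2.unpair.1, p.1.1.1, p.2.unpair.2)) = true :=
    segment (b := fun q : List ℕ × ((α × ℕ) × ℕ) × ℕ => !f (q.1, q.2.1.1.1, q.2.2.unpair.2))
      (n := fun q => q.2.unpair.1) (by fun_prop) (by fun_prop)
  have h3 : SemidecidableIn o fun i (p : (α × ℕ) × ℕ) => ∀ m < p.2,
      (!f (initialSegment (o i) m.unpair.1, p.1.1, m.unpair.2)) = true :=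
    ball (R := fun i (p : (α × ℕ) × ℕ) m =>
      (!f (initialSegment (o i) m.unpair.1, p.1.1, m.unpair.2)) = true) h2 (n := Prod.snd)
      (by fun_prop)
  have h4 : SemidecidableIn o fun _ (p : (α × ℕ) × ℕ) => p.2.unpair.2 = p.1.2 :=
    of_decide (computable_decide_eq (by fun_prop) (by fun_prop))
  refine (h4.and (h1.and h3)).proj.congr fun i p => ?_
  constructor
  · intro h
    exact ⟨M i p.1, h, hM i p.1, fun m hm => by simpa using hM' i p.1 m hm⟩
  · rintro ⟨m, h2, h3, h4⟩
    have : M i p.1 = m := by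
      rcases lt_trichotomy (M i p.1) m with h | h | h
      · exact absurd (hM i p.1) (by simpa using h4 _ h)
      · exact h
      · exact absurd h3 (hM' i p.1 m h)
    simpa only [this] using h2

/-- A semidecidable relation is uniformized by a computable functional. -/
theorem exists_functional {R : I → ℕ × ℕ → Prop} (hR : SemidecidableIn o R) :
    ∃ F, ComputableFunctional F ∧ ∀ i n, (∃ v, R i (n, v)) → ∃ v ∈ F (o i) n, R i (n, v) := by
  obtain ⟨f, hf, mf, ef⟩ := hR
  -- The candidate value is read off from the length of the prefix. Each `v` is the first component
  -- of arbitrarily large lengths, so it is tried with prefixes long enough for the test to accept.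
  let φ : List ℕ → ℕ → Option ℕ := fun l n =>
    if f (l, n, l.length.unpair.1) = true then some l.length.unpair.1 else none
  have hφ : Computable₂ φ := by
    have : Computable fun p : List ℕ × ℕ =>
        if f (p.1, p.2, p.1.length.unpair.1) = true then some p.1.length.unpair.1 else none :=
      computable_ite (by simpa using (by fun_prop : Computable fun p : List ℕ × ℕ =>
        f (p.1, p.2, p.1.length.unpair.1))) (by fun_prop) (by fun_prop)
    exact this
  refine ⟨fun h n => Nat.rfindOpt fun k => φ (initialSegment h k) n, ⟨φ, hφ, fun _ _ => rfl⟩, ?_⟩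
  rintro i n ⟨v, hv⟩
  obtain ⟨k, hk⟩ := (ef i _).1 hv
  have hd : (Nat.rfindOpt fun k => φ (initialSegment (o i) k) n).Dom := by
    rw [Nat.rfindOpt_dom]
    refine ⟨Nat.pair v k, v, ?_⟩
    simp only [φ, length_initialSegment, Nat.unpair_pair, Option.mem_def]
    rw [if_pos (mf i _ k _ (Nat.right_le_pair v k) hk)]
  obtain ⟨w, hw⟩ := Part.dom_iff_mem.1 hd
  refine ⟨w, hw, ?_⟩
  obtain ⟨m, hm⟩ := Nat.rfindOpt_spec hw
  simp only [φ, length_initialSegment, Option.mem_def, Option.ite_none_right_eq_some,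
    Option.some.injEq] at hm
  rw [← hm.2]
  exact (ef i _).2 ⟨m, hm.1⟩

end SemidecidableIn

theorem mem_rfindOpt_iff {δ : Type*} {f : ℕ → Option δ} {v : δ} :
    v ∈ Nat.rfindOpt f ↔ ∃ k, f k = some v ∧ ∀ m < k, f m = none := by
  unfold Nat.rfindOpt
  rw [Part.mem_bind_iff]
  refine exists_congr fun k => (and_congr_left' Nat.mem_rfind).trans ?_
  constructor
  · rintro ⟨⟨_, h3⟩, h4⟩
    exact ⟨by simpa using h4, fun m hm => by simpa using h3 hm⟩
  · rintro ⟨h3, h4⟩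
    exact ⟨⟨by simp [h3], fun hm => by simp [h4 _ hm]⟩, by simp [h3]⟩

/-- The graph of a computable functional is semidecidable. -/
theorem ComputableFunctional.semidecidableIn {F : (ℕ → ℕ) → ℕ →. ℕ} (hF : ComputableFunctional F) :
    SemidecidableIn (fun h : ℕ → ℕ => h) fun h (p : ℕ × ℕ) => p.2 ∈ F h p.1 := by
  obtain ⟨φ, hφ, e⟩ := hF
  have h1 : Computable fun q : List ℕ × ℕ => φ q.1 q.2 := hφ
  have h2 : SemidecidableIn (fun h : ℕ → ℕ => h) fun h (q : (ℕ × ℕ) × ℕ) =>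
      decide (φ (initialSegment h q.2) q.1.1 = some q.1.2) = true :=
    .segment (b := fun r : List ℕ × (ℕ × ℕ) × ℕ => decide (φ r.1 r.2.1.1 = some r.2.1.2))
      (n := fun q => q.2) (computable_decide_eq (h1.comp (g := fun r : List ℕ × (ℕ × ℕ) × ℕ =>
        (r.1, r.2.1.1)) (by fun_prop)) (by fun_prop)) (by fun_prop)
  have h3 : SemidecidableIn (fun h : ℕ → ℕ => h) fun h (q : ((ℕ × ℕ) × ℕ) × ℕ) =>
      decide (φ (initialSegment h q.2) q.1.1.1 = none) = true :=
    .segment (b := fun r : List ℕ × ((ℕ × ℕ) × ℕ) × ℕ => decide (φ r.1 r.2.1.1.1 = none))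
      (n := fun q => q.2) (computable_decide_eq (h1.comp (g := fun r : List ℕ ×
        ((ℕ × ℕ) × ℕ) × ℕ => (r.1, r.2.1.1.1)) (by fun_prop)) (by fun_prop)) (by fun_prop)
  have h4 : SemidecidableIn (fun h : ℕ → ℕ => h) fun h (q : (ℕ × ℕ) × ℕ) =>
      ∀ m < q.2, decide (φ (initialSegment h m) q.1.1 = none) = true :=
    .ball (R := fun h (q : (ℕ × ℕ) × ℕ) m => decide (φ (initialSegment h m) q.1.1 = none) = true)
      h3 (n := Prod.snd) (by fun_prop)
  refine (h2.and h4).proj.congr fun h p => ?_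
  rw [e, mem_rfindOpt_iff]
  simp only [decide_eq_true_eq]

end Semidecidable

/-! ### Real numbers computable in an oracle -/

section Reals

variable {I J α β : Type*} [Primcodable α] [Primcodable β] {o : I → ℕ → ℕ}

/-- The lower cuts of the reals `f i a` are semidecidable in the oracle. -/
def LowerIn (o : I → ℕ → ℕ) (f : I → α → ℝ) : Prop :=
  SemidecidableIn o fun i (p : α × ℚ) => (p.2 : ℝ) < f i p.1

/-- The reals `f i a` are computable in the oracle, uniformly in `a`. -/
def ComputableRealIn (o : I → ℕ → ℕ) (f : I → α → ℝ) : Prop :=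
  LowerIn o f ∧ LowerIn o fun i a => -f i a

namespace LowerIn

variable {f g : I → α → ℝ}

theorem congr (hf : LowerIn o f) (h : ∀ i a, g i a = f i a) : LowerIn o g := by
  obtain rfl : g = f := by ext i a; exact h i a
  exact hf

theorem lt (hf : LowerIn o f) {q : β → ℚ} {u : β → α} (hq : Computable q) (hu : Computable u) :
    SemidecidableIn o fun i b => (q b : ℝ) < f i (u b) :=
  SemidecidableIn.comp hf (computable_mk hu hq)

theorem comp (hf : LowerIn o f) {u : β → α} (hu : Computable u) :
    LowerIn o fun i b => f i (u b) :=
  hf.lt (q := fun p : β × ℚ => p.2) (u := fun p => u p.1) (by fun_prop) (by fun_prop)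

theorem subst {oJ : J → ℕ → ℕ} {f : J → β → ℝ} (hf : LowerIn oJ f) {φ : I → α → J}
    (hφ : SemidecidableIn o fun i (p : α × ℕ × ℕ) => oJ (φ i p.1) p.2.1 = p.2.2) :
    LowerIn o fun i (p : α × β) => f (φ i p.1) p.2 :=
  (SemidecidableIn.subst hf hφ).comp (g := fun q : (α × β) × ℚ => (q.1.1, q.1.2, q.2))
    (by fun_prop)

theorem of_rat {f : α → ℚ} (hf : Computable f) : LowerIn o fun _ a => (f a : ℝ) :=
  (SemidecidableIn.of_decide (o := o) (p := fun p : α × ℚ => p.2 < f p.1)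
    (computable_rat_decide_lt (by fun_prop) (by fun_prop))).congr fun i p => Rat.cast_lt

/-- A rational lies below a sum exactly if it splits into two rationals that lie below the summands;
the search is for the first of them. -/
theorem add (hf : LowerIn o f) (hg : LowerIn o g) : LowerIn o fun i a => f i a + g i a := by
  have h : SemidecidableIn o fun i (p : (α × ℚ) × ℚ) =>
      (p.2 : ℝ) < f i p.1.1 ∧ ((p.1.2 - p.2 : ℚ) : ℝ) < g i p.1.1 :=
    (hf.lt (q := fun p : (α × ℚ) × ℚ => p.2) (u := fun p => p.1.1) (by fun_prop)
      (by fun_prop)).and (hg.lt (q := fun p : (α × ℚ) × ℚ => p.1.2 - p.2) (u := fun p => p.1.1)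
      (by fun_prop) (by fun_prop))
  refine h.proj.congr fun i p => ?_
  constructor
  · intro h
    obtain ⟨r, h1, h2⟩ := exists_rat_btwn (sub_lt_iff_lt_add.2 h)
    exact ⟨r, h2, by push_cast; linarith⟩
  · rintro ⟨r, h1, h2⟩
    push_cast at h2
    simp only at h1 h2
    linarith

/-- Substituting a value that is found by a semidecidable graph. -/
theorem subst_value {f : I → α × β → ℝ} (hf : LowerIn o f) {g : I → α → β}
    (hg : SemidecidableIn o fun i (p : α × β) => g i p.1 = p.2) :
    LowerIn o fun i a => f i (a, g i a) :=
  (SemidecidableIn.comp hf (g := fun p : (α × ℚ) × β => ((p.1.1, p.2), p.1.2))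
    (by fun_prop)).subst_value (g := fun i p => g i p.1)
    (hg.comp (g := fun p : (α × ℚ) × β => (p.1.1, p.2)) (by fun_prop))

theorem max (hf : LowerIn o f) (hg : LowerIn o g) :
    LowerIn o fun i a => max (f i a) (g i a) :=
  (SemidecidableIn.or hf hg).congr fun _ _ => lt_max_iff

theorem min (hf : LowerIn o f) (hg : LowerIn o g) :
    LowerIn o fun i a => min (f i a) (g i a) :=
  (SemidecidableIn.and hf hg).congr fun _ _ => lt_min_iff

theorem rat_mul (hf : LowerIn o f) {c : α → ℚ} (hc : Computable c) (h0 : ∀ a, 0 < c a) :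
    LowerIn o fun i a => (c a : ℝ) * f i a := by
  refine (hf.lt (q := fun p : α × ℚ => p.2 / c p.1) (u := fun p => p.1) (by fun_prop)
    (by fun_prop)).congr fun i p => ?_
  have : (0 : ℝ) < c p.1 := by exact_mod_cast h0 p.1
  push_cast
  rw [div_lt_iff₀' this]

/-- Suprema of sequences. -/
theorem of_lt_iff_exists {f : I → α → ℕ → ℝ} (hf : LowerIn o fun i (p : α × ℕ) => f i p.1 p.2)
    {g : I → α → ℝ} (h : ∀ i a (q : ℝ), q < g i a ↔ ∃ n, q < f i a n) : LowerIn o g := by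
  have h1 : SemidecidableIn o fun i (p : (α × ℚ) × ℕ) => (p.1.2 : ℝ) < f i p.1.1 p.2 :=
    hf.lt (q := fun p : (α × ℚ) × ℕ => p.1.2) (u := fun p => (p.1.1, p.2)) (by fun_prop)
      (by fun_prop)
  exact h1.proj.congr fun i p => h i p.1 p.2

theorem _root_.SchnorrRandomness.exists_rat_lt_sum {f : ℕ → ℝ} (n : ℕ) {q : ℝ}
    (h : q < ∑ j ∈ Finset.range n, f j) :
    ∃ r : ℕ → ℚ, (∀ j < n, (r j : ℝ) < f j) ∧ q < ∑ j ∈ Finset.range n, (r j : ℝ) := by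
  induction n generalizing q with
  | zero => exact ⟨fun _ => 0, by simp, by simpa using h⟩
  | succ n ih =>
    rw [Finset.sum_range_succ, ← sub_lt_iff_lt_add'] at h
    obtain ⟨s, h1, h2⟩ := exists_rat_btwn h
    obtain ⟨r, hr, hq⟩ := ih (q := q - s) (by linarith)
    have e : ∀ j < n, Function.update r n s j = r j :=
      fun j hj => Function.update_of_ne hj.ne _ _
    refine ⟨Function.update r n s, fun j hj => ?_, ?_⟩
    · rcases Nat.lt_succ_iff_lt_or_eq.1 hj with hj | rfl
      · rw [e j hj]; exact hr j hj
      · simpa using h2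
    · rw [Finset.sum_range_succ, Finset.sum_congr rfl (g := fun j => (r j : ℝ))
        fun j hj => by rw [e j (Finset.mem_range.1 hj)]]
      simp only [Function.update_self]
      linarith

/-- The last factor is lowered to a positive rational `s` by so little that `q / s` is still below
the product of the other factors. This is possible because that product is positive as soon as `0 ≤
q` is below the whole. -/
theorem _root_.SchnorrRandomness.exists_rat_lt_prod {f : ℕ → ℝ} (hf : ∀ j, 0 ≤ f j) (n : ℕ) {q : ℝ}
    (hq0 : 0 ≤ q) (h : q < ∏ j ∈ Finset.range n, f j) :
    ∃ r : ℕ → ℚ, (∀ j < n, 0 ≤ r j ∧ (r j : ℝ) < f j) ∧ q < ∏ j ∈ Finset.range n, (r j : ℝ) := by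
  induction n generalizing q with
  | zero => exact ⟨fun _ => 0, by simp, by simpa using h⟩
  | succ n ih =>
    rw [Finset.prod_range_succ] at h
    have hP : 0 < ∏ j ∈ Finset.range n, f j := by
      refine lt_of_le_of_ne (Finset.prod_nonneg fun j _ => hf j) fun e => ?_
      rw [← e, zero_mul] at h
      exact absurd h (not_lt.2 hq0)
    obtain ⟨s, h1, h2⟩ := exists_rat_btwn ((div_lt_iff₀' hP).2 h)
    have hs : (0 : ℝ) < s := lt_of_le_of_lt (by positivity) h1
    obtain ⟨r, hr, hq⟩ := ih (q := q / s) (by positivity) (by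
      rw [div_lt_iff₀ hs]; rwa [div_lt_iff₀' hP] at h1)
    have e : ∀ j < n, Function.update r n s j = r j :=
      fun j hj => Function.update_of_ne hj.ne _ _
    refine ⟨Function.update r n s, fun j hj => ?_, ?_⟩
    · rcases Nat.lt_succ_iff_lt_or_eq.1 hj with hj | rfl
      · rw [e j hj]; exact hr j hj
      · simpa using ⟨by exact_mod_cast hs.le, h2⟩
    · rw [Finset.prod_range_succ, Finset.prod_congr rfl (g := fun j => (r j : ℝ))
        fun j hj => by rw [e j (Finset.mem_range.1 hj)]]
      simp only [Function.update_self]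
      rwa [div_lt_iff₀ hs] at hq

theorem _root_.SchnorrRandomness.getD_map_range {σ : Type*} (r : ℕ → σ) (d : σ) {j n : ℕ} (hj : j < n) :
    ((List.range n).map r).getD j d = r j := by
  simp [hj]

theorem sum_range {f : I → α → ℕ → ℝ} (hf : LowerIn o fun i (p : α × ℕ) => f i p.1 p.2)
    {n : α → ℕ} (hn : Computable n) :
    LowerIn o fun i a => ∑ j ∈ Finset.range (n a), f i a j := by
  have h1 : SemidecidableIn o fun i (p : ((α × ℚ) × List ℚ) × ℕ) =>
      ((p.1.2.getD p.2 0 : ℚ) : ℝ) < f i p.1.1.1 p.2 :=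
    hf.lt (q := fun p : ((α × ℚ) × List ℚ) × ℕ => p.1.2.getD p.2 0)
      (u := fun p => (p.1.1.1, p.2)) (by fun_prop) (by fun_prop)
  have h2 : SemidecidableIn o fun i (p : (α × ℚ) × List ℚ) =>
      ∀ j < n p.1.1, ((p.2.getD j 0 : ℚ) : ℝ) < f i p.1.1 j :=
    SemidecidableIn.ball (R := fun i (p : (α × ℚ) × List ℚ) j =>
      ((p.2.getD j 0 : ℚ) : ℝ) < f i p.1.1 j) h1 (n := fun p => n p.1.1) (by fun_prop)
  have h3 : Computable fun p : (α × ℚ) × List ℚ =>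
      ∑ j ∈ Finset.range (n p.1.1), p.2.getD j 0 :=
    computable_rat_sum_range (f := fun p : ((α × ℚ) × List ℚ) × ℕ => p.1.2.getD p.2 0)
      (by fun_prop) (by fun_prop)
  have h4 : SemidecidableIn o fun _ (p : (α × ℚ) × List ℚ) =>
      p.1.2 < ∑ j ∈ Finset.range (n p.1.1), p.2.getD j 0 :=
    .of_decide (computable_rat_decide_lt (by fun_prop) h3)
  refine (h2.and h4).proj.congr fun i p => ?_
  constructor
  · intro h
    obtain ⟨r, hr, hq⟩ := exists_rat_lt_sum _ h
    refine ⟨(List.range (n p.1)).map r, fun j hj => ?_, ?_⟩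
    · simp only [getD_map_range r 0 hj]; exact hr j hj
    · simp only
      rw [Finset.sum_congr rfl fun j hj => getD_map_range r 0 (Finset.mem_range.1 hj)]
      exact_mod_cast hq
  · rintro ⟨L, h5, h6⟩
    calc (p.2 : ℝ) < ((∑ j ∈ Finset.range (n p.1), L.getD j 0 : ℚ) : ℝ) := Rat.cast_lt.2 h6
      _ = ∑ j ∈ Finset.range (n p.1), ((L.getD j 0 : ℚ) : ℝ) := by push_cast; rfl
      _ ≤ _ := Finset.sum_le_sum fun j hj => (h5 j (Finset.mem_range.1 hj)).le

theorem prod_range {f : I → α → ℕ → ℝ} (hf : LowerIn o fun i (p : α × ℕ) => f i p.1 p.2)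
    (h0 : ∀ i a j, 0 ≤ f i a j) {n : α → ℕ} (hn : Computable n) :
    LowerIn o fun i a => ∏ j ∈ Finset.range (n a), f i a j := by
  have h1 : SemidecidableIn o fun i (p : ((α × ℚ) × List ℚ) × ℕ) =>
      0 ≤ p.1.2.getD p.2 0 ∧ ((p.1.2.getD p.2 0 : ℚ) : ℝ) < f i p.1.1.1 p.2 :=
    (SemidecidableIn.of_decide (p := fun p : ((α × ℚ) × List ℚ) × ℕ => 0 ≤ p.1.2.getD p.2 0)
      (computable_rat_decide_le (by fun_prop) (by fun_prop))).and
    (hf.lt (q := fun p : ((α × ℚ) × List ℚ) × ℕ => p.1.2.getD p.2 0)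
      (u := fun p => (p.1.1.1, p.2)) (by fun_prop) (by fun_prop))
  have h2 : SemidecidableIn o fun i (p : (α × ℚ) × List ℚ) =>
      ∀ j < n p.1.1, 0 ≤ p.2.getD j 0 ∧ ((p.2.getD j 0 : ℚ) : ℝ) < f i p.1.1 j :=
    SemidecidableIn.ball (R := fun i (p : (α × ℚ) × List ℚ) j =>
      0 ≤ p.2.getD j 0 ∧ ((p.2.getD j 0 : ℚ) : ℝ) < f i p.1.1 j) h1 (n := fun p => n p.1.1)
      (by fun_prop)
  have h3 : Computable fun p : (α × ℚ) × List ℚ =>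
      ∏ j ∈ Finset.range (n p.1.1), p.2.getD j 0 :=
    computable_rat_prod_range (f := fun p : ((α × ℚ) × List ℚ) × ℕ => p.1.2.getD p.2 0)
      (by fun_prop) (by fun_prop)
  have h4 : SemidecidableIn o fun _ (p : (α × ℚ) × List ℚ) =>
      p.1.2 < ∏ j ∈ Finset.range (n p.1.1), p.2.getD j 0 :=
    .of_decide (computable_rat_decide_lt (by fun_prop) h3)
  -- Negative rationals are accepted outright: if a factor vanishes, no nonnegative rational lies
  -- strictly below it, and the search for lower bounds of the factors finds nothing.
  have h5 : SemidecidableIn o fun _ (p : α × ℚ) => p.2 < 0 :=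
    .of_decide (computable_rat_decide_lt (by fun_prop) (by fun_prop))
  refine (h5.or (h2.and h4).proj).congr fun i p => ?_
  constructor
  · intro h
    rcases lt_or_ge p.2 0 with h6 | h6
    · exact Or.inl h6
    obtain ⟨r, hr, hq⟩ := exists_rat_lt_prod (h0 i p.1) _ (by exact_mod_cast h6) h
    refine Or.inr ⟨(List.range (n p.1)).map r, fun j hj => ?_, ?_⟩
    · simp only [getD_map_range r 0 hj]; exact hr j hj
    · simp only
      rw [Finset.prod_congr rfl fun j hj => getD_map_range r 0 (Finset.mem_range.1 hj)]
      exact_mod_cast hq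
  · rintro (h6 | ⟨L, h5, h6⟩)
    · exact lt_of_lt_of_le (by exact_mod_cast h6) (Finset.prod_nonneg fun j _ => h0 i p.1 j)
    calc (p.2 : ℝ) < ((∏ j ∈ Finset.range (n p.1), L.getD j 0 : ℚ) : ℝ) := Rat.cast_lt.2 h6
      _ = ∏ j ∈ Finset.range (n p.1), ((L.getD j 0 : ℚ) : ℝ) := by push_cast; rfl
      _ ≤ _ := Finset.prod_le_prod
        (fun j hj => by exact_mod_cast (h5 j (Finset.mem_range.1 hj)).1)
        fun j hj => (h5 j (Finset.mem_range.1 hj)).2.le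

/-- `exp x` is the supremum of `(1 + r / n) ^ n` over rationals `r < x` and `n > -r`. The second
condition keeps the base positive, so that each power is at most `exp r`. -/
theorem exp (hf : LowerIn o f) : LowerIn o fun i a => Real.exp (f i a) := by
  have h1 : SemidecidableIn o fun i (p : (α × ℚ) × ℚ × ℕ) => (p.2.1 : ℝ) < f i p.1.1 :=
    hf.lt (q := fun p : (α × ℚ) × ℚ × ℕ => p.2.1) (u := fun p => p.1.1) (by fun_prop) (by fun_prop)
  have h2 : SemidecidableIn o fun _ (p : (α × ℚ) × ℚ × ℕ) =>
      -(p.2.2 : ℚ) < p.2.1 :=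
    .of_decide (computable_rat_decide_lt (by fun_prop) (by fun_prop))
  have h3 : SemidecidableIn o fun _ (p : (α × ℚ) × ℚ × ℕ) =>
      p.1.2 < (1 + p.2.1 / (p.2.2 : ℚ)) ^ p.2.2 :=
    .of_decide (computable_rat_decide_lt (by fun_prop) (by fun_prop))
  refine (h1.and (h2.and h3)).proj.congr fun i p => ?_
  constructor
  · intro h
    obtain ⟨r, hr1, hr2⟩ : ∃ r : ℚ, (r : ℝ) < f i p.1 ∧ (p.2 : ℝ) < Real.exp r := by
      have hc : ∀ᶠ x in 𝓝[<] (f i p.1), (p.2 : ℝ) < Real.exp x :=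
        (Real.continuous_exp.continuousAt.tendsto.mono_left nhdsWithin_le_nhds).eventually_const_lt h
      obtain ⟨l, hl, H⟩ := (mem_nhdsLT_iff_exists_Ioo_subset (a := f i p.1)).1 hc
      obtain ⟨r, h4, h5⟩ := exists_rat_btwn (Set.mem_Iio.1 hl)
      exact ⟨r, h5, H ⟨h4, h5⟩⟩
    have h6 := (Real.tendsto_one_add_div_pow_exp (r : ℝ)).eventually_const_lt hr2
    have h7 : ∀ᶠ n : ℕ in atTop, -r < (n : ℚ) := by
      obtain ⟨N, hN⟩ := exists_nat_gt (-r)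
      exact eventually_atTop.2 ⟨N, fun n hn => hN.trans_le (by exact_mod_cast hn)⟩
    obtain ⟨n, h8, h9⟩ := (h6.and h7).exists
    exact ⟨(r, n), hr1, by simp only; linarith, by exact_mod_cast h8⟩
  · rintro ⟨⟨r, n⟩, h4, h5, h6⟩
    simp only at h4 h5 h6
    have h6' : (p.2 : ℝ) < (1 + (r : ℝ) / n) ^ n := by exact_mod_cast h6
    refine h6'.trans_le (le_trans ?_ (Real.exp_le_exp.2 h4.le))
    -- For `n = 0` the power is `1` and the side condition reads `0 < r`, so the bound by `exp r`
    -- persists.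
    rcases Nat.eq_zero_or_pos n with rfl | hn
    · have : (0 : ℝ) < r := by exact_mod_cast (by simpa using h5 : (0 : ℚ) < r)
      simpa using this.le
    · have hn' : (0 : ℝ) < n := by exact_mod_cast hn
      have h5' : -(n : ℝ) < r := by exact_mod_cast h5
      calc (1 + (r : ℝ) / n) ^ n ≤ Real.exp (r / n) ^ n := by
            refine pow_le_pow_left₀ ?_ (by linarith [Real.add_one_le_exp ((r : ℝ) / n)]) n
            have : -1 < (r : ℝ) / n := by rw [lt_div_iff₀ hn']; linarith
            linarith
        _ = Real.exp r := by rw [← Real.exp_nat_mul]; congr 1; field_simp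

/-- For `q < 0`, the inequality `q < -exp x` says that `-1 / q < exp (-x)`, which reduces the upper
cut to the lower cut of an exponential. -/
theorem neg_exp (hf : LowerIn o fun i a => -f i a) : LowerIn o fun i a => -Real.exp (f i a) := by
  have h1 : SemidecidableIn o fun _ (p : α × ℚ) => p.2 < 0 :=
    .of_decide (computable_rat_decide_lt (by fun_prop) (by fun_prop))
  refine (h1.and (hf.exp.lt (q := fun p : α × ℚ => -1 / p.2) (u := fun p => p.1)
    (by fun_prop) (by fun_prop))).congr fun i p => ?_
  push_cast
  have key : ∀ x : ℝ, 0 < x → (Real.exp (f i p.1) < x ↔ 1 / x < Real.exp (-f i p.1)) := by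
    intro x hx
    rw [Real.exp_neg, inv_eq_one_div, one_div_lt_one_div hx (Real.exp_pos _)]
  constructor
  · intro h
    have h2 : (p.2 : ℝ) < 0 := h.trans (neg_lt_zero.2 (Real.exp_pos _))
    refine ⟨by exact_mod_cast h2, ?_⟩
    rw [← neg_div_neg_eq, neg_neg, ← key _ (by linarith)]
    linarith
  · rintro ⟨h2, h3⟩
    have h2 : (p.2 : ℝ) < 0 := by exact_mod_cast h2
    rw [← neg_div_neg_eq, neg_neg, ← key _ (by linarith)] at h3
    linarith

end LowerIn

namespace ComputableRealIn

variable {f g : I → α → ℝ}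

theorem congr (hf : ComputableRealIn o f) (h : ∀ i a, g i a = f i a) : ComputableRealIn o g := by
  obtain rfl : g = f := by ext i a; exact h i a
  exact hf

theorem lt (hf : ComputableRealIn o f) {q : β → ℚ} {u : β → α} (hq : Computable q)
    (hu : Computable u) : SemidecidableIn o fun i b => f i (u b) < (q b : ℝ) :=
  (hf.2.lt (q := fun b => -q b) (by fun_prop) hu).congr fun i b => by
    push_cast; exact neg_lt_neg_iff.symm

theorem comp (hf : ComputableRealIn o f) {u : β → α} (hu : Computable u) :
    ComputableRealIn o fun i b => f i (u b) := ⟨hf.1.comp hu, hf.2.comp hu⟩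

theorem of_rat {f : α → ℚ} (hf : Computable f) : ComputableRealIn o fun _ a => (f a : ℝ) :=
  ⟨.of_rat hf, (LowerIn.of_rat (computable_rat_neg hf)).congr fun _ _ => by push_cast; rfl⟩

theorem neg (hf : ComputableRealIn o f) : ComputableRealIn o fun i a => -f i a :=
  ⟨hf.2, hf.1.congr fun _ _ => neg_neg _⟩

theorem add (hf : ComputableRealIn o f) (hg : ComputableRealIn o g) :
    ComputableRealIn o fun i a => f i a + g i a :=
  ⟨hf.1.add hg.1, (hf.2.add hg.2).congr fun _ _ => neg_add _ _⟩

theorem sub (hf : ComputableRealIn o f) (hg : ComputableRealIn o g) :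
    ComputableRealIn o fun i a => f i a - g i a :=
  (hf.add hg.neg).congr fun _ _ => sub_eq_add_neg _ _

/-- Substituting a value that is found by a semidecidable graph. -/
theorem subst_value {f : I → α × β → ℝ} (hf : ComputableRealIn o f) {g : I → α → β}
    (hg : SemidecidableIn o fun i (p : α × β) => g i p.1 = p.2) :
    ComputableRealIn o fun i a => f i (a, g i a) :=
  ⟨LowerIn.subst_value hf.1 hg, LowerIn.subst_value (f := fun i a => -f i a) hf.2 hg⟩

theorem max (hf : ComputableRealIn o f) (hg : ComputableRealIn o g) :
    ComputableRealIn o fun i a => max (f i a) (g i a) :=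
  ⟨hf.1.max hg.1, (hf.2.min hg.2).congr fun _ _ => neg_sup _ _⟩

theorem min (hf : ComputableRealIn o f) (hg : ComputableRealIn o g) :
    ComputableRealIn o fun i a => min (f i a) (g i a) :=
  ⟨hf.1.min hg.1, (hf.2.max hg.2).congr fun _ _ => neg_inf _ _⟩

theorem abs (hf : ComputableRealIn o f) : ComputableRealIn o fun i a => |f i a| :=
  (hf.max hf.neg).congr fun _ _ => abs_eq_max_neg

theorem rat_mul (hf : ComputableRealIn o f) {c : α → ℚ} (hc : Computable c) (h0 : ∀ a, 0 < c a) :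
    ComputableRealIn o fun i a => (c a : ℝ) * f i a :=
  ⟨hf.1.rat_mul hc h0, (hf.2.rat_mul hc h0).congr fun _ _ => (mul_neg _ _).symm⟩

theorem sum_range {f : I → α → ℕ → ℝ}
    (hf : ComputableRealIn o fun i (p : α × ℕ) => f i p.1 p.2) {n : α → ℕ} (hn : Computable n) :
    ComputableRealIn o fun i a => ∑ j ∈ Finset.range (n a), f i a j :=
  ⟨LowerIn.sum_range hf.1 hn, (LowerIn.sum_range (f := fun i a j => -f i a j) hf.2 hn).congr
    fun _ _ => Finset.sum_neg_distrib _ |>.symm⟩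

theorem exp (hf : ComputableRealIn o f) : ComputableRealIn o fun i a => Real.exp (f i a) :=
  ⟨hf.1.exp, hf.2.neg_exp⟩

/-- Limits with a computable modulus of convergence. -/
theorem of_approx {f : I → α → ℝ} {g : I → α → ℕ → ℝ}
    (hg : ComputableRealIn o fun i (p : α × ℕ) => g i p.1 p.2) {e : α → ℕ → ℚ}
    (he : Computable fun p : α × ℕ => e p.1 p.2)
    (he0 : ∀ a, Tendsto (fun n => (e a n : ℝ)) atTop (𝓝 0))
    (h : ∀ i a n, |g i a n - f i a| ≤ e a n) : ComputableRealIn o f := by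
  have ht : ∀ i a, Tendsto (g i a) atTop (𝓝 (f i a)) := fun i a =>
    tendsto_iff_norm_sub_tendsto_zero.2 (squeeze_zero (fun _ => norm_nonneg _) (h i a) (he0 a))
  have he' : ComputableRealIn o fun _ (p : α × ℕ) => (e p.1 p.2 : ℝ) := .of_rat he
  refine ⟨.of_lt_iff_exists (f := fun i a n => g i a n - e a n) (hg.sub he').1 fun i a q => ?_,
    .of_lt_iff_exists (f := fun i a n => -g i a n - e a n) (hg.neg.sub he').1 fun i a q => ?_⟩
  · constructor
    · intro hq
      have := ((ht i a).sub (he0 a)).eventually_const_lt (by simpa using hq)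
      exact this.exists
    · rintro ⟨n, hn⟩
      linarith [(abs_le.1 (h i a n)).2]
  · constructor
    · intro hq
      have := ((ht i a).neg.sub (he0 a)).eventually_const_lt (by simpa using hq)
      exact this.exists
    · rintro ⟨n, hn⟩
      linarith [(abs_le.1 (h i a n)).1]

end ComputableRealIn

end Reals

/-! ### Points computable in an oracle -/

section CauchyNames

variable {Y Z : Type*} [PseudoMetricSpace Y] [BasicPoints Y] [PseudoMetricSpace Z] [BasicPoints Z]

theorem IsCauchyName.dist_le {h : ℕ → ℕ} {y : Y} (hy : IsCauchyName h y) (i : ℕ) :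
    dist (basic (h i) : Y) y ≤ (1 / 2 : ℝ) ^ i := by
  rw [dist_comm]
  exact le_of_tendsto (hy.2.dist tendsto_const_nhds)
    (eventually_atTop.2 ⟨i, fun j hj => hy.1 i j hj⟩)

/-- The additional factor `1 / 2` pays for the triangle inequality between two terms of the
sequence. -/
theorem isCauchyName_of_dist_le {h : ℕ → ℕ} {y : Y}
    (H : ∀ i, dist (basic (h i) : Y) y ≤ (1 / 2 : ℝ) ^ (i + 1)) : IsCauchyName h y := by
  constructor
  · intro i j hij
    have h1 : (1 / 2 : ℝ) ^ (j + 1) ≤ (1 / 2 : ℝ) ^ (i + 1) :=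
      pow_le_pow_of_le_one (by norm_num) (by norm_num) (by omega)
    calc dist (basic (h j) : Y) (basic (h i)) ≤ dist (basic (h j)) y + dist (basic (h i)) y :=
          dist_triangle_right _ _ _
      _ ≤ (1 / 2 : ℝ) ^ (i + 1) + (1 / 2 : ℝ) ^ (i + 1) := add_le_add ((H j).trans h1) (H i)
      _ = (1 / 2 : ℝ) ^ i := by ring
  · rw [tendsto_iff_dist_tendsto_zero]
    refine squeeze_zero (fun _ => dist_nonneg) H ?_
    exact (tendsto_pow_atTop_nhds_zero_of_lt_one (by norm_num) (by norm_num)).comp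
      (tendsto_add_atTop_nat 1)

theorem tendsto_half_pow : Tendsto (fun n => (1 / 2 : ℝ) ^ n) atTop (𝓝 0) :=
  tendsto_pow_atTop_nhds_zero_of_lt_one (by norm_num) (by norm_num)

theorem isCauchyName_prod_iff {h : ℕ → ℕ} {p : Y × Z} : IsCauchyName h p ↔
    IsCauchyName (fun i => (h i).unpair.1) p.1 ∧ IsCauchyName (fun i => (h i).unpair.2) p.2 := by
  unfold IsCauchyName
  rw [Prod.tendsto_iff]
  simp only [Prod.dist_eq, max_le_iff]
  constructor
  · rintro ⟨h1, h2, h3⟩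
    exact ⟨⟨fun i j hij => (h1 i j hij).1, h2⟩, fun i j hij => (h1 i j hij).2, h3⟩
  · rintro ⟨⟨h1, h2⟩, h3, h4⟩
    exact ⟨fun i j hij => ⟨h1 i j hij, h3 i j hij⟩, h2, h4⟩

theorem isCauchyName_const (n : ℕ) : IsCauchyName (fun _ => n) n :=
  ⟨fun i j _ => by rw [dist_self]; positivity, tendsto_const_nhds⟩

theorem IsCauchyName.apply_one {h : ℕ → ℕ} {n : ℕ} (hn : IsCauchyName h n) : h 1 = n := by
  have h1 := hn.dist_le 1
  rw [Nat.dist_eq] at h1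
  have h2 : |((h 1 : ℤ) : ℝ) - ((n : ℤ) : ℝ)| < 1 := lt_of_le_of_lt h1 (by norm_num)
  rw [← Int.cast_sub, ← Int.cast_abs] at h2
  have h3 : |(h 1 : ℤ) - n| < 1 := by exact_mod_cast h2
  rw [Int.abs_lt_one_iff] at h3
  omega

theorem baire_dist_le_iff {g h : ℕ → ℕ} {n : ℕ} :
    dist g h ≤ (1 / 2 : ℝ) ^ n ↔ ∀ i < n, g i = h i := by
  have := PiNat.mem_cylinder_iff_dist_le (x := h) (y := g) (n := n)
  rw [PiNat.mem_cylinder_iff] at this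
  exact this.symm

theorem basic_baire_apply (n k : ℕ) :
    (basic n : ℕ → ℕ) k = (Denumerable.ofNat (List ℕ) n).getD k 0 := rfl

theorem basic_encode_apply (l : List ℕ) (k : ℕ) :
    (basic (Encodable.encode l) : ℕ → ℕ) k = l.getD k 0 := by
  rw [basic_baire_apply, Denumerable.ofNat_encode]

theorem IsCauchyName.apply_baire {H h : ℕ → ℕ} (hH : IsCauchyName H h) (i : ℕ) :
    h i = (Denumerable.ofNat (List ℕ) (H (i + 1))).getD i 0 :=
  (baire_dist_le_iff.1 (hH.dist_le (i + 1)) i (Nat.lt_succ_self i)).symm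

theorem isCauchyName_initialSegment (h : ℕ → ℕ) :
    IsCauchyName (fun i => Encodable.encode (initialSegment h (i + 1))) h := by
  refine isCauchyName_of_dist_le fun i => baire_dist_le_iff.2 fun j hj => ?_
  rw [basic_encode_apply, getD_initialSegment h hj]

end CauchyNames

-- Uniformly computable points and their images under computable maps

section PointIn

variable {I J α β : Type*} [Primcodable α] [Primcodable β] {o : I → ℕ → ℕ}
variable {Y Z : Type*} [PseudoMetricSpace Y] [BasicPoints Y] [PseudoMetricSpace Z] [BasicPoints Z]

/-- The points `y i a` are computable in the oracle `o i`, uniformly in `a`. -/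
def PointIn (o : I → ℕ → ℕ) (y : I → α → Y) : Prop :=
  ∃ G : I → α → ℕ → ℕ, SemidecidableIn o (fun i (p : α × ℕ × ℕ) => G i p.1 p.2.1 = p.2.2) ∧
    ∀ i a, IsCauchyName (G i a) (y i a)

/-- The pairs of a point of `K` and one of its Cauchy names. -/
def Named (K : Set Y) : Type _ := {p : (ℕ → ℕ) × Y // IsCauchyName p.1 p.2 ∧ p.2 ∈ K}

/-- The name of a named point. -/
def Named.name {K : Set Y} (p : Named K) : ℕ → ℕ := p.1.1

/-- The point of a named point. -/
def Named.pt {K : Set Y} (p : Named K) : Y := p.1.2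

theorem Named.isCauchyName {K : Set Y} (p : Named K) : IsCauchyName p.name p.pt := p.2.1

theorem Named.pt_mem {K : Set Y} (p : Named K) : p.pt ∈ K := p.2.2

namespace PointIn

variable {y : I → α → Y} {z : I → α → Z}

theorem comp (hy : PointIn o y) {u : β → α} (hu : Computable u) :
    PointIn o fun i b => y i (u b) := by
  obtain ⟨G, h1, h2⟩ := hy
  exact ⟨fun i b => G i (u b), h1.comp (g := fun p : β × ℕ × ℕ => (u p.1, p.2)) (by fun_prop),
    fun i b => h2 i (u b)⟩

theorem subst {oJ : J → ℕ → ℕ} {y : J → β → Y} (hy : PointIn oJ y) {φ : I → α → J}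
    (hφ : SemidecidableIn o fun i (p : α × ℕ × ℕ) => oJ (φ i p.1) p.2.1 = p.2.2) :
    PointIn o fun i (p : α × β) => y (φ i p.1) p.2 := by
  obtain ⟨G, h1, h2⟩ := hy
  refine ⟨fun i p => G (φ i p.1) p.2, ?_, fun i p => h2 _ _⟩
  exact (h1.subst hφ).comp (g := fun q : (α × β) × ℕ × ℕ => (q.1.1, q.1.2, q.2)) (by fun_prop)

theorem subst_value {y : I → α × β → Y} (hy : PointIn o y) {g : I → α → β}
    (hg : SemidecidableIn o fun i (p : α × β) => g i p.1 = p.2) :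
    PointIn o fun i a => y i (a, g i a) := by
  obtain ⟨G, h1, h2⟩ := hy
  refine ⟨fun i a => G i (a, g i a), ?_, fun i a => h2 _ _⟩
  exact SemidecidableIn.subst_value (β := β) (g := fun i (p : α × ℕ × ℕ) => g i p.1)
    (h1.comp (g := fun q : (α × ℕ × ℕ) × β => ((q.1.1, q.2), q.1.2)) (by fun_prop))
    (hg.comp (g := fun q : (α × ℕ × ℕ) × β => (q.1.1, q.2)) (by fun_prop))

theorem of_dist_le {R : I → α × ℕ × ℕ → Prop} (hR : SemidecidableIn o R)
    (h1 : ∀ i a n, ∃ v, R i (a, n, v))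
    (h2 : ∀ i a n v, R i (a, n, v) → dist (basic v : Y) (y i a) ≤ (1 / 2 : ℝ) ^ n) :
    PointIn o y := by
  obtain ⟨G, h3, h4⟩ := SemidecidableIn.exists_selector (R := fun i (p : (α × ℕ) × ℕ) =>
    R i (p.1.1, p.1.2 + 1, p.2))
    (hR.comp (g := fun p : (α × ℕ) × ℕ => (p.1.1, p.1.2 + 1, p.2)) (by fun_prop))
    fun i p => h1 i p.1 (p.2 + 1)
  exact ⟨fun i a n => G i (a, n), h3.comp (g := fun p : α × ℕ × ℕ => ((p.1, p.2.1), p.2.2))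
    (by fun_prop), fun i a => isCauchyName_of_dist_le fun n => h2 i a _ _ (h4 i (a, n))⟩

theorem prodMk (hy : PointIn o y) (hz : PointIn o z) : PointIn o fun i a => (y i a, z i a) := by
  obtain ⟨G, h1, h2⟩ := hy
  obtain ⟨H, h3, h4⟩ := hz
  refine ⟨fun i a n => Nat.pair (G i a n) (H i a n), ?_, fun i a => ?_⟩
  · refine ((h1.comp (g := fun p : α × ℕ × ℕ => (p.1, p.2.1, p.2.2.unpair.1)) (by fun_prop)).and
      (h3.comp (g := fun p : α × ℕ × ℕ => (p.1, p.2.1, p.2.2.unpair.2)) (by fun_prop))).congr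
      fun i p => ?_
    constructor
    · intro h; simp [← h]
    · rintro ⟨h5, h6⟩
      simp only at h5 h6 ⊢
      rw [h5, h6, Nat.pair_unpair]
  · rw [isCauchyName_prod_iff]
    simpa using ⟨h2 i a, h4 i a⟩

theorem fst {y : I → α → Y × Z} (hy : PointIn o y) : PointIn o fun i a => (y i a).1 := by
  obtain ⟨G, h1, h2⟩ := hy
  refine ⟨fun i a n => (G i a n).unpair.1, ?_, fun i a => (isCauchyName_prod_iff.1 (h2 i a)).1⟩
  exact SemidecidableIn.subst_value (β := ℕ) (R := fun _ (q : (α × ℕ × ℕ) × ℕ) =>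
    q.2.unpair.1 = q.1.2.2) (.of_decide (computable_decide_eq (by fun_prop) (by fun_prop)))
    (g := fun i p => G i p.1 p.2.1)
    (h1.comp (g := fun q : (α × ℕ × ℕ) × ℕ => (q.1.1, q.1.2.1, q.2)) (by fun_prop))

theorem snd {y : I → α → Y × Z} (hy : PointIn o y) : PointIn o fun i a => (y i a).2 := by
  obtain ⟨G, h1, h2⟩ := hy
  refine ⟨fun i a n => (G i a n).unpair.2, ?_, fun i a => (isCauchyName_prod_iff.1 (h2 i a)).2⟩
  exact SemidecidableIn.subst_value (β := ℕ) (R := fun _ (q : (α × ℕ × ℕ) × ℕ) =>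
    q.2.unpair.2 = q.1.2.2) (.of_decide (computable_decide_eq (by fun_prop) (by fun_prop)))
    (g := fun i p => G i p.1 p.2.1)
    (h1.comp (g := fun q : (α × ℕ × ℕ) × ℕ => (q.1.1, q.1.2.1, q.2)) (by fun_prop))

theorem of_nat {n : I → α → ℕ} (hn : SemidecidableIn o fun i (p : α × ℕ) => n i p.1 = p.2) :
    PointIn o n :=
  ⟨fun i a _ => n i a, hn.comp (g := fun p : α × ℕ × ℕ => (p.1, p.2.2)) (by fun_prop),
    fun i a => isCauchyName_const (n i a)⟩

theorem nat_graph {n : I → α → ℕ} (hn : PointIn o n) :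
    SemidecidableIn o fun i (p : α × ℕ) => n i p.1 = p.2 := by
  obtain ⟨G, h1, h2⟩ := hn
  refine (h1.comp (g := fun p : α × ℕ => (p.1, 1, p.2)) (by fun_prop)).congr fun i p => ?_
  simp only
  rw [(h2 i p.1).apply_one]

theorem of_baire {h : I → α → ℕ → ℕ}
    (hh : SemidecidableIn o fun i (p : α × ℕ × ℕ) => h i p.1 p.2.1 = p.2.2) : PointIn o h := by
  have h1 : SemidecidableIn o fun i (p : (α × ℕ × ℕ) × ℕ) =>
      h i p.1.1 p.2 = (Denumerable.ofNat (List ℕ) p.1.2.2).getD p.2 0 :=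
    hh.comp (g := fun p : (α × ℕ × ℕ) × ℕ =>
      (p.1.1, p.2, (Denumerable.ofNat (List ℕ) p.1.2.2).getD p.2 0)) (by fun_prop)
  refine of_dist_le (R := fun i (p : α × ℕ × ℕ) => ∀ j < p.2.1,
    h i p.1 j = (Denumerable.ofNat (List ℕ) p.2.2).getD j 0)
    (SemidecidableIn.ball (R := fun i (p : α × ℕ × ℕ) j =>
      h i p.1 j = (Denumerable.ofNat (List ℕ) p.2.2).getD j 0) h1 (n := fun p => p.2.1)
      (by fun_prop)) ?_ ?_
  · intro i a n
    refine ⟨Encodable.encode (initialSegment (h i a) n), fun j hj => ?_⟩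
    simp only at hj
    rw [Denumerable.ofNat_encode, getD_initialSegment _ hj]
  · intro i a n v hv
    exact baire_dist_le_iff.2 fun j hj => (hv j hj).symm

theorem baire_graph {h : I → α → ℕ → ℕ} (hh : PointIn o h) :
    SemidecidableIn o fun i (p : α × ℕ × ℕ) => h i p.1 p.2.1 = p.2.2 := by
  obtain ⟨G, h1, h2⟩ := hh
  refine (SemidecidableIn.subst_value (β := ℕ) (R := fun _ (q : (α × ℕ × ℕ) × ℕ) =>
    (Denumerable.ofNat (List ℕ) q.2).getD q.1.2.1 0 = q.1.2.2)
    (.of_decide (computable_decide_eq (by fun_prop) (by fun_prop)))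
    (g := fun i p => G i p.1 (p.2.1 + 1))
    (h1.comp (g := fun q : (α × ℕ × ℕ) × ℕ => (q.1.1, q.1.2.1 + 1, q.2)) (by fun_prop))).congr
    fun i p => ?_
  rw [(h2 i p.1).apply_baire]

/-- The terms of a name are rationals with a known error, which makes both cuts semidecidable.
Conversely, if both cuts are semidecidable, a rational within `2⁻ⁿ` can be found by search. -/
theorem real_iff {x : I → α → ℝ} : PointIn o x ↔ ComputableRealIn o x := by
  constructor
  · rintro ⟨G, h1, h2⟩
    have key : ∀ i a n, |(ratOf (G i a n) : ℝ) - x i a| ≤ (1 / 2 : ℝ) ^ n :=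
      fun i a n => (h2 i a).dist_le n
    have hg : ComputableRealIn o fun i (p : α × ℕ) => (ratOf (G i p.1 p.2) : ℝ) := by
      have h3 : SemidecidableIn o fun i (p : (α × ℕ) × ℕ) => G i p.1.1 p.1.2 = p.2 :=
        h1.comp (g := fun p : (α × ℕ) × ℕ => (p.1.1, p.1.2, p.2)) (by fun_prop)
      have h4 : SemidecidableIn o fun _ (q : ((α × ℕ) × ℚ) × ℕ) => q.1.2 < ratOf q.2 :=
        .of_decide (computable_rat_decide_lt (by fun_prop) (by fun_prop))
      have h5 : SemidecidableIn o fun _ (q : ((α × ℕ) × ℚ) × ℕ) => q.1.2 < -ratOf q.2 :=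
        .of_decide (computable_rat_decide_lt (by fun_prop) (by fun_prop))
      have h6 : SemidecidableIn o fun i (p : ((α × ℕ) × ℚ) × ℕ) => G i p.1.1.1 p.1.1.2 = p.2 :=
        h3.comp (g := fun q : ((α × ℕ) × ℚ) × ℕ => (q.1.1, q.2)) (by fun_prop)
      refine ⟨(h4.subst_value (g := fun i p => G i p.1.1 p.1.2) h6).congr fun i p => ?_,
        (h5.subst_value (g := fun i p => G i p.1.1 p.1.2) h6).congr fun i p => ?_⟩
      · exact Rat.cast_lt
      · simp only
        rw [← Rat.cast_neg]; exact Rat.cast_lt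
    refine ComputableRealIn.of_approx (g := fun i a n => (ratOf (G i a n) : ℝ)) hg
      (e := fun _ n => (1 / 2 : ℚ) ^ n) (by fun_prop) (fun a => ?_) (fun i a n => ?_)
    · push_cast; exact tendsto_half_pow
    · push_cast; exact key i a n
  · intro hx
    have h1 : SemidecidableIn o fun i (p : α × ℕ × ℕ) =>
        ((ratOf p.2.2 - (1 / 2) ^ p.2.1 : ℚ) : ℝ) < x i p.1 ∧
        x i p.1 < ((ratOf p.2.2 + (1 / 2) ^ p.2.1 : ℚ) : ℝ) :=
      (hx.1.lt (q := fun p : α × ℕ × ℕ => ratOf p.2.2 - (1 / 2) ^ p.2.1) (u := fun p => p.1)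
        (by fun_prop) (by fun_prop)).and
      (hx.lt (q := fun p : α × ℕ × ℕ => ratOf p.2.2 + (1 / 2) ^ p.2.1) (u := fun p => p.1)
        (by fun_prop) (by fun_prop))
    refine of_dist_le h1 (fun i a n => ?_) fun i a n v => ?_
    · have hn : (0 : ℝ) < (1 / 2) ^ n := by positivity
      obtain ⟨q, h2, h3⟩ := exists_rat_btwn (show x i a - (1 / 2) ^ n < x i a + (1 / 2) ^ n by
        linarith)
      obtain ⟨v, rfl⟩ := ratOf_surjective q
      exact ⟨v, by push_cast; linarith, by push_cast; linarith⟩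
    · rintro ⟨h2, h3⟩
      push_cast at h2 h3
      rw [Real.dist_eq, abs_le]
      change _ ≤ (ratOf v : ℝ) - _ ∧ (ratOf v : ℝ) - _ ≤ _
      constructor <;> linarith

end PointIn

theorem pointIn_named (K : Set Y) : PointIn (α := α) (Named.name (K := K)) fun p _ => p.pt :=
  ⟨fun p _ => p.name, .apply_eq (by fun_prop) (by fun_prop), fun p _ => p.isCauchyName⟩

/-- Together with `ComputableOn.pointIn` this allows computability of maps to be proved without
handling functionals: indexing by named points makes "uniformly in the name" a statement about one
family of oracles. The output name may depend on the input name. -/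
theorem computableOn_of_pointIn {f : Y → Z} {K : Set Y}
    (h : PointIn (Named.name (K := K)) fun p (_ : Unit) => f p.pt) : ComputableOn f K := by
  obtain ⟨G, h1, h2⟩ := h
  obtain ⟨F, hF, hF'⟩ := SemidecidableIn.exists_functional
    (h1.comp (g := fun p : ℕ × ℕ => ((), p)) (by fun_prop))
  refine ⟨F, hF, fun y hy h hn => ⟨G ⟨(h, y), hn, hy⟩ (), fun n => ?_, h2 ⟨(h, y), hn, hy⟩ ()⟩⟩
  obtain ⟨v, h3, h4⟩ := hF' ⟨(h, y), hn, hy⟩ n ⟨G ⟨(h, y), hn, hy⟩ () n, rfl⟩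
  simp only at h4
  rwa [h4]

theorem ComputableOn.pointIn {f : Y → Z} {K : Set Y} (hf : ComputableOn f K) {y : I → α → Y}
    (hy : PointIn o y) (hK : ∀ i a, y i a ∈ K) : PointIn o fun i a => f (y i a) := by
  obtain ⟨F, hF, h⟩ := hf
  obtain ⟨G, h1, h2⟩ := hy
  choose H h3 h4 using fun i a => h (y i a) (hK i a) (G i a) (h2 i a)
  refine ⟨H, ?_, h4⟩
  refine ((hF.semidecidableIn.subst (φ := G) h1)).congr fun i p => ?_
  exact ⟨fun e => e ▸ h3 i p.1 p.2.1, fun e => Part.mem_unique (h3 i p.1 p.2.1) e⟩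

theorem ComputableMap.pointIn {f : Y → Z} (hf : ComputableMap f) {y : I → α → Y}
    (hy : PointIn o y) : PointIn o fun i a => f (y i a) :=
  ComputableOn.pointIn hf hy fun _ _ => Set.mem_univ _

theorem computableMap_of_pointIn {f : Y → Z}
    (h : PointIn (Named.name (K := (Set.univ : Set Y))) fun p (_ : Unit) => f p.pt) :
    ComputableMap f := computableOn_of_pointIn h

/-- Computability of a sequence of maps, in terms of the names of their arguments. -/
theorem computableMap_nat_prod {g : ℕ × Y → Z}
    (h : PointIn (Named.name (K := (Set.univ : Set Y))) fun p n => g (n, p.pt)) :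
    ComputableMap g := by
  refine computableMap_of_pointIn ?_
  have h1 := pointIn_named (α := Unit) (Set.univ : Set (ℕ × Y))
  obtain ⟨G, hG, hG'⟩ := h1.snd
  have h2 := PointIn.subst (o := Named.name (K := (Set.univ : Set (ℕ × Y)))) h
    (φ := fun i a => ⟨(G i a, i.pt.2), hG' i a, Set.mem_univ _⟩) hG
  exact PointIn.subst_value (β := ℕ) h2 (g := fun i _ => i.pt.1) h1.fst.nat_graph

theorem ComputableMap.comp {W : Type*} [PseudoMetricSpace W] [BasicPoints W] {g : Z → W}
    {f : Y → Z} (hg : ComputableMap g) (hf : ComputableMap f) : ComputableMap fun y => g (f y) :=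
  computableMap_of_pointIn (hg.pointIn (hf.pointIn (pointIn_named _)))

end PointIn

/-! ### Randomness is preserved by total computable maps of oracles -/

section Transfer

variable {B C X : Type*} [PseudoMetricSpace B] [BasicPoints B] [PseudoMetricSpace C] [BasicPoints C]
  [PseudoMetricSpace X] [BasicPoints X] [MeasurableSpace X]

theorem IsUniformSchnorrTest.comp {t : C × Measures X × X → ℝ≥0∞} (ht : IsUniformSchnorrTest t)
    {g : B → C} (hg : ComputableMap g) :
    IsUniformSchnorrTest fun p : B × Measures X × X => t (g p.1, p.2) where
  lowerSemicomputable := by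
    obtain ⟨u, hu, h⟩ := ht.lowerSemicomputable
    refine ⟨fun q => u (q.1, g q.2.1, q.2.2), computableMap_nat_prod ?_, fun p => h (g p.1, p.2)⟩
    have h1 := pointIn_named (α := ℕ) (Set.univ : Set (B × Measures X × X))
    exact hu.pointIn (.prodMk (.of_nat (.of_decide (computable_decide_eq (by fun_prop)
      (by fun_prop)))) (.prodMk (hg.pointIn h1.fst) h1.snd))
  lintegral_lt_top b := ht.lintegral_lt_top (g b)
  computable_integral := by
    refine computableMap_of_pointIn ?_
    have h1 := pointIn_named (α := Unit) (Set.univ : Set (B × Measures X))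
    exact ht.computable_integral.pointIn (.prodMk (hg.pointIn h1.fst) h1.snd)

/-- Totality of `g` matters: the pulled back test has to be a test at every oracle, not only at `b`.
-/
theorem mem_SR_map {μ : Measures X} {x : X} {b : B} (hx : x ∈ SR μ b) {g : B → C}
    (hg : ComputableMap g) : x ∈ SR μ (g b) :=
  fun _ ht => hx _ (ht.comp hg)

end Transfer

-- Total computable maps and effectively open sets on Baire space

section Baire

variable {Y : Type*} [PseudoMetricSpace Y] [BasicPoints Y]

theorem computableMap_of_baire {f : (ℕ → ℕ) → Y}
    (h : PointIn (fun h : ℕ → ℕ => h) fun h (_ : Unit) => f h) : ComputableMap f := by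
  refine computableMap_of_pointIn ?_
  have h1 := pointIn_named (α := Unit) (Set.univ : Set (ℕ → ℕ))
  exact (h.subst (φ := fun (p : Named (Set.univ : Set (ℕ → ℕ))) (_ : Unit) => p.pt)
    h1.baire_graph).comp (u := fun _ => ((), ())) (Computable.const _)

theorem computableMap_baire_unpair_fst :
    ComputableMap fun (h : ℕ → ℕ) (n : ℕ) => (h n).unpair.1 := by
  refine computableMap_of_baire (.of_baire ?_)
  exact SemidecidableIn.subst_value (β := ℕ) (R := fun (_ : ℕ → ℕ) (q : (Unit × ℕ × ℕ) × ℕ) =>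
    q.2.unpair.1 = q.1.2.2) (.of_decide (computable_decide_eq (by fun_prop) (by fun_prop)))
    (g := fun i p => i p.2.1) (.apply_eq (n := fun q : (Unit × ℕ × ℕ) × ℕ => q.1.2.1)
      (v := fun q => q.2) (by fun_prop) (by fun_prop))

theorem EffectivelyOpen.semidecidableIn {U : Set (ℕ → ℕ)} (hU : EffectivelyOpen U) :
    SemidecidableIn (fun h : ℕ → ℕ => h) fun h (_ : Unit) => h ∈ U := by
  obtain ⟨A, ⟨hA, hA'⟩, rfl⟩ := hU
  have h1 : SemidecidableIn (fun h : ℕ → ℕ => h) fun h (p : (Unit × ℕ × ℕ) × ℕ) =>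
      h p.2 = (Denumerable.ofNat (List ℕ) p.1.2.1.unpair.1).getD p.2 0 :=
    .apply_eq (by fun_prop) (by fun_prop)
  have h2 : SemidecidableIn (fun h : ℕ → ℕ => h) fun h (p : Unit × ℕ × ℕ) =>
      ∀ j < p.2.2, h j = (Denumerable.ofNat (List ℕ) p.2.1.unpair.1).getD j 0 :=
    .ball (R := fun (h : ℕ → ℕ) (p : Unit × ℕ × ℕ) j =>
      h j = (Denumerable.ofNat (List ℕ) p.2.1.unpair.1).getD j 0) h1 (n := fun p => p.2.2)
      (by fun_prop)
  have h3 : SemidecidableIn (fun h : ℕ → ℕ => h) fun _ (p : Unit × ℕ × ℕ) =>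
      (1 / 2 : ℚ) ^ p.2.2 < posRatOf p.2.1.unpair.2 :=
    .of_decide (computable_rat_decide_lt (by fun_prop) (by fun_prop))
  have h4 : SemidecidableIn (fun h : ℕ → ℕ => h) fun _ (p : Unit × ℕ × ℕ) => A p.2.1 :=
    .of_decide (hA'.comp (g := fun p : Unit × ℕ × ℕ => p.2.1) (by fun_prop))
  refine (h4.and (h3.and h2)).proj.congr fun h _ => ?_
  simp only [basicBall, Metric.mem_ball, Set.mem_ofPred_eq, Prod.exists]
  refine exists_congr fun n => ?_
  rw [exists_and_left]
  refine and_congr_right fun _ => ?_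
  constructor
  -- A ball contains `h` exactly if `h` agrees with the centre on `k` places for some `k` with `2⁻ᵏ`
  -- below the radius. Unless `h` is the centre itself, the first place of difference serves as `k`.
  · intro hd
    by_cases e : h = basic n.unpair.1
    · obtain ⟨k, hk⟩ := exists_pow_lt_of_lt_one (posRatOf_pos n.unpair.2)
        (by norm_num : (1 / 2 : ℚ) < 1)
      exact ⟨k, hk, fun j _ => congrFun e j⟩
    · have e' : dist h (basic n.unpair.1) = (1 / 2 : ℝ) ^ PiNat.firstDiff h (basic n.unpair.1) :=
        PiNat.dist_eq_of_ne e
      refine ⟨PiNat.firstDiff h (basic n.unpair.1), ?_, baire_dist_le_iff.1 e'.le⟩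
      rw [e'] at hd
      rw [← Rat.cast_lt (K := ℝ)]
      push_cast
      exact hd
  · rintro ⟨k, hk, hj⟩
    have hk' : (1 / 2 : ℝ) ^ k < (posRatOf n.unpair.2 : ℝ) := by
      have := (Rat.cast_lt (K := ℝ)).2 hk
      push_cast at this
      exact this
    exact (baire_dist_le_iff.2 hj).trans_lt hk'

/-- What is computed on an effectively closed set has a name that is computed by a total map. -/
theorem UniformlyComputes.exists_total_name {h : ℕ → ℕ} {y : Y} (hy : UniformlyComputes h y) :
    ∃ c : (ℕ → ℕ) → ℕ → ℕ, ComputableMap c ∧ IsCauchyName (c h) y := by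
  obtain ⟨K, hK, hhK, f, hf, rfl⟩ := hy
  obtain ⟨F, hF, hFK⟩ := hf
  -- The codes of the initial segments form a Cauchy name of `h` itself that is computed from `h`;
  -- the functional expects a name as its input.
  have h1 : SemidecidableIn (fun h : ℕ → ℕ => h) fun h (p : Unit × ℕ × ℕ) =>
      Encodable.encode (initialSegment h (p.2.1 + 1)) = p.2.2 :=
    (SemidecidableIn.segment (b := fun q : List ℕ × Unit × ℕ × ℕ =>
      decide (Encodable.encode q.1 = q.2.2.2)) (computable_decide_eq (by fun_prop) (by fun_prop))
      (n := fun p => p.2.1 + 1) (by fun_prop)).congr fun h p => by simp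
  have h2 : SemidecidableIn (fun h : ℕ → ℕ => h) fun h (p : Unit × ℕ × ℕ) =>
      p.2.2 ∈ F (fun i => Encodable.encode (initialSegment h (i + 1))) p.2.1 :=
    hF.semidecidableIn.subst (o := fun h : ℕ → ℕ => h)
      (φ := fun h (_ : Unit) i => Encodable.encode (initialSegment h (i + 1))) h1
  -- Either the functional answers or `h` is seen to leave `K`. In the second case every value is
  -- acceptable, so the relation is total; on `K` only the answer of the functional qualifies.
  have h3 : SemidecidableIn (fun h : ℕ → ℕ => h) fun h (p : (Unit × ℕ) × ℕ) =>
      p.2 ∈ F (fun i => Encodable.encode (initialSegment h (i + 1))) p.1.2 ∨ h ∈ Kᶜ :=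
    (h2.comp (g := fun p : (Unit × ℕ) × ℕ => (p.1.1, p.1.2, p.2)) (by fun_prop)).or
      (hK.semidecidableIn.comp (g := fun _ : (Unit × ℕ) × ℕ => ()) (by fun_prop))
  obtain ⟨c, hc, hc'⟩ := h3.exists_selector fun h p => by
    by_cases hh : h ∈ K
    · obtain ⟨g, hg, _⟩ := hFK h hh _ (isCauchyName_initialSegment h)
      exact ⟨g p.2, Or.inl (hg p.2)⟩
    · exact ⟨0, Or.inr hh⟩
  refine ⟨fun h n => c h ((), n), computableMap_of_baire (.of_baire ?_), ?_⟩
  · exact hc.comp (g := fun p : Unit × ℕ × ℕ => (((), p.2.1), p.2.2)) (by fun_prop)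
  · obtain ⟨g, hg, hg'⟩ := hFK h hhK _ (isCauchyName_initialSegment h)
    have : (fun n => c h ((), n)) = g := by
      ext n
      rcases hc' h ((), n) with h5 | h5
      · exact Part.mem_unique h5 (hg n)
      · exact absurd hhK h5
    simp only [this]
    exact hg'

end Baire

-- Total limit maps, and the implications towards randomness relative to the point

section Retraction

variable {A : Type*} [MetricSpace A] [BasicPoints A] [IsComputableMetricSpace A]

theorem ComputableRealSeq.abs_sub_le {f : ℕ → ℝ} {c : ℕ → ℕ → ℕ}
    (h1 : ∀ n i j, i ≤ j → |ratOf (c n j) - ratOf (c n i)| ≤ (1 / 2 : ℚ) ^ i)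
    (h2 : ∀ n, Tendsto (fun i => (ratOf (c n i) : ℝ)) atTop (𝓝 (f n))) (n i : ℕ) :
    |(ratOf (c n i) : ℝ) - f n| ≤ (1 / 2 : ℝ) ^ i := by
  rw [abs_sub_comm]
  refine le_of_tendsto ((h2 n).sub_const _).abs (eventually_atTop.2 ⟨i, fun j hj => ?_⟩)
  have := (Rat.cast_le (K := ℝ)).2 (h1 n i j hj)
  push_cast at this
  exact this

/-- In a computable metric space, a total computable map sends every Cauchy name to its limit. -/
theorem exists_computableMap_limit :
    ∃ ρ : (ℕ → ℕ) → A, ComputableMap ρ ∧ ∀ h a, IsCauchyName h a → ρ h = a := by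
  obtain ⟨c, hc, hc1, hc2⟩ := IsComputableMetricSpace.computable_dist (X := A)
  have : CompleteSpace A := IsComputableMetricSpace.complete
  have hc3 : Computable fun p : ℕ × ℕ => c p.1 p.2 := hc
  have hd : ∀ u v i, |(ratOf (c (Nat.pair u v) i) : ℝ) - dist (basic u : A) (basic v)| ≤
      (1 / 2 : ℝ) ^ i := fun u v i => by
    simpa using ComputableRealSeq.abs_sub_le hc1 hc2 (Nat.pair u v) i
  -- Comparing a distance with `2⁻ⁱ` is undecidable, so an approximation with error `2⁻ⁱ⁻¹` is
  -- compared with `2⁻ⁱ + 2⁻ⁱ⁻¹`. The test passes for all distances up to `2⁻ⁱ`, and only for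
  -- distances up to `2 · 2⁻ⁱ`.
  let ok : ℕ → ℕ → ℕ → Prop := fun u v i =>
    ratOf (c (Nat.pair u v) (i + 1)) ≤ 3 / 2 * (1 / 2) ^ i
  have ok_of : ∀ u v i, dist (basic u : A) (basic v) ≤ (1 / 2 : ℝ) ^ i → ok u v i := by
    intro u v i h
    have h1 := (abs_le.1 (hd u v (i + 1))).2
    have h2 : (ratOf (c (Nat.pair u v) (i + 1)) : ℝ) ≤ 3 / 2 * (1 / 2) ^ i := by
      rw [pow_succ] at h1; linarith
    change ratOf _ ≤ _
    rw [← Rat.cast_le (K := ℝ)]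
    push_cast
    exact h2
  have dist_of : ∀ u v i, ok u v i → dist (basic u : A) (basic v) ≤ 2 * (1 / 2 : ℝ) ^ i := by
    intro u v i h
    have h1 := (abs_le.1 (hd u v (i + 1))).1
    have h2 : (ratOf (c (Nat.pair u v) (i + 1)) : ℝ) ≤ 3 / 2 * (1 / 2) ^ i := by
      have := (Rat.cast_le (K := ℝ)).2 h
      push_cast at this
      exact this
    rw [pow_succ] at h1; linarith
  have okc : Computable fun q : ℕ × ℕ × ℕ => decide (ok q.1 q.2.1 q.2.2) :=
    computable_rat_decide_le (computable_ratOf (hc3.comp (g := fun q : ℕ × ℕ × ℕ =>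
      (Nat.pair q.1 q.2.1, q.2.2 + 1)) (by fun_prop))) (by fun_prop)
  have s1 : SemidecidableIn (fun h : ℕ → ℕ => h) fun h (n : ℕ) => ok (h n) (h (n + 1)) n := by
    have := SemidecidableIn.segment (b := fun q : List ℕ × ℕ =>
      decide (ok (q.1.getD q.2 0) (q.1.getD (q.2 + 1) 0) q.2))
      (okc.comp (g := fun q : List ℕ × ℕ => (q.1.getD q.2 0, q.1.getD (q.2 + 1) 0, q.2))
        (by fun_prop)) (n := fun n => n + 2) (by fun_prop) (o := fun h : ℕ → ℕ => h)
    refine this.congr fun h n => ?_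
    rw [getD_initialSegment h (by omega), getD_initialSegment h (by omega), decide_eq_true_eq]
  have s2 : SemidecidableIn (fun h : ℕ → ℕ => h) fun h (n : ℕ) => ¬ok (h n) (h (n + 1)) n := by
    have := SemidecidableIn.segment (b := fun q : List ℕ × ℕ =>
      !decide (ok (q.1.getD q.2 0) (q.1.getD (q.2 + 1) 0) q.2))
      (computable_not (okc.comp (g := fun q : List ℕ × ℕ =>
        (q.1.getD q.2 0, q.1.getD (q.2 + 1) 0, q.2)) (by fun_prop))) (n := fun n => n + 2)
        (by fun_prop) (o := fun h : ℕ → ℕ => h)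
    refine this.congr fun h n => ?_
    rw [getD_initialSegment h (by omega), getD_initialSegment h (by omega), Bool.not_eq_true',
      decide_eq_false_iff_not]
  -- The relation singles out the minimum of `n` and the first index at which the test fails.
  -- Reading `h` at this index freezes the sequence there, so every `h` leads to a fast Cauchy
  -- sequence.
  have s3 : SemidecidableIn (fun h : ℕ → ℕ => h) fun h (p : ℕ × ℕ) =>
      p.2 ≤ p.1 ∧ (∀ i < p.2, ok (h i) (h (i + 1)) i) ∧
        (p.2 = p.1 ∨ ¬ok (h p.2) (h (p.2 + 1)) p.2) :=
    (SemidecidableIn.of_decide (p := fun p : ℕ × ℕ => p.2 ≤ p.1)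
      (computable_decide_le (by fun_prop) (by fun_prop))).and
    ((SemidecidableIn.ball (R := fun (h : ℕ → ℕ) (_ : ℕ × ℕ) i => ok (h i) (h (i + 1)) i)
      (s1.comp (g := fun p : (ℕ × ℕ) × ℕ => p.2) (by fun_prop)) (n := fun p => p.2)
      (by fun_prop)).and
    ((SemidecidableIn.of_decide (p := fun p : ℕ × ℕ => p.2 = p.1)
      (computable_decide_eq (by fun_prop) (by fun_prop))).or
    (s2.comp (g := fun p : ℕ × ℕ => p.2) (by fun_prop))))
  obtain ⟨r, hr, hr'⟩ := s3.exists_selector fun h n => by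
    classical
    by_cases H : ∃ m, m < n ∧ ¬ok (h m) (h (m + 1)) m
    · exact ⟨Nat.find H, (Nat.find_spec H).1.le, fun i hi => by
        by_contra hn
        exact Nat.find_min H hi ⟨hi.trans (Nat.find_spec H).1, hn⟩, Or.inr (Nat.find_spec H).2⟩
    · push Not at H
      exact ⟨n, le_rfl, H, Or.inl rfl⟩
  have step : ∀ (h : ℕ → ℕ) n, dist (basic (h (r h n)) : A) (basic (h (r h (n + 1)))) ≤
      2 * (1 / 2 : ℝ) ^ n := by
    intro h n
    obtain ⟨a1, a2, a3⟩ := hr' h n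
    obtain ⟨b1, b2, b3⟩ := hr' h (n + 1)
    simp only at a1 a2 a3 b1 b2 b3
    rcases lt_trichotomy (r h n) (r h (n + 1)) with hlt | heq | hgt
    · rcases a3 with a3 | a3
      · have : r h (n + 1) = n + 1 := by omega
        rw [a3, this]
        exact dist_of _ _ _ (b2 n (by omega))
      · exact absurd (b2 _ hlt) a3
    · rw [heq, dist_self]; positivity
    · rcases b3 with b3 | b3
      · omega
      · exact absurd (a2 _ hgt) b3
  have lim : ∀ h : ℕ → ℕ, ∃ a : A, Tendsto (fun n => (basic (h (r h n)) : A)) atTop (𝓝 a) := fun h =>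
    cauchySeq_tendsto_of_complete (cauchySeq_of_le_geometric (1 / 2) 2 (by norm_num) (step h))
  choose ρ hρ using lim
  refine ⟨ρ, computableMap_of_baire ?_, fun h a ha => ?_⟩
  · have s4 : SemidecidableIn (fun h : ℕ → ℕ => h) fun h (p : Unit × ℕ × ℕ) =>
        h (r h (p.2.1 + 2)) = p.2.2 :=
      SemidecidableIn.subst_value (β := ℕ) (R := fun (h : ℕ → ℕ) (q : (Unit × ℕ × ℕ) × ℕ) =>
        h q.2 = q.1.2.2) (.apply_eq (by fun_prop) (by fun_prop))
        (hr.comp (g := fun q : (Unit × ℕ × ℕ) × ℕ => (q.1.2.1 + 2, q.2)) (by fun_prop))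
    refine PointIn.of_dist_le s4 (fun h _ n => ⟨h (r h (n + 2)), rfl⟩) fun h _ n v hv => ?_
    obtain rfl : h (r h (n + 2)) = v := hv
    have := dist_le_of_le_geometric_of_tendsto (1 / 2) 2 (by norm_num) (step h) (hρ h) (n + 2)
    refine this.trans (le_of_eq ?_)
    ring
  · have hall : ∀ i, ok (h i) (h (i + 1)) i := fun i => ok_of _ _ _ (by
      rw [dist_comm]; exact ha.1 i (i + 1) (Nat.le_succ i))
    have hrn : ∀ n, r h n = n := fun n => by
      rcases (hr' h n).2.2 with e | e
      · exact e
      · exact absurd (hall _) e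
    refine tendsto_nhds_unique (hρ h) ?_
    simp only [hrn]
    exact ha.2

variable {X : Type*} [PseudoMetricSpace X] [BasicPoints X] [MeasurableSpace X]

theorem mem_SR_of_isCauchyName {μ : Measures X} {x : X} {a : A} {h : ℕ → ℕ} (hh : IsCauchyName h a)
    (hx : x ∈ SR μ h) : x ∈ SR μ a := by
  obtain ⟨ρ, hρ, hρ'⟩ := exists_computableMap_limit (A := A)
  exact hρ' h a hh ▸ mem_SR_map hx hρ

theorem mem_SR_fst_of_isCauchyName {μ : Measures X} {x : X} {p : A × Measures X} {h : ℕ → ℕ}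
    (hh : IsCauchyName h p) (hx : x ∈ SR μ h) : x ∈ SR μ p.1 :=
  mem_SR_of_isCauchyName (isCauchyName_prod_iff.1 hh).1 (mem_SR_map hx computableMap_baire_unpair_fst)

theorem mem_SR_fst_of_uniformlyComputes {μ : Measures X} {x : X} {p : A × Measures X} {h : ℕ → ℕ}
    (hh : UniformlyComputes h p) (hx : x ∈ SR μ h) : x ∈ SR μ p.1 := by
  obtain ⟨c, hc, hc'⟩ := hh.exists_total_name
  exact mem_SR_fst_of_isCauchyName hc' (mem_SR_map hx hc)

end Retraction

/-! ### The space of measures -/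

section BasicFunctions

variable {X : Type*} [PseudoMetricSpace X] [BasicPoints X]

/-- Code of a bump function. -/
def bumpCode (i r s : ℕ) : ℕ := 5 * Nat.pair i (Nat.pair r s) + 1

/-- Code of a maximum. -/
def maxCode (a b : ℕ) : ℕ := 5 * Nat.pair a b + 1 + 1

/-- Code of a sum. -/
def addCode (a b : ℕ) : ℕ := 5 * Nat.pair a b + 3 + 1

/-- Code of a rational multiple. -/
def mulCode (a b : ℕ) : ℕ := 5 * Nat.pair a b + 4 + 1

theorem basicFun_succ (n : ℕ) : basicFun X (n + 1) =
    if n % 5 = 0 then bump (basic (n / 5).unpair.1) (posRatOf (n / 5).unpair.2.unpair.1 : ℝ)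
        ((posRatOf (n / 5).unpair.2.unpair.1 : ℝ) + (posRatOf (n / 5).unpair.2.unpair.2 : ℝ))
    else if n % 5 = 1 then
      fun y => max (basicFun X (n / 5).unpair.1 y) (basicFun X (n / 5).unpair.2 y)
    else if n % 5 = 2 then
      fun y => min (basicFun X (n / 5).unpair.1 y) (basicFun X (n / 5).unpair.2 y)
    else if n % 5 = 3 then
      fun y => basicFun X (n / 5).unpair.1 y + basicFun X (n / 5).unpair.2 y
    else fun y => (ratOf (n / 5).unpair.1 : ℝ) * basicFun X (n / 5).unpair.2 y := by
  rw [basicFun]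
  have h5 : n % 5 < 5 := Nat.mod_lt _ (by norm_num)
  generalize n % 5 = m at *
  interval_cases m <;> simp

theorem basicFun_zero : basicFun X 0 = fun _ => 1 := by rw [basicFun]

theorem basicFun_bumpCode (i r s : ℕ) : basicFun X (bumpCode i r s) =
    bump (basic i) (posRatOf r : ℝ) ((posRatOf r : ℝ) + (posRatOf s : ℝ)) := by
  rw [bumpCode, basicFun_succ]
  simp

theorem basicFun_maxCode (a b : ℕ) : basicFun X (maxCode a b) =
    fun y => max (basicFun X a y) (basicFun X b y) := by
  rw [maxCode, basicFun_succ, show (5 * Nat.pair a b + 1) % 5 = 1 by omega,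
    show (5 * Nat.pair a b + 1) / 5 = Nat.pair a b by omega]
  simp

theorem basicFun_addCode (a b : ℕ) : basicFun X (addCode a b) =
    fun y => basicFun X a y + basicFun X b y := by
  rw [addCode, basicFun_succ, show (5 * Nat.pair a b + 3) % 5 = 3 by omega,
    show (5 * Nat.pair a b + 3) / 5 = Nat.pair a b by omega]
  simp

theorem basicFun_mulCode (a b : ℕ) : basicFun X (mulCode a b) =
    fun y => (ratOf a : ℝ) * basicFun X b y := by
  rw [mulCode, basicFun_succ, show (5 * Nat.pair a b + 4) % 5 = 4 by omega,
    show (5 * Nat.pair a b + 4) / 5 = Nat.pair a b by omega]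
  simp

theorem unpair_div_lt (n : ℕ) : (n / 5).unpair.1 < n + 1 ∧ (n / 5).unpair.2 < n + 1 :=
  ⟨Nat.lt_succ_of_le ((Nat.unpair_left_le _).trans (Nat.div_le_self n 5)),
    Nat.lt_succ_of_le ((Nat.unpair_right_le _).trans (Nat.div_le_self n 5))⟩

/-- The bump function as a clamped quotient. -/
theorem bump_eq {Y : Type*} [PseudoMetricSpace Y] (x y : Y) {r t : ℝ} (ht : 0 < t) :
    bump x r (r + t) y = max 0 (min 1 ((r + t - dist x y) / t)) := by
  unfold bump
  rw [add_sub_cancel_left]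
  split_ifs with h1 h2
  · rw [min_eq_left, max_eq_right zero_le_one]
    rw [le_div_iff₀ ht]; linarith
  · rw [min_eq_right, max_eq_right]
    · exact div_nonneg (by linarith) ht.le
    · rw [div_le_one ht]; linarith
  · rw [max_eq_left]
    exact (min_le_right _ _).trans (div_nonpos_of_nonpos_of_nonneg (by linarith) ht.le)

theorem continuous_bump {Y : Type*} [PseudoMetricSpace Y] (x : Y) (r : ℝ) {t : ℝ} (ht : 0 < t) : Continuous (bump x r (r + t)) := by
  have : bump x r (r + t) = fun y => max 0 (min 1 ((r + t - dist x y) / t)) := by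
    ext y; exact bump_eq x y ht
  rw [this]
  fun_prop

theorem posRatOf_cast_pos (n : ℕ) : (0 : ℝ) < posRatOf n := by exact_mod_cast posRatOf_pos n

/-- Both properties are needed throughout: they make the functions integrable for finite measures,
and weak convergence of measures controls their integrals. -/
theorem continuous_basicFun_and_bounded (n : ℕ) :
    Continuous (basicFun X n) ∧ ∃ C : ℝ, ∀ y, |basicFun X n y| ≤ C := by
  induction n using Nat.strong_induction_on with
  | _ n ih =>
    rcases n with _ | n
    · rw [basicFun_zero]
      exact ⟨continuous_const, 1, fun _ => by simp⟩
    obtain ⟨c1, C1, b1⟩ := ih _ (unpair_div_lt n).1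
    obtain ⟨c2, C2, b2⟩ := ih _ (unpair_div_lt n).2
    rw [basicFun_succ]
    split_ifs
    · refine ⟨continuous_bump _ _ (posRatOf_cast_pos _), 1, fun y => ?_⟩
      rw [bump_eq _ _ (posRatOf_cast_pos _), abs_le]
      exact ⟨by linarith [le_max_left (0 : ℝ) (min 1 (((posRatOf (n / 5).unpair.2.unpair.1 : ℝ) +
        (posRatOf (n / 5).unpair.2.unpair.2 : ℝ) - dist (basic (n / 5).unpair.1) y) /
        (posRatOf (n / 5).unpair.2.unpair.2 : ℝ)))], max_le zero_le_one (min_le_left _ _)⟩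
    · exact ⟨c1.max c2, max C1 C2, fun y => abs_max_le_max_abs_abs.trans
        (max_le_max (b1 y) (b2 y))⟩
    · exact ⟨c1.min c2, max C1 C2, fun y => abs_min_le_max_abs_abs.trans
        (max_le_max (b1 y) (b2 y))⟩
    · exact ⟨c1.add c2, C1 + C2, fun y => (abs_add_le _ _).trans (add_le_add (b1 y) (b2 y))⟩
    · refine ⟨continuous_const.mul c2, |(ratOf (n / 5).unpair.1 : ℝ)| * C2, fun y => ?_⟩
      rw [abs_mul]
      exact mul_le_mul_of_nonneg_left (b2 y) (abs_nonneg _)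

theorem continuous_basicFun (n : ℕ) : Continuous (basicFun X n) :=
  (continuous_basicFun_and_bounded n).1

theorem exists_bound_basicFun (n : ℕ) : ∃ C : ℝ, ∀ y, |basicFun X n y| ≤ C :=
  (continuous_basicFun_and_bounded n).2

end BasicFunctions

-- Convergence of measures and density of the basic measures

section MeasureMetric

variable {X : Type*} [PseudoMetricSpace X] [BasicPoints X] [MeasurableSpace X]

instance (μ : Measures X) : IsFiniteMeasure μ.toMeasure := FiniteMeasure.isFiniteMeasure μ

theorem measures_dist_eq (μ ν : Measures X) : dist μ ν = ∑' i, measureDistTerm μ ν i := rfl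

theorem measureDistTerm_le_dist (μ ν : Measures X) (i : ℕ) : measureDistTerm μ ν i ≤ dist μ ν :=
  (summable_measureDistTerm μ ν).le_tsum i fun j _ => measureDistTerm_nonneg μ ν j

/-- Each integral depends on the measure with an explicit modulus of continuity. The `m`-th term of
the distance bounds `1 - exp (-D)` by `2⁻ᵏ⁻¹`, and `exp (-D) * (1 + D) ≤ 1` then gives `D ≤ 2⁻ᵏ`. Of
the exponent, `m` cancels the coefficient of the term, and `1` pays for inverting the exponential.
-/
theorem abs_basicIntegral_sub_le {μ ν : Measures X} {m k : ℕ}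
    (h : dist μ ν ≤ (1 / 2 : ℝ) ^ (m + 1 + k)) :
    |basicIntegral μ m - basicIntegral ν m| ≤ (1 / 2 : ℝ) ^ k := by
  set D := |basicIntegral μ m - basicIntegral ν m| with hD
  have hD0 : 0 ≤ D := abs_nonneg _
  have h1 : (1 / 2 : ℝ) ^ m * (1 - Real.exp (-D)) ≤ (1 / 2 : ℝ) ^ m * (1 / 2 : ℝ) ^ (k + 1) := by
    rw [← pow_add, show m + (k + 1) = m + 1 + k by ring]
    exact (measureDistTerm_le_dist μ ν m).trans h
  have h2 : 1 - Real.exp (-D) ≤ (1 / 2 : ℝ) ^ (k + 1) := le_of_mul_le_mul_left h1 (by positivity)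
  have h3 : Real.exp (-D) * (1 + D) ≤ 1 := by
    rw [Real.exp_neg, inv_mul_le_iff₀ (Real.exp_pos D)]
    linarith [Real.add_one_le_exp D]
  have h4 : (1 / 2 : ℝ) ^ (k + 1) ≤ 1 / 2 := by
    rw [pow_succ]
    have : (1 / 2 : ℝ) ^ k ≤ 1 := pow_le_one₀ (by norm_num) (by norm_num)
    linarith
  rw [pow_succ] at h2 h4
  set ε := (1 / 2 : ℝ) ^ k
  have h5 : (1 - ε * (1 / 2)) * (1 + D) ≤ 1 :=
    (mul_le_mul_of_nonneg_right (by linarith) (by linarith)).trans h3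
  nlinarith

/-- Dominated convergence for the series that defines the distance, whose terms are bounded by
`2⁻ⁱ`. -/
theorem tendsto_measures_of_basicIntegral {ι : Type*} {l : Filter ι} {ν : ι → Measures X}
    {μ : Measures X} (h : ∀ m, Tendsto (fun j => basicIntegral (ν j) m) l (𝓝 (basicIntegral μ m))) :
    Tendsto ν l (𝓝 μ) := by
  rw [tendsto_iff_dist_tendsto_zero]
  have h0 : (0 : ℝ) = ∑' _ : ℕ, (0 : ℝ) := by simp
  rw [h0]
  refine tendsto_tsum_of_dominated_convergence (bound := fun i => (1 / 2 : ℝ) ^ i)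
    summable_geometric_two (fun m => ?_) (Eventually.of_forall fun j m => ?_)
  · have h1 : Tendsto (fun j => (1 / 2 : ℝ) ^ m *
        (1 - Real.exp (-|basicIntegral (ν j) m - basicIntegral μ m|))) l
        (𝓝 ((1 / 2 : ℝ) ^ m * (1 - Real.exp (-|basicIntegral μ m - basicIntegral μ m|)))) := by
      refine Tendsto.const_mul _ (tendsto_const_nhds.sub ?_)
      exact (Real.continuous_exp.tendsto _).comp (((h m).sub_const _).abs.neg)
    simpa [measureDistTerm] using h1
  · rw [Real.norm_of_nonneg (measureDistTerm_nonneg _ _ _)]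
    exact measureDistTerm_le _ _ _

variable [OpensMeasurableSpace X]

theorem integrable_basicFun (n : ℕ) (μ : Measure X) [IsFiniteMeasure μ] :
    Integrable (basicFun X n) μ := by
  obtain ⟨C, hC⟩ := exists_bound_basicFun (X := X) n
  exact Integrable.of_bound (continuous_basicFun n).aestronglyMeasurable C
    (Eventually.of_forall hC)

theorem list_sum_map_eq {σ : Type*} (L : List σ) (d : σ) (g : σ → ℝ) :
    (L.map g).sum = ∑ j ∈ Finset.range L.length, g (L.getD j d) := by
  induction L with
  | nil => simp
  | cons a L ih =>
    rw [List.length_cons, Finset.sum_range_succ', List.map_cons, List.sum_cons, ih, add_comm]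
    rfl

theorem integral_basic_measure (n : ℕ) (f : X → ℝ) (hf : Continuous f) {C : ℝ}
    (hC : ∀ y, |f y| ≤ C) :
    ∫ x, f x ∂(basic n : Measures X).toMeasure =
      ((Denumerable.ofNat (List ℕ) n).map fun k =>
        (posRatOf k.unpair.2 : ℝ) * f (basic k.unpair.1)).sum := by
  have hi : ∀ μ : FiniteMeasure X, Integrable f (μ : Measure X) := fun μ =>
    Integrable.of_bound hf.aestronglyMeasurable C (Eventually.of_forall hC)
  change ∫ x, f x ∂((((Denumerable.ofNat (List ℕ) n).map fun m =>
    Real.toNNReal (posRatOf m.unpair.2 : ℝ) • pointMass (basic m.unpair.1 : X)).sum :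
      FiniteMeasure X) : Measure X) = _
  induction Denumerable.ofNat (List ℕ) n with
  | nil => simp
  | cons k L ih =>
    rw [List.map_cons, List.sum_cons, List.map_cons, List.sum_cons, FiniteMeasure.toMeasure_add,
      integral_add_measure (hi _) (hi _), ih, FiniteMeasure.toMeasure_smul,
      integral_smul_nnreal_measure]
    congr 1
    change (Real.toNNReal (posRatOf k.unpair.2 : ℝ)) • ∫ x, f x ∂(Measure.dirac _) = _
    rw [integral_dirac' _ _ hf.stronglyMeasurable, NNReal.smul_def,
      Real.coe_toNNReal _ (posRatOf_cast_pos _).le, smul_eq_mul]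

theorem basicIntegral_basic (n m : ℕ) : basicIntegral (basic n : Measures X) m =
    ∑ j ∈ Finset.range (Denumerable.ofNat (List ℕ) n).length,
      (posRatOf ((Denumerable.ofNat (List ℕ) n).getD j 0).unpair.2 : ℝ) *
        basicFun X m (basic ((Denumerable.ofNat (List ℕ) n).getD j 0).unpair.1) := by
  obtain ⟨C, hC⟩ := exists_bound_basicFun (X := X) m
  rw [basicIntegral, integral_basic_measure n _ (continuous_basicFun m) hC, list_sum_map_eq _ 0]

theorem exists_posRatOf {q : ℚ} (hq : 0 < q) : ∃ n, posRatOf n = q := by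
  refine ⟨Nat.pair (q.num.toNat - 1) (q.den - 1), ?_⟩
  have h1 : 0 < q.num := Rat.num_pos.2 hq
  have h2 : ((q.num.toNat - 1 : ℕ) : ℚ) + 1 = (q.num : ℚ) := by
    have : ((q.num.toNat - 1 : ℕ) : ℤ) + 1 = q.num := by omega
    exact_mod_cast this
  have h3 : ((q.den - 1 : ℕ) : ℚ) + 1 = (q.den : ℚ) := by
    have := q.den_pos
    exact_mod_cast (by omega : q.den - 1 + 1 = q.den)
  simp only [posRatOf, Nat.unpair_pair]
  rw [h2, h3, Rat.num_div_den]

/-- The measure is pushed to the nearest of the first `N + 1` basic points, and the mass of each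
cell is rounded to a positive rational with error at most `2⁻ᴺ`. The push converges by dominated
convergence, and the rounding costs at most `C (N + 1) 2⁻ᴺ`. -/
theorem exists_basic_tendsto (hX : DenseRange (basic : ℕ → X)) (μ : Measures X) :
    ∃ c : ℕ → ℕ, ∀ (f : X → ℝ) (C : ℝ), Continuous f → (∀ y, |f y| ≤ C) →
      Tendsto (fun N => ∫ x, f x ∂(basic (c N) : Measures X).toMeasure) atTop
        (𝓝 (∫ x, f x ∂μ.toMeasure)) := by
  let s : ℕ → SimpleFunc X ℕ := fun N => SimpleFunc.nearestPtInd basic N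
  let w : ℕ → ℕ → ℝ := fun N n => μ.toMeasure.real (s N ⁻¹' {n})
  have hq : ∀ N n : ℕ, ∃ k, |(posRatOf k : ℝ) - w N n| ≤ (1 / 2 : ℝ) ^ N := by
    intro N n
    have hp : (0 : ℝ) < (1 / 2) ^ N := by positivity
    obtain ⟨q, h1, h2⟩ := exists_rat_btwn (show w N n < w N n + (1 / 2) ^ N by linarith)
    have h0 : (0 : ℝ) ≤ w N n := measureReal_nonneg
    obtain ⟨k, hk⟩ := exists_posRatOf (q := q) (by exact_mod_cast h0.trans_lt h1)
    exact ⟨k, by rw [hk, abs_le]; constructor <;> linarith⟩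
  choose k hk using hq
  refine ⟨fun N => Encodable.encode ((List.range (N + 1)).map fun n => Nat.pair n (k N n)),
    fun f C hf hC => ?_⟩
  have e1 : ∀ N, ∫ x, f x ∂(basic (Encodable.encode ((List.range (N + 1)).map
      fun n => Nat.pair n (k N n))) : Measures X).toMeasure =
      ∑ n ∈ Finset.range (N + 1), (posRatOf (k N n) : ℝ) * f (basic n) := by
    intro N
    rw [integral_basic_measure _ f hf hC, Denumerable.ofNat_encode, List.map_map,
      list_sum_map_eq _ 0]
    simp only [List.length_range]
    refine Finset.sum_congr rfl fun n hn => ?_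
    have := Finset.mem_range.1 hn
    simp [this]
  have e2 : ∀ N, ∫ x, f (basic (s N x)) ∂μ.toMeasure =
      ∑ n ∈ Finset.range (N + 1), w N n * f (basic n) := by
    intro N
    have : ∀ x, f (basic (s N x)) =
        ∑ n ∈ Finset.range (N + 1), (s N ⁻¹' {n}).indicator (fun _ => f (basic n)) x := by
      intro x
      have hle : s N x ≤ N := SimpleFunc.nearestPtInd_le _ _ _
      rw [Finset.sum_eq_single (s N x)]
      · simp
      · intro n _ hn
        exact Set.indicator_of_notMem (by simpa using hn.symm) _
      · intro hn
        simp at hn; omega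
    simp only [this]
    rw [integral_finsetSum _ fun n _ => (integrable_const _).indicator ((s N).measurableSet_fiber n)]
    refine Finset.sum_congr rfl fun n _ => ?_
    rw [integral_indicator_const _ ((s N).measurableSet_fiber n), smul_eq_mul]
  have t1 : Tendsto (fun N => ∫ x, f (basic (s N x)) ∂μ.toMeasure) atTop
      (𝓝 (∫ x, f x ∂μ.toMeasure)) := by
    refine tendsto_integral_of_dominated_convergence (fun _ => C) (fun N => ?_)
      (integrable_const C) (fun N => Eventually.of_forall fun x => hC _)
      (Eventually.of_forall fun x => ?_)
    · exact ((s N).map fun n => f (basic n)).aestronglyMeasurable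
    · exact (hf.tendsto x).comp (SimpleFunc.tendsto_nearestPt (hX x))
  have t2 : Tendsto (fun N => (∑ n ∈ Finset.range (N + 1), (posRatOf (k N n) : ℝ) * f (basic n)) -
      ∑ n ∈ Finset.range (N + 1), w N n * f (basic n)) atTop (𝓝 0) := by
    have hC0 : 0 ≤ C := (abs_nonneg _).trans (hC (basic 0))
    refine squeeze_zero_norm (a := fun N : ℕ => C * (((N : ℝ) + 1) * (1 / 2) ^ N)) (fun N => ?_) ?_
    · rw [← Finset.sum_sub_distrib, Real.norm_eq_abs]
      refine (Finset.abs_sum_le_sum_abs _ _).trans ?_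
      calc _ ≤ ∑ n ∈ Finset.range (N + 1), (1 / 2 : ℝ) ^ N * C := by
            refine Finset.sum_le_sum fun n _ => ?_
            rw [← sub_mul, abs_mul]
            exact mul_le_mul (hk N n) (hC _) (abs_nonneg _) (by positivity)
        _ = _ := by rw [Finset.sum_const, Finset.card_range, nsmul_eq_mul]; push_cast; ring
    · have h1 := tendsto_self_mul_const_pow_of_lt_one (r := (1 / 2 : ℝ)) (by norm_num) (by norm_num)
      have h2 := (h1.add tendsto_half_pow).const_mul C
      simpa [add_mul] using h2
  have t3 := t2.add t1
  simp only [e1]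
  simpa only [e2, sub_add_cancel, zero_add] using t3

theorem denseRange_basic_measures (hX : DenseRange (basic : ℕ → X)) :
    DenseRange (basic : ℕ → Measures X) := by
  intro μ
  obtain ⟨c, hc⟩ := exists_basic_tendsto hX μ
  refine mem_closure_of_tendsto (f := fun N => (basic (c N) : Measures X)) (b := atTop)
    (tendsto_measures_of_basicIntegral fun m => ?_)
    (Eventually.of_forall fun N => Set.mem_range_self _)
  obtain ⟨C, hC⟩ := exists_bound_basicFun (X := X) m
  exact hc _ C (continuous_basicFun m) hC

end MeasureMetric

attribute [local irreducible] Computable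

/-! ### Computability of distances and of integrals of basic functions -/

section ComputableDist

variable {I α : Type*} [Primcodable α] {o : I → ℕ → ℕ}

/-- Computability without an oracle is expressed with the constant oracle `0`, which every oracle
computes. -/
theorem ComputableRealIn.of_const {f : α → ℝ}
    (hf : ComputableRealIn (fun (_ : Unit) (_ : ℕ) => 0) fun _ a => f a) :
    ComputableRealIn o fun _ a => f a := by
  have h : SemidecidableIn o fun (_ : I) (p : Unit × ℕ × ℕ) => (0 : ℕ) = p.2.2 :=
    .of_decide (computable_decide_eq (by fun_prop) (by fun_prop))
  exact ⟨(hf.1.subst (o := o) (φ := fun _ (_ : Unit) => ()) h).comp (u := fun a => ((), a))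
      (by fun_prop),
    (hf.2.subst (o := o) (φ := fun _ (_ : Unit) => ()) h).comp (u := fun a => ((), a))
      (by fun_prop)⟩

/-- The distances of the basic points are computable. -/
def ComputableDist (Y : Type*) [PseudoMetricSpace Y] [BasicPoints Y] : Prop :=
  ComputableRealIn (fun (_ : Unit) (_ : ℕ) => 0) fun _ (p : ℕ × ℕ) =>
    dist (basic p.1 : Y) (basic p.2)

theorem tendsto_half_pow_cast : Tendsto (fun n => (((1 / 2 : ℚ) ^ n : ℚ) : ℝ)) atTop (𝓝 0) := by
  push_cast
  exact tendsto_half_pow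

theorem computableDist_of_isComputableMetricSpace (A : Type*) [MetricSpace A] [BasicPoints A]
    [IsComputableMetricSpace A] : ComputableDist A := by
  obtain ⟨c, hc, hc1, hc2⟩ := IsComputableMetricSpace.computable_dist (X := A)
  have hc3 : Computable fun p : ℕ × ℕ => c p.1 p.2 := hc
  refine ComputableRealIn.of_approx
    (g := fun _ p n => (ratOf (c (Nat.pair p.1 p.2) n) : ℝ)) (e := fun _ n => (1 / 2) ^ n)
    (.of_rat (f := fun q : (ℕ × ℕ) × ℕ => ratOf (c (Nat.pair q.1.1 q.1.2) q.2))
      (computable_ratOf (hc3.comp (g := fun q : (ℕ × ℕ) × ℕ => (Nat.pair q.1.1 q.1.2, q.2))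
        (by fun_prop)))) (by fun_prop) (fun _ => tendsto_half_pow_cast) fun _ p n => ?_
  have := ComputableRealSeq.abs_sub_le hc1 hc2 (Nat.pair p.1 p.2) n
  push_cast
  simpa using this

variable {Y Z : Type*} [PseudoMetricSpace Y] [BasicPoints Y] [PseudoMetricSpace Z] [BasicPoints Z]

theorem ComputableDist.prod (hY : ComputableDist Y) (hZ : ComputableDist Z) :
    ComputableDist (Y × Z) :=
  (ComputableRealIn.max
    (hY.comp (u := fun p : ℕ × ℕ => (p.1.unpair.1, p.2.unpair.1)) (by fun_prop))
    (hZ.comp (u := fun p : ℕ × ℕ => (p.1.unpair.2, p.2.unpair.2)) (by fun_prop))).congr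
    fun _ _ => Prod.dist_eq

theorem ComputableDist.pointIn (hY : ComputableDist Y) {y : I → α → Y} (hy : PointIn o y) :
    ComputableRealIn o fun i (p : α × ℕ) => dist (basic p.2 : Y) (y i p.1) := by
  obtain ⟨G, hG, hG'⟩ := hy
  have h1 : ComputableRealIn o fun (_ : I) (q : ((α × ℕ) × ℕ) × ℕ) =>
      dist (basic q.1.1.2 : Y) (basic q.2) :=
    (ComputableRealIn.of_const hY).comp (u := fun q : ((α × ℕ) × ℕ) × ℕ => (q.1.1.2, q.2))
      (by fun_prop)
  have h2 : SemidecidableIn o fun i (q : ((α × ℕ) × ℕ) × ℕ) => G i q.1.1.1 q.1.2 = q.2 :=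
    hG.comp (g := fun q : ((α × ℕ) × ℕ) × ℕ => (q.1.1.1, q.1.2, q.2)) (by fun_prop)
  have h3 : ComputableRealIn o fun i (q : (α × ℕ) × ℕ) =>
      dist (basic q.1.2 : Y) (basic (G i q.1.1 q.2)) := h1.subst_value h2
  refine ComputableRealIn.of_approx (g := fun i p n => dist (basic p.2 : Y) (basic (G i p.1 n)))
    h3 (e := fun _ n => (1 / 2) ^ n) (by fun_prop) (fun _ => tendsto_half_pow_cast)
    fun i p n => ?_
  push_cast
  rw [dist_comm _ (basic (G i p.1 n)), dist_comm _ (y i p.1)]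
  exact (abs_dist_sub_le _ _ _).trans ((hG' i p.1).dist_le n)

end ComputableDist

-- Interval arithmetic for the values of basic functions

section BasicFunBounds

/-- The value of a bump function at distance `d`. -/
def clampBump (r t d : ℚ) : ℚ := max 0 (min 1 ((r + t - d) / t))

/-- Bounds for the value of the basic function that arises by the operation with number `m` from
arguments with the codes `u` and `v`: here `A` and `B` are bounds for the values of the basic
functions with the codes `u` and `v`, and `d` is an approximation to within `e` of the distance of
the argument from the basic point with code `u`. -/
def boundsOp (m u v : ℕ) (d e : ℚ) (A B : ℚ × ℚ) : ℚ × ℚ :=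
  if m = 0 then
    -- Bump functions decrease with the distance, so the overestimate `d + e` gives the lower bound.
    (clampBump (posRatOf v.unpair.1) (posRatOf v.unpair.2) (d + e),
      clampBump (posRatOf v.unpair.1) (posRatOf v.unpair.2) (d - e))
  else if m = 1 then (max A.1 B.1, max A.2 B.2)
  else if m = 2 then (min A.1 B.1, min A.2 B.2)
  else if m = 3 then (A.1 + B.1, A.2 + B.2)
  -- The sign of the factor decides which end of the interval becomes the lower bound; minimum and
  -- maximum cover both cases.
  else (min (ratOf u * B.1) (ratOf u * B.2), max (ratOf u * B.1) (ratOf u * B.2))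

/-- One step of the computation of rational bounds of the values of basic functions. The argument
`((l, i), L)` stands for the point with code `l`, the precision `i`, and the list `L` of the bounds
for the basic functions with smaller codes; `D (j, l, i)` is an approximation to within `2⁻ⁱ` of
the distance of the basic points with codes `j` and `l`. -/
def boundsStep (D : ℕ × ℕ × ℕ → ℚ) (q : (ℕ × ℕ) × List (ℚ × ℚ)) : ℚ × ℚ :=
  if q.2.length = 0 then (1, 1)
  else boundsOp ((q.2.length - 1) % 5) ((q.2.length - 1) / 5).unpair.1
    ((q.2.length - 1) / 5).unpair.2 (D (((q.2.length - 1) / 5).unpair.1, q.1.1, q.1.2))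
    ((1 / 2) ^ q.1.2) (q.2.getD ((q.2.length - 1) / 5).unpair.1 (0, 0))
    (q.2.getD ((q.2.length - 1) / 5).unpair.2 (0, 0))

/-- The list of the bounds for the first basic functions. -/
def boundsList (D : ℕ × ℕ × ℕ → ℚ) (a : ℕ × ℕ) : ℕ → List (ℚ × ℚ)
  | 0 => []
  | n + 1 => boundsList D a n ++ [boundsStep D (a, boundsList D a n)]

/-- Lower and upper bounds for the value of the basic function with code `n`. -/
def basicFunBounds (D : ℕ × ℕ × ℕ → ℚ) (a : ℕ × ℕ) (n : ℕ) : ℚ × ℚ :=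
  boundsStep D (a, boundsList D a n)

@[fun_prop] theorem computable_clampBump {α : Type*} [Primcodable α] {r t d : α → ℚ}
    (hr : Computable r) (ht : Computable t) (hd : Computable d) :
    Computable fun a => clampBump (r a) (t a) (d a) := by
  unfold clampBump; fun_prop

theorem computable_boundsOp {α : Type*} [Primcodable α] {m u v : α → ℕ} {d e : α → ℚ}
    {A B : α → ℚ × ℚ} (hm : Computable m) (hu : Computable u) (hv : Computable v)
    (hd : Computable d) (he : Computable e) (hA : Computable A) (hB : Computable B) :
    Computable fun a => boundsOp (m a) (u a) (v a) (d a) (e a) (A a) (B a) := by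
  have h : ∀ c : ℕ, Computable fun a => decide (m a = c) :=
    fun c => computable_decide_eq hm (Computable.const c)
  unfold boundsOp
  refine computable_ite (h 0) ?_ (computable_ite (h 1) ?_
    (computable_ite (h 2) ?_ (computable_ite (h 3) ?_ ?_))) <;> fun_prop

theorem computable_boundsStep {D : ℕ × ℕ × ℕ → ℚ} (hD : Computable D) :
    Computable (boundsStep D) := by
  have hd : Computable fun q : (ℕ × ℕ) × List (ℚ × ℚ) =>
      D (((q.2.length - 1) / 5).unpair.1, q.1.1, q.1.2) := hD.comp (by fun_prop)
  have hl : Computable fun q : (ℕ × ℕ) × List (ℚ × ℚ) => decide (q.2.length = 0) :=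
    computable_decide_eq (by fun_prop) (by fun_prop)
  have he : Computable fun q : (ℕ × ℕ) × List (ℚ × ℚ) => (1 / 2 : ℚ) ^ q.1.2 := by fun_prop
  have hm : Computable fun q : (ℕ × ℕ) × List (ℚ × ℚ) => (q.2.length - 1) % 5 := by fun_prop
  have hu : Computable fun q : (ℕ × ℕ) × List (ℚ × ℚ) => ((q.2.length - 1) / 5).unpair.1 := by
    fun_prop
  have hv : Computable fun q : (ℕ × ℕ) × List (ℚ × ℚ) => ((q.2.length - 1) / 5).unpair.2 := by
    fun_prop
  have hA : Computable fun q : (ℕ × ℕ) × List (ℚ × ℚ) =>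
      q.2.getD ((q.2.length - 1) / 5).unpair.1 (0, 0) := by fun_prop
  have hB : Computable fun q : (ℕ × ℕ) × List (ℚ × ℚ) =>
      q.2.getD ((q.2.length - 1) / 5).unpair.2 (0, 0) := by fun_prop
  unfold boundsStep
  exact computable_ite hl (Computable.const _) (computable_boundsOp hm hu hv hd he hA hB)

theorem computable_boundsList {D : ℕ × ℕ × ℕ → ℚ} (hD : Computable D) :
    Computable fun p : (ℕ × ℕ) × ℕ => boundsList D p.1 p.2 := by
  have hs : Computable fun q : ((ℕ × ℕ) × ℕ) × ℕ × List (ℚ × ℚ) =>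
      q.2.2 ++ [boundsStep D (q.1.1, q.2.2)] :=
    Computable.list_append.comp (by fun_prop : Computable fun q :
      ((ℕ × ℕ) × ℕ) × ℕ × List (ℚ × ℚ) => q.2.2) (Computable.list_cons.comp
      ((computable_boundsStep hD).comp (by fun_prop : Computable fun q :
      ((ℕ × ℕ) × ℕ) × ℕ × List (ℚ × ℚ) => (q.1.1, q.2.2))) (Computable.const []))
  refine (Computable.nat_rec (f := fun p : (ℕ × ℕ) × ℕ => p.2) (g := fun _ => ([] : List (ℚ × ℚ)))
    (h := fun p q => q.2 ++ [boundsStep D (p.1, q.2)]) (by fun_prop) (by fun_prop) hs).of_eq ?_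
  rintro ⟨a, n⟩
  induction n with
  | zero => rfl
  | succ n ih => simp only [boundsList] at ih ⊢; rw [← ih]

theorem computable_basicFunBounds {D : ℕ × ℕ × ℕ → ℚ} (hD : Computable D) :
    Computable fun p : (ℕ × ℕ) × ℕ => basicFunBounds D p.1 p.2 :=
  (computable_boundsStep hD).comp (by
    have := computable_boundsList hD
    fun_prop : Computable fun p : (ℕ × ℕ) × ℕ => (p.1, boundsList D p.1 p.2))

@[simp] theorem length_boundsList (D : ℕ × ℕ × ℕ → ℚ) (a : ℕ × ℕ) (n : ℕ) :
    (boundsList D a n).length = n := by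
  induction n with
  | zero => rfl
  | succ n ih => simp [boundsList, ih]

theorem getD_boundsList (D : ℕ × ℕ × ℕ → ℚ) (a : ℕ × ℕ) {m n : ℕ} (h : m < n) :
    (boundsList D a n).getD m (0, 0) = basicFunBounds D a m := by
  induction n with
  | zero => omega
  | succ n ih =>
    rcases Nat.lt_succ_iff_lt_or_eq.1 h with h | rfl
    · rw [boundsList, List.getD_append _ _ _ _ (by simpa using h), ih h]
    · rw [boundsList, List.getD_append_right _ _ _ _ (by simp)]
      simp [basicFunBounds]

theorem basicFunBounds_zero (D : ℕ × ℕ × ℕ → ℚ) (a : ℕ × ℕ) : basicFunBounds D a 0 = (1, 1) := rfl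

theorem basicFunBounds_succ (D : ℕ × ℕ × ℕ → ℚ) (a : ℕ × ℕ) (n : ℕ) :
    basicFunBounds D a (n + 1) = boundsOp (n % 5) (n / 5).unpair.1 (n / 5).unpair.2
      (D ((n / 5).unpair.1, a)) ((1 / 2) ^ a.2) (basicFunBounds D a (n / 5).unpair.1)
      (basicFunBounds D a (n / 5).unpair.2) := by
  have h := unpair_div_lt n
  rw [← getD_boundsList D a h.1, ← getD_boundsList D a h.2, basicFunBounds, boundsStep]
  simp

theorem clampBump_cast (r t d : ℚ) : (clampBump r t d : ℝ) = max 0 (min 1 ((r + t - d) / t)) := by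
  unfold clampBump; push_cast; rfl

theorem clampBump_anti {r t d e : ℝ} (ht : 0 < t) (h : d ≤ e) :
    max 0 (min 1 ((r + t - e) / t)) ≤ max 0 (min 1 ((r + t - d) / t)) := by gcongr

theorem min_mul_le_max (c : ℝ) {x l h : ℝ} (h1 : l ≤ x) (h2 : x ≤ h) :
    min (c * l) (c * h) ≤ c * x ∧ c * x ≤ max (c * l) (c * h) := by
  rcases le_total 0 c with hc | hc
  · exact ⟨(min_le_left _ _).trans (mul_le_mul_of_nonneg_left h1 hc),
      (mul_le_mul_of_nonneg_left h2 hc).trans (le_max_right _ _)⟩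
  · exact ⟨(min_le_right _ _).trans (mul_le_mul_of_nonpos_left h2 hc),
      (mul_le_mul_of_nonpos_left h1 hc).trans (le_max_left _ _)⟩

variable {X : Type*} [PseudoMetricSpace X] [BasicPoints X]

/-- Induction on the code. Together with the convergence of the bounds this makes all values at
basic points computable, uniformly in the codes. -/
theorem basicFunBounds_spec {D : ℕ × ℕ × ℕ → ℚ}
    (hD : ∀ j l i, |(D (j, l, i) : ℝ) - dist (basic j : X) (basic l)| ≤ (1 / 2) ^ i) (l i n : ℕ) :
    ((basicFunBounds D (l, i) n).1 : ℝ) ≤ basicFun X n (basic l) ∧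
      basicFun X n (basic l) ≤ (basicFunBounds D (l, i) n).2 := by
  induction n using Nat.strong_induction_on with
  | _ n ih =>
  cases n with
  | zero => simp [basicFunBounds_zero, basicFun_zero]
  | succ n =>
    obtain ⟨h1, h2⟩ := unpair_div_lt n
    obtain ⟨a1, a2⟩ := ih _ h1
    obtain ⟨b1, b2⟩ := ih _ h2
    rw [basicFunBounds_succ, basicFun_succ, boundsOp]
    split_ifs
    · have hd := abs_le.1 (hD (n / 5).unpair.1 l i)
      have ht := posRatOf_cast_pos (n / 5).unpair.2.unpair.2
      rw [bump_eq _ _ ht]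
      simp only [clampBump_cast]
      push_cast
      exact ⟨clampBump_anti ht (by linarith), clampBump_anti ht (by linarith)⟩
    · push_cast; exact ⟨max_le_max a1 b1, max_le_max a2 b2⟩
    · push_cast; exact ⟨min_le_min a1 b1, min_le_min a2 b2⟩
    · push_cast; exact ⟨add_le_add a1 b1, add_le_add a2 b2⟩
    · push_cast; exact min_mul_le_max _ b1 b2

theorem tendsto_basicFunBounds {D : ℕ × ℕ × ℕ → ℚ}
    (hD : ∀ j l i, |(D (j, l, i) : ℝ) - dist (basic j : X) (basic l)| ≤ (1 / 2) ^ i) (l n : ℕ) :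
    Tendsto (fun i => ((basicFunBounds D (l, i) n).1 : ℝ)) atTop (𝓝 (basicFun X n (basic l))) ∧
      Tendsto (fun i => ((basicFunBounds D (l, i) n).2 : ℝ)) atTop
        (𝓝 (basicFun X n (basic l))) := by
  induction n using Nat.strong_induction_on with
  | _ n ih =>
  cases n with
  | zero => simp [basicFunBounds_zero, basicFun_zero]
  | succ n =>
    obtain ⟨h1, h2⟩ := unpair_div_lt n
    obtain ⟨a1, a2⟩ := ih _ h1
    obtain ⟨b1, b2⟩ := ih _ h2
    simp only [basicFunBounds_succ, basicFun_succ, boundsOp]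
    split_ifs
    · have ht := posRatOf_cast_pos (n / 5).unpair.2.unpair.2
      have hd : Tendsto (fun i => (D ((n / 5).unpair.1, l, i) : ℝ)) atTop
          (𝓝 (dist (basic (n / 5).unpair.1 : X) (basic l))) :=
        tendsto_iff_norm_sub_tendsto_zero.2 (squeeze_zero (fun _ => norm_nonneg _)
          (fun i => hD _ l i) tendsto_half_pow)
      rw [bump_eq _ _ ht]
      simp only [clampBump_cast]
      push_cast
      constructor
      · refine tendsto_const_nhds.max (tendsto_const_nhds.min ((tendsto_const_nhds.sub ?_).div_const _))
        simpa using hd.add tendsto_half_pow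
      · refine tendsto_const_nhds.max (tendsto_const_nhds.min ((tendsto_const_nhds.sub ?_).div_const _))
        simpa using hd.sub tendsto_half_pow
    · push_cast; exact ⟨a1.max b1, a2.max b2⟩
    · push_cast; exact ⟨a1.min b1, a2.min b2⟩
    · push_cast; exact ⟨a1.add b1, a2.add b2⟩
    · push_cast
      have c1 := b1.const_mul (ratOf (n / 5).unpair.1 : ℝ)
      have c2 := b2.const_mul (ratOf (n / 5).unpair.1 : ℝ)
      exact ⟨by simpa using c1.min c2, by simpa using c1.max c2⟩

end BasicFunBounds

-- Integrals of basic functions and the distance of measures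

section Integrals

variable {I α : Type*} [Primcodable α] {o : I → ℕ → ℕ}
  {X : Type*} [MetricSpace X] [BasicPoints X] [IsComputableMetricSpace X]

theorem exists_basicFun_bounds (X : Type*) [MetricSpace X] [BasicPoints X]
    [IsComputableMetricSpace X] : ∃ lo hi : (ℕ × ℕ) × ℕ → ℚ, Computable lo ∧ Computable hi ∧
      ∀ p, ((∀ i, (lo (p, i) : ℝ) ≤ basicFun X p.1 (basic p.2)) ∧
          Tendsto (fun i => (lo (p, i) : ℝ)) atTop (𝓝 (basicFun X p.1 (basic p.2)))) ∧
        (∀ i, basicFun X p.1 (basic p.2) ≤ hi (p, i)) ∧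
          Tendsto (fun i => (hi (p, i) : ℝ)) atTop (𝓝 (basicFun X p.1 (basic p.2))) := by
  obtain ⟨c, hc, hc1, hc2⟩ := IsComputableMetricSpace.computable_dist (X := X)
  have hc3 : Computable fun p : ℕ × ℕ => c p.1 p.2 := hc
  obtain ⟨D, hD, hD'⟩ : ∃ D : ℕ × ℕ × ℕ → ℚ, Computable D ∧
      ∀ j l i, |(D (j, l, i) : ℝ) - dist (basic j : X) (basic l)| ≤ (1 / 2) ^ i :=
    ⟨fun p => ratOf (c (Nat.pair p.1 p.2.1) p.2.2), computable_ratOf (hc3.comp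
      (g := fun q : ℕ × ℕ × ℕ => (Nat.pair q.1 q.2.1, q.2.2)) (by fun_prop)),
      fun j l i => by simpa using ComputableRealSeq.abs_sub_le hc1 hc2 (Nat.pair j l) i⟩
  have hB : Computable fun q : (ℕ × ℕ) × ℕ => basicFunBounds D (q.1.2, q.2) q.1.1 :=
    (computable_basicFunBounds hD).comp
      (by fun_prop : Computable fun q : (ℕ × ℕ) × ℕ => ((q.1.2, q.2), q.1.1))
  exact ⟨_, _, Computable.fst.comp hB, Computable.snd.comp hB, fun p =>
    ⟨⟨fun i => (basicFunBounds_spec hD' p.2 i p.1).1, (tendsto_basicFunBounds hD' p.2 p.1).1⟩,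
      fun i => (basicFunBounds_spec hD' p.2 i p.1).2, (tendsto_basicFunBounds hD' p.2 p.1).2⟩⟩

/-- Rational bounds that converge to the value from both sides suffice for the two cuts. No rate of
convergence is needed, and none is tracked through the recursion. -/
theorem computable_basicFun (X : Type*) [MetricSpace X] [BasicPoints X]
    [IsComputableMetricSpace X] : ComputableRealIn o fun (_ : I) (p : ℕ × ℕ) =>
      basicFun X p.1 (basic p.2) := by
  obtain ⟨lo, hi, hlo, hhi, H⟩ := exists_basicFun_bounds X
  refine ⟨LowerIn.of_lt_iff_exists (f := fun _ p i => (lo (p, i) : ℝ)) (LowerIn.of_rat hlo)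
      fun _ p q => ⟨fun h => ?_, fun ⟨i, h⟩ => h.trans_le ((H p).1.1 i)⟩,
    LowerIn.of_lt_iff_exists (f := fun _ p i => ((-hi (p, i) : ℚ) : ℝ))
      (LowerIn.of_rat (computable_rat_neg hhi)) fun _ p q => ⟨fun h => ?_, fun ⟨i, h⟩ =>
        h.trans_le (by push_cast; exact neg_le_neg ((H p).2.1 i))⟩⟩
  · exact ((H p).1.2.eventually_const_lt h).exists
  · push_cast
    exact ((H p).2.2.neg.eventually_const_lt h).exists

variable [MeasurableSpace X] [BorelSpace X]

theorem computable_basicIntegral_basic (X : Type*) [MetricSpace X] [BasicPoints X]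
    [IsComputableMetricSpace X] [MeasurableSpace X] [BorelSpace X] :
    ComputableRealIn o fun (_ : I) (p : ℕ × ℕ) => basicIntegral (basic p.1 : Measures X) p.2 := by
  have h1 : Computable fun q : (ℕ × ℕ) × ℕ => (Denumerable.ofNat (List ℕ) q.1.1).getD q.2 0 := by
    fun_prop
  have h2 : ComputableRealIn o fun (_ : I) (q : (ℕ × ℕ) × ℕ) =>
      (posRatOf ((Denumerable.ofNat (List ℕ) q.1.1).getD q.2 0).unpair.2 : ℝ) *
        basicFun X q.1.2 (basic ((Denumerable.ofNat (List ℕ) q.1.1).getD q.2 0).unpair.1) :=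
    ((computable_basicFun X).comp (u := fun q : (ℕ × ℕ) × ℕ =>
      (q.1.2, ((Denumerable.ofNat (List ℕ) q.1.1).getD q.2 0).unpair.1)) (by fun_prop)).rat_mul
      (c := fun q : (ℕ × ℕ) × ℕ =>
        posRatOf ((Denumerable.ofNat (List ℕ) q.1.1).getD q.2 0).unpair.2) (by fun_prop)
      fun _ => posRatOf_pos _
  exact (ComputableRealIn.sum_range (f := fun (_ : I) (p : ℕ × ℕ) j =>
      (posRatOf ((Denumerable.ofNat (List ℕ) p.1).getD j 0).unpair.2 : ℝ) *
        basicFun X p.2 (basic ((Denumerable.ofNat (List ℕ) p.1).getD j 0).unpair.1)) h2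
      (n := fun p => (Denumerable.ofNat (List ℕ) p.1).length) (by fun_prop)).congr
    fun _ p => basicIntegral_basic p.1 p.2

/-- Partial sums of the defining series are computable, and the terms from index `n` on contribute
at most `2 · 2⁻ⁿ`. -/
theorem computableDist_measures (X : Type*) [MetricSpace X] [BasicPoints X]
    [IsComputableMetricSpace X] [MeasurableSpace X] [BorelSpace X] :
    ComputableDist (Measures X) := by
  have h1 : ComputableRealIn (fun (_ : Unit) (_ : ℕ) => 0) fun _ (q : ((ℕ × ℕ) × ℕ) × ℕ) =>
      ((1 / 2 : ℚ) ^ q.2 : ℚ) * (1 - Real.exp (-|basicIntegral (basic q.1.1.1 : Measures X) q.2 -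
        basicIntegral (basic q.1.1.2 : Measures X) q.2|)) :=
    (((ComputableRealIn.of_rat (f := fun _ => (1 : ℚ)) (by fun_prop)).congr
      (g := fun _ _ => (1 : ℝ)) fun _ _ => by simp).sub
      ((((computable_basicIntegral_basic X).comp
        (u := fun q : ((ℕ × ℕ) × ℕ) × ℕ => (q.1.1.1, q.2)) (by fun_prop)).sub
      ((computable_basicIntegral_basic X).comp
        (u := fun q : ((ℕ × ℕ) × ℕ) × ℕ => (q.1.1.2, q.2)) (by fun_prop))).abs.neg.exp)).rat_mul
      (by fun_prop) fun _ => by positivity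
  have h2 : ComputableRealIn (fun (_ : Unit) (_ : ℕ) => 0) fun _ (q : (ℕ × ℕ) × ℕ) =>
      ∑ i ∈ Finset.range q.2, measureDistTerm (basic q.1.1 : Measures X) (basic q.1.2) i :=
    (ComputableRealIn.sum_range (f := fun _ (q : (ℕ × ℕ) × ℕ) i =>
      ((1 / 2 : ℚ) ^ i : ℚ) * (1 - Real.exp (-|basicIntegral (basic q.1.1 : Measures X) i -
        basicIntegral (basic q.1.2 : Measures X) i|))) h1 (n := fun q => q.2) (by fun_prop)).congr
      fun _ q => by
        refine Finset.sum_congr rfl fun i _ => ?_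
        rw [measureDistTerm]; push_cast; rfl
  refine ComputableRealIn.of_approx (g := fun _ p n =>
    ∑ i ∈ Finset.range n, measureDistTerm (basic p.1 : Measures X) (basic p.2) i) h2 (e := fun _ n => 2 * (1 / 2) ^ n) (by fun_prop)
    (fun _ => ?_) fun _ p n => ?_
  · push_cast
    simpa using tendsto_half_pow.const_mul 2
  · have hs := summable_measureDistTerm (basic p.1 : Measures X) (basic p.2)
    have ht := hs.sum_add_tsum_nat_add n
    rw [measures_dist_eq, ← ht]
    have h3 : ∑' i, measureDistTerm (basic p.1 : Measures X) (basic p.2) (i + n) ≤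
        ∑' i, (1 / 2 : ℝ) ^ i * (1 / 2) ^ n := by
      refine ((summable_nat_add_iff n).2 hs).tsum_le_tsum (fun i => ?_)
        (summable_geometric_two.mul_right _)
      rw [← pow_add]; exact measureDistTerm_le _ _ _
    have h4 : 0 ≤ ∑' i, measureDistTerm (basic p.1 : Measures X) (basic p.2) (i + n) :=
      tsum_nonneg fun i => measureDistTerm_nonneg _ _ _
    rw [tsum_mul_right, tsum_geometric_two] at h3
    push_cast
    rw [abs_le]
    constructor <;> linarith

theorem PointIn.basicIntegral {ν : I → α → Measures X} (hν : PointIn o ν) :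
    ComputableRealIn o fun i (p : α × ℕ) => basicIntegral (ν i p.1) p.2 := by
  obtain ⟨G, hG, hG'⟩ := hν
  have h1 : ComputableRealIn o fun (_ : I) (q : ((α × ℕ) × ℕ) × ℕ) =>
      SchnorrRandomness.basicIntegral (basic q.2 : Measures X) q.1.1.2 :=
    (computable_basicIntegral_basic X).comp (u := fun q : ((α × ℕ) × ℕ) × ℕ => (q.2, q.1.1.2))
      (by fun_prop)
  -- The shift of the index by `m + 1`, for the basic function with code `m`, is the modulus of
  -- continuity from `abs_basicIntegral_sub_le`.
  have h2 : SemidecidableIn o fun i (q : ((α × ℕ) × ℕ) × ℕ) =>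
      G i q.1.1.1 (q.1.1.2 + 1 + q.1.2) = q.2 := by
    refine hG.comp (g := fun q : ((α × ℕ) × ℕ) × ℕ => (q.1.1.1, q.1.1.2 + 1 + q.1.2, q.2)) ?_
    fun_prop
  have h3 : ComputableRealIn o fun i (q : (α × ℕ) × ℕ) =>
      SchnorrRandomness.basicIntegral (basic (G i q.1.1 (q.1.2 + 1 + q.2)) : Measures X) q.1.2 :=
    h1.subst_value (g := fun i q => G i q.1.1 (q.1.2 + 1 + q.2)) h2
  refine ComputableRealIn.of_approx (g := fun i p n =>
    SchnorrRandomness.basicIntegral (basic (G i p.1 (p.2 + 1 + n)) : Measures X) p.2)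
    h3 (e := fun _ n => (1 / 2) ^ n) (by fun_prop) (fun _ => tendsto_half_pow_cast)
    fun i p n => ?_
  push_cast
  exact abs_basicIntegral_sub_le ((hG' i p.1).dist_le _)

end Integrals

/-! ### Integrals over Baire space -/

/-- The sequence of pairs of the members of two sequences. -/
def zipSeq (h κ : ℕ → ℕ) (n : ℕ) : ℕ := Nat.pair (h n) (κ n)

/-- The list of pairs of the members of two lists. -/
def zipList (s σ : List ℕ) : List ℕ :=
  (List.range s.length).map fun n => Nat.pair (s.getD n 0) (σ.getD n 0)

theorem initialSegment_zipSeq (h κ : ℕ → ℕ) (k : ℕ) :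
    initialSegment (zipSeq h κ) k = zipList (initialSegment h k) (initialSegment κ k) := by
  unfold zipList
  rw [length_initialSegment, initialSegment]
  refine List.map_congr_left fun n hn => ?_
  have hn := List.mem_range.1 hn
  rw [getD_initialSegment h hn, getD_initialSegment κ hn]; rfl

@[fun_prop] theorem computable_zipList {α : Type*} [Primcodable α] {s σ : α → List ℕ}
    (hs : Computable s) (hσ : Computable σ) : Computable fun a => zipList (s a) (σ a) :=
  computable_map_range (f := fun q : α × ℕ => Nat.pair ((s q.1).getD q.2 0) ((σ q.1).getD q.2 0))
    (by fun_prop) (by fun_prop)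

/-- The set of the sequences that extend a given list. -/
def cylinderSet (σ : List ℕ) : Set (ℕ → ℕ) := {κ | initialSegment κ σ.length = σ}

theorem cylinderSet_eq (σ : List ℕ) :
    cylinderSet σ = ⋂ j ∈ Finset.range σ.length, {κ | κ j = σ.getD j 0} := by
  ext κ
  simp [cylinderSet, eq_comm (a := initialSegment κ _), eq_initialSegment_iff]

theorem measurableSet_cylinderSet (σ : List ℕ) : MeasurableSet (cylinderSet σ) := by
  rw [cylinderSet_eq]
  exact Finset.measurableSet_biInter _ fun j _ =>
    (measurable_pi_apply (X := fun _ : ℕ => ℕ) j) (measurableSet_singleton (σ.getD j 0))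

theorem measurable_initialSegment (k : ℕ) :
    Measurable[MeasurableSpace.pi, ⊤] fun κ => initialSegment κ k := by
  let _ : MeasurableSpace (List ℕ) := ⊤
  refine measurable_to_countable' fun σ => ?_
  by_cases h : σ.length = k
  · subst h; exact measurableSet_cylinderSet σ
  · convert MeasurableSet.empty
    ext κ
    simp only [Set.mem_preimage, Set.mem_singleton_iff, Set.mem_empty_iff_false, iff_false]
    rintro rfl; simp at h

-- Step functions that increase to a lower semicomputable function

section Approximation

variable (φ : List ℕ × ℚ → Bool)

/-- The largest of the first rationals that are accepted by a test. -/
noncomputable def acceptedSup (s : List ℕ) : ℝ≥0 :=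
  (Finset.range s.length).sup fun c => if φ (s, ratOf c) = true then (ratOf c : ℝ).toNNReal else 0

theorem acceptedSup_eq_zero_or (s : List ℕ) :
    acceptedSup φ s = 0 ∨ ∃ r : ℚ, 0 < r ∧ φ (s, r) = true ∧ (acceptedSup φ s : ℝ) = r := by
  rcases (Finset.range s.length).eq_empty_or_nonempty with h | h
  · left; simp [acceptedSup, h]
  · obtain ⟨c, _, hc⟩ := Finset.exists_mem_eq_sup _ h
      fun c => if φ (s, ratOf c) = true then (ratOf c : ℝ).toNNReal else 0
    rw [acceptedSup, hc]
    split_ifs with h1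
    · rcases le_or_gt (ratOf c) 0 with h2 | h2
      · left; exact Real.toNNReal_of_nonpos (by exact_mod_cast h2)
      · exact Or.inr ⟨ratOf c, h2, h1, Real.coe_toNNReal _ (by exact_mod_cast h2.le)⟩
    · exact Or.inl rfl

variable {φ} {h : ℕ → ℕ} {x : ℝ}

theorem acceptedSup_mono (hφ : ∀ q k l, k ≤ l → φ (initialSegment h k, q) = true →
    φ (initialSegment h l, q) = true) : Monotone fun k => acceptedSup φ (initialSegment h k) := by
  intro k l hkl
  simp only [acceptedSup, length_initialSegment]
  refine (Finset.sup_mono_fun fun c _ => ?_).trans (Finset.sup_mono (Finset.range_mono hkl))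
  split_ifs with h1 h2
  · exact le_rfl
  · exact absurd (hφ _ _ _ hkl h1) h2
  · exact zero_le
  · exact le_rfl

theorem acceptedSup_le (hx : ∀ q : ℚ, (q : ℝ) < x ↔ ∃ k, φ (initialSegment h k, q) = true)
    (h0 : 0 ≤ x) (k : ℕ) : (acceptedSup φ (initialSegment h k) : ℝ) ≤ x := by
  rcases acceptedSup_eq_zero_or φ (initialSegment h k) with e | ⟨r, _, h2, e⟩
  · simpa [e] using h0
  · rw [e]; exact ((hx r).2 ⟨k, h2⟩).le

/-- Each rational below the limit is eventually accepted, and its code is eventually below the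
prefix length. At stage `k` the approximation depends only on the first `k` places, so it is a step
function on cylinders. -/
theorem tendsto_acceptedSup (hφ : ∀ q k l, k ≤ l → φ (initialSegment h k, q) = true →
    φ (initialSegment h l, q) = true)
    (hx : ∀ q : ℚ, (q : ℝ) < x ↔ ∃ k, φ (initialSegment h k, q) = true) (h0 : 0 ≤ x) :
    Tendsto (fun k => (acceptedSup φ (initialSegment h k) : ℝ)) atTop (𝓝 x) := by
  refine tendsto_order.2 ⟨fun y hy => ?_, fun y hy =>
    Eventually.of_forall fun k => (acceptedSup_le hx h0 k).trans_lt hy⟩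
  obtain ⟨r, h1, h2⟩ := exists_rat_btwn hy
  obtain ⟨c, rfl⟩ := ratOf_surjective r
  obtain ⟨k, hk⟩ := (hx _).1 h2
  filter_upwards [eventually_ge_atTop (max k (c + 1))] with l hl
  refine h1.trans_le ((Real.le_coe_toNNReal _).trans ?_)
  have h3 : c ∈ Finset.range l := Finset.mem_range.2 (by omega)
  have h4 := Finset.le_sup (s := Finset.range l) (f := fun c =>
    if φ (initialSegment h l, ratOf c) = true then (ratOf c : ℝ).toNNReal else 0) h3
  simp only [if_pos (hφ _ _ _ (by omega : k ≤ l) hk)] at h4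
  rw [acceptedSup, length_initialSegment]
  exact_mod_cast h4

end Approximation

section IntegralBaire

/-- A certificate that the integral of a lower semicomputable function exceeds `q`. -/
def IntegralCertificate (ξ : Measure (ℕ → ℕ)) (ψ : List ℕ × ℚ → Bool) (k : ℕ) (q : ℚ)
    (L : List (List ℕ × ℚ × ℚ)) : Prop :=
  (∀ j < L.length, ((L.getD j ([], 0, 0)).1.length = k ∧ 0 < (L.getD j ([], 0, 0)).2.1) ∧
    ψ ((L.getD j ([], 0, 0)).1, (L.getD j ([], 0, 0)).2.1) = true ∧
    (((L.getD j ([], 0, 0)).2.2 / (L.getD j ([], 0, 0)).2.1 : ℚ) : ℝ) <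
      ξ.real (cylinderSet (L.getD j ([], 0, 0)).1)) ∧
  (∀ j < L.length, ∀ i < j, (L.getD i ([], 0, 0)).1 ≠ (L.getD j ([], 0, 0)).1) ∧
  q < ∑ j ∈ Finset.range L.length, (L.getD j ([], 0, 0)).2.2

variable {ξ : Measure (ℕ → ℕ)} {f : (ℕ → ℕ) → ℝ}
  {ψ : List ℕ × ℚ → Bool}

/-- Cylinders over distinct strings of equal length are disjoint, so the listed values define a step
function below `f`. The rational `t j` is below the contribution `r j * ξ.real (cylinderSet (σ j))`
of the `j`-th cylinder. -/
theorem IntegralCertificate.lt_integral [IsProbabilityMeasure ξ] {k : ℕ} {q : ℚ} {L : List (List ℕ × ℚ × ℚ)}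
    (hL : IntegralCertificate ξ ψ k q L)
    (hψ : ∀ κ (q : ℚ), ψ (initialSegment κ k, q) = true → (q : ℝ) < f κ)
    (h0 : ∀ κ, 0 ≤ f κ) (hf : Integrable f ξ) : (q : ℝ) < ∫ κ, f κ ∂ξ := by
  obtain ⟨h1, h2, h3⟩ := hL
  set σ : ℕ → List ℕ := fun j => (L.getD j ([], 0, 0)).1 with hσ
  set r : ℕ → ℚ := fun j => (L.getD j ([], 0, 0)).2.1 with hr
  set t : ℕ → ℚ := fun j => (L.getD j ([], 0, 0)).2.2 with ht
  have hint : ∀ j ∈ Finset.range L.length,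
      Integrable ((cylinderSet (σ j)).indicator fun _ => (r j : ℝ)) ξ :=
    fun j _ => (integrable_const _).indicator (measurableSet_cylinderSet _)
  have hpt : ∀ κ, ∑ j ∈ Finset.range L.length,
      (cylinderSet (σ j)).indicator (fun _ => (r j : ℝ)) κ ≤ f κ := by
    intro κ
    by_cases hκ : ∃ j ∈ Finset.range L.length, κ ∈ cylinderSet (σ j)
    · obtain ⟨j, hj, hjκ⟩ := hκ
      have hj' := Finset.mem_range.1 hj
      rw [Finset.sum_eq_single_of_mem j hj, Set.indicator_of_mem hjκ]
      · refine (hψ κ (r j) ?_).le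
        have := (h1 j hj').2.1
        rw [← (h1 j hj').1.1]
        rwa [show initialSegment κ _ = σ j from hjκ]
      · intro i hi hij
        refine Set.indicator_of_notMem (fun hiκ => ?_) _
        have e : σ i = σ j := by
          rw [← show initialSegment κ (σ i).length = σ i from hiκ,
            ← show initialSegment κ (σ j).length = σ j from hjκ,
            (h1 i (Finset.mem_range.1 hi)).1.1, (h1 j hj').1.1]
        rcases lt_or_gt_of_ne hij with h | h
        · exact h2 j hj' i h e
        · exact h2 i (Finset.mem_range.1 hi) j h e.symm
    · push Not at hκ
      rw [Finset.sum_eq_zero fun j hj => Set.indicator_of_notMem (hκ j hj) _]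
      exact h0 κ
  calc (q : ℝ) < ((∑ j ∈ Finset.range L.length, t j : ℚ) : ℝ) := Rat.cast_lt.2 h3
    _ = ∑ j ∈ Finset.range L.length, (t j : ℝ) := by push_cast; rfl
    _ ≤ ∑ j ∈ Finset.range L.length,
        ∫ κ, (cylinderSet (σ j)).indicator (fun _ => (r j : ℝ)) κ ∂ξ := by
      refine Finset.sum_le_sum fun j hj => ?_
      rw [integral_indicator_const _ (measurableSet_cylinderSet _), smul_eq_mul]
      obtain ⟨⟨_, h5⟩, _, h6⟩ := h1 j (Finset.mem_range.1 hj)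
      have h5' : (0 : ℝ) < r j := by exact_mod_cast h5
      rw [Rat.cast_div, div_lt_iff₀ h5'] at h6
      exact h6.le
    _ = ∫ κ, ∑ j ∈ Finset.range L.length,
        (cylinderSet (σ j)).indicator (fun _ => (r j : ℝ)) κ ∂ξ := (integral_finsetSum _ hint).symm
    _ ≤ ∫ κ, f κ ∂ξ := integral_mono (integrable_finsetSum _ hint) hf hpt

/-- By monotone convergence some stage `k` of the step functions already has integral above `q`.
That integral is a countable sum over strings, so finitely many strings suffice, and their
contributions can be lowered to rationals. -/
theorem exists_integralCertificate {φ : List ℕ × ℚ → Bool}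
    {h : ℕ → ℕ} (hφ : ∀ κ q k l, k ≤ l → φ (initialSegment (zipSeq h κ) k, q) = true →
      φ (initialSegment (zipSeq h κ) l, q) = true)
    (hx : ∀ κ (q : ℚ), (q : ℝ) < f κ ↔ ∃ k, φ (initialSegment (zipSeq h κ) k, q) = true)
    (h0 : ∀ κ, 0 ≤ f κ) (hf : Integrable f ξ) {q : ℚ} (hq : (q : ℝ) < ∫ κ, f κ ∂ξ) :
    ∃ k L, IntegralCertificate ξ (fun p => φ (zipList (initialSegment h k) p.1, p.2)) k q L := by
  classical
  rcases lt_or_ge q 0 with hq0 | hq0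
  · exact ⟨0, [], by simp [IntegralCertificate, hq0]⟩
  let _ : MeasurableSpace (List ℕ) := ⊤
  have _ : DiscreteMeasurableSpace (List ℕ) := ⟨fun _ => trivial⟩
  let Φ : ℕ → List ℕ → ℝ := fun k σ => acceptedSup φ (zipList (initialSegment h k) σ)
  have hΦ : ∀ k κ, Φ k (initialSegment κ k) = acceptedSup φ (initialSegment (zipSeq h κ) k) :=
    fun k κ => by rw [initialSegment_zipSeq]
  have hmeas : ∀ k, Measurable fun κ => initialSegment κ k := measurable_initialSegment
  have hle : ∀ k κ, Φ k (initialSegment κ k) ≤ f κ := fun k κ => by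
    rw [hΦ]; exact acceptedSup_le (hx κ) (h0 κ) k
  have hΦ0 : ∀ k σ, 0 ≤ Φ k σ := fun k σ => NNReal.coe_nonneg _
  have hΦm : ∀ k, Measurable fun κ => Φ k (initialSegment κ k) := fun k =>
    (Measurable.of_discrete (f := Φ k)).comp (hmeas k)
  have hΦi : ∀ k, Integrable (fun κ => Φ k (initialSegment κ k)) ξ := fun k =>
    hf.mono' (hΦm k).aestronglyMeasurable (ae_of_all _ fun κ => by
      rw [Real.norm_of_nonneg (hΦ0 _ _)]; exact hle k κ)
  have hlim : Tendsto (fun k => ∫ κ, Φ k (initialSegment κ k) ∂ξ) atTop (𝓝 (∫ κ, f κ ∂ξ)) := by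
    refine integral_tendsto_of_tendsto_of_monotone hΦi hf (ae_of_all _ fun κ k l hkl => ?_)
      (ae_of_all _ fun κ => ?_)
    · simp only [hΦ]
      exact_mod_cast acceptedSup_mono (hφ κ) hkl
    · simp only [hΦ]
      exact tendsto_acceptedSup (hφ κ) (hx κ) (h0 κ)
  obtain ⟨k, hk⟩ := (hlim.eventually_const_lt hq).exists
  refine ⟨k, ?_⟩
  have hmap : ∫ κ, Φ k (initialSegment κ k) ∂ξ =
      ∫ σ, Φ k σ ∂(ξ.map fun κ => initialSegment κ k) :=
    (integral_map (hmeas k).aemeasurable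
      (Measurable.of_discrete (f := Φ k)).aestronglyMeasurable).symm
  have hi : Integrable (Φ k) (ξ.map fun κ => initialSegment κ k) :=
    (integrable_map_measure (Measurable.of_discrete (f := Φ k)).aestronglyMeasurable
      (hmeas k).aemeasurable).2 (hΦi k)
  rw [hmap, integral_countable hi] at hk
  -- A sum that does not converge has the value `0` by convention, which cannot exceed `q ≥ 0`; this
  -- is why negative `q` was settled separately by the empty list.
  have hs : Summable fun σ => (ξ.map fun κ => initialSegment κ k).real {σ} • Φ k σ := by
    by_contra hs
    rw [tsum_eq_zero_of_not_summable hs] at hk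
    exact absurd hk (not_lt.2 (by exact_mod_cast hq0))
  obtain ⟨s, hs⟩ := (hs.hasSum.eventually_const_lt hk).exists
  set w : List ℕ → ℝ := fun σ => (ξ.map fun κ => initialSegment κ k).real {σ} • Φ k σ with hw
  have hw0 : ∀ σ, 0 ≤ w σ := fun σ => mul_nonneg measureReal_nonneg (hΦ0 k σ)
  have hwk : ∀ σ, 0 < w σ → σ.length = k := by
    intro σ hσ
    by_contra hne
    have : (ξ.map fun κ => initialSegment κ k).real {σ} = 0 := by
      rw [map_measureReal_apply (hmeas k) (MeasurableSet.singleton σ)]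
      have : (fun κ => initialSegment κ k) ⁻¹' {σ} = ∅ := by
        ext κ
        simp only [Set.mem_preimage, Set.mem_singleton_iff, Set.mem_empty_iff_false, iff_false]
        rintro rfl; simp at hne
      simp [this]
    rw [hw] at hσ
    simp [this] at hσ
  have hwξ : ∀ σ, σ.length = k → w σ = ξ.real (cylinderSet σ) * Φ k σ := by
    rintro σ rfl
    rw [hw]
    simp only [smul_eq_mul]
    rw [map_measureReal_apply (hmeas _) (MeasurableSet.singleton σ)]; rfl
  -- Strings without weight are dropped: the remaining ones have length `k` and a positive accepted
  -- rational, as a certificate requires.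
  have hs' : (q : ℝ) < ∑ σ ∈ s.filter fun σ => 0 < w σ, w σ := by
    rwa [Finset.sum_filter_of_ne fun σ _ hσ => lt_of_le_of_ne (hw0 σ) (Ne.symm hσ)]
  set S := (s.filter fun σ => 0 < w σ).toList with hS
  have hSpos : ∀ σ ∈ S, 0 < w σ := fun σ hσ => by
    rw [hS, Finset.mem_toList, Finset.mem_filter] at hσ; exact hσ.2
  have hget : ∀ j < S.length, S.getD j [] ∈ S := fun j hj => by
    rw [List.getD_eq_getElem _ _ hj]; exact List.getElem_mem hj
  have hsum : ∑ σ ∈ s.filter (fun σ => 0 < w σ), w σ =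
      ∑ j ∈ Finset.range S.length, w (S.getD j []) := by
    rw [← Finset.sum_map_toList, ← hS, list_sum_map_eq S []]
  rw [hsum] at hs'
  obtain ⟨t, ht, hqt⟩ := exists_rat_lt_sum S.length hs'
  have hr : ∀ σ, ∃ r : ℚ, 0 < w σ → 0 < r ∧ φ (zipList (initialSegment h k) σ, r) = true ∧
      Φ k σ = r := by
    intro σ
    by_cases hσ : 0 < w σ
    · rcases acceptedSup_eq_zero_or φ (zipList (initialSegment h k) σ) with e | ⟨r, h1, h2, e⟩
      · rw [hw] at hσ; simp [Φ, e] at hσ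
      · exact ⟨r, fun _ => ⟨h1, h2, e⟩⟩
    · exact ⟨0, fun h => absurd h hσ⟩
  choose r hr using hr
  refine ⟨(List.range S.length).map fun j => (S.getD j [], r (S.getD j []), t j), ?_, ?_, ?_⟩
  · intro j hj
    rw [List.length_map, List.length_range] at hj
    rw [getD_map_range _ _ hj]
    have h1 := hSpos _ (hget j hj)
    obtain ⟨h2, h3, h4⟩ := hr _ h1
    refine ⟨⟨hwk _ h1, h2⟩, h3, ?_⟩
    rw [Rat.cast_div, div_lt_iff₀ (by exact_mod_cast h2), ← h4, ← hwξ _ (hwk _ h1)]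
    exact ht j hj
  · intro j hj i hij
    rw [List.length_map, List.length_range] at hj
    rw [getD_map_range _ _ hj, getD_map_range _ _ (hij.trans hj)]
    simp only
    rw [List.getD_eq_getElem _ _ hj, List.getD_eq_getElem _ _ (hij.trans hj)]
    intro e
    exact hij.ne ((Finset.nodup_toList _).getElem_inj_iff.1 e)
  · rw [List.length_map, List.length_range]
    rw [Finset.sum_congr rfl fun j hj => by rw [getD_map_range _ _ (Finset.mem_range.1 hj)]]
    exact_mod_cast hqt

variable {I α : Type*} [Primcodable α] {o : I → ℕ → ℕ}

/-- Integrals of lower semicomputable functions over Baire space are lower semicomputable. -/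
theorem LowerIn.integral {ξ : I → Measure (ℕ → ℕ)} [∀ i, IsProbabilityMeasure (ξ i)]
    (hξ : LowerIn o fun i σ => (ξ i).real (cylinderSet σ)) {f : I × (ℕ → ℕ) → α → ℝ}
    (hf : LowerIn (fun p : I × (ℕ → ℕ) => zipSeq (o p.1) p.2) f) (h0 : ∀ p a, 0 ≤ f p a)
    (hint : ∀ i a, Integrable (fun κ => f (i, κ) a) (ξ i)) :
    LowerIn o fun i a => ∫ κ, f (i, κ) a ∂ξ i := by
  obtain ⟨φ, hφ, hmono, hiff⟩ := hf
  have hL : Computable fun p : ((α × ℚ) × ℕ × List (List ℕ × ℚ × ℚ)) × ℕ =>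
      p.1.2.2.getD p.2 ([], 0, 0) := by fun_prop
  have c1 : SemidecidableIn o fun _ (p : ((α × ℚ) × ℕ × List (List ℕ × ℚ × ℚ)) × ℕ) =>
      (p.1.2.2.getD p.2 ([], 0, 0)).1.length = p.1.2.1 ∧ 0 < (p.1.2.2.getD p.2 ([], 0, 0)).2.1 :=
    (SemidecidableIn.of_decide (computable_decide_eq (by fun_prop) (by fun_prop))).and
      (.of_decide (computable_rat_decide_lt (by fun_prop) (by fun_prop)))
  have c2 : SemidecidableIn o fun i (p : ((α × ℚ) × ℕ × List (List ℕ × ℚ × ℚ)) × ℕ) =>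
      φ (zipList (initialSegment (o i) p.1.2.1) (p.1.2.2.getD p.2 ([], 0, 0)).1,
        p.1.1.1, (p.1.2.2.getD p.2 ([], 0, 0)).2.1) = true :=
    .segment (b := fun q : List ℕ × ((α × ℚ) × ℕ × List (List ℕ × ℚ × ℚ)) × ℕ =>
      φ (zipList q.1 (q.2.1.2.2.getD q.2.2 ([], 0, 0)).1,
        q.2.1.1.1, (q.2.1.2.2.getD q.2.2 ([], 0, 0)).2.1))
      (n := fun p => p.1.2.1) (by fun_prop) (by fun_prop)
  have c3 : SemidecidableIn o fun i (p : ((α × ℚ) × ℕ × List (List ℕ × ℚ × ℚ)) × ℕ) =>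
      (((p.1.2.2.getD p.2 ([], 0, 0)).2.2 / (p.1.2.2.getD p.2 ([], 0, 0)).2.1 : ℚ) : ℝ) <
        (ξ i).real (cylinderSet (p.1.2.2.getD p.2 ([], 0, 0)).1) :=
    hξ.lt (q := fun p : ((α × ℚ) × ℕ × List (List ℕ × ℚ × ℚ)) × ℕ =>
      (p.1.2.2.getD p.2 ([], 0, 0)).2.2 / (p.1.2.2.getD p.2 ([], 0, 0)).2.1)
      (u := fun p => (p.1.2.2.getD p.2 ([], 0, 0)).1) (by fun_prop) (by fun_prop)
  have c4 : SemidecidableIn o fun _ (p : (((α × ℚ) × ℕ × List (List ℕ × ℚ × ℚ)) × ℕ) × ℕ) =>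
      (p.1.1.2.2.getD p.2 ([], 0, 0)).1 ≠ (p.1.1.2.2.getD p.1.2 ([], 0, 0)).1 := by
    have : Computable fun p : (((α × ℚ) × ℕ × List (List ℕ × ℚ × ℚ)) × ℕ) × ℕ =>
        !decide ((p.1.1.2.2.getD p.2 ([], 0, 0)).1 = (p.1.1.2.2.getD p.1.2 ([], 0, 0)).1) :=
      computable_not (computable_decide_eq (by fun_prop) (by fun_prop))
    exact (SemidecidableIn.of_computable this).congr fun i p => by simp
  have c5 : Computable fun p : (α × ℚ) × ℕ × List (List ℕ × ℚ × ℚ) =>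
      ∑ j ∈ Finset.range p.2.2.length, (p.2.2.getD j ([], 0, 0)).2.2 :=
    computable_rat_sum_range
      (f := fun p : ((α × ℚ) × ℕ × List (List ℕ × ℚ × ℚ)) × ℕ =>
        (p.1.2.2.getD p.2 ([], 0, 0)).2.2) (by fun_prop) (by fun_prop)
  have c6 : SemidecidableIn o fun i (p : (α × ℚ) × ℕ × List (List ℕ × ℚ × ℚ)) =>
      IntegralCertificate (ξ i)
        (fun r => φ (zipList (initialSegment (o i) p.2.1) r.1, p.1.1, r.2)) p.2.1 p.1.2 p.2.2 :=
    (SemidecidableIn.ball (R := fun i (p : (α × ℚ) × ℕ × List (List ℕ × ℚ × ℚ)) j =>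
        ((p.2.2.getD j ([], 0, 0)).1.length = p.2.1 ∧ 0 < (p.2.2.getD j ([], 0, 0)).2.1) ∧
        φ (zipList (initialSegment (o i) p.2.1) (p.2.2.getD j ([], 0, 0)).1,
          p.1.1, (p.2.2.getD j ([], 0, 0)).2.1) = true ∧
        (((p.2.2.getD j ([], 0, 0)).2.2 / (p.2.2.getD j ([], 0, 0)).2.1 : ℚ) : ℝ) <
          (ξ i).real (cylinderSet (p.2.2.getD j ([], 0, 0)).1))
      (c1.and (c2.and c3)) (n := fun p => p.2.2.length) (by fun_prop)).and
    ((SemidecidableIn.ball (R := fun _ (p : (α × ℚ) × ℕ × List (List ℕ × ℚ × ℚ)) j =>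
        ∀ i < j, (p.2.2.getD i ([], 0, 0)).1 ≠ (p.2.2.getD j ([], 0, 0)).1)
      (SemidecidableIn.ball (R := fun _ (p : ((α × ℚ) × ℕ × List (List ℕ × ℚ × ℚ)) × ℕ) i =>
        (p.1.2.2.getD i ([], 0, 0)).1 ≠ (p.1.2.2.getD p.2 ([], 0, 0)).1) c4
        (n := fun p => p.2) (by fun_prop)) (n := fun p => p.2.2.length) (by fun_prop)).and
    (.of_decide (computable_rat_decide_lt (by fun_prop) c5)))
  refine c6.proj.congr fun i p => ⟨fun hq => ?_, ?_⟩
  · obtain ⟨k, L, hL⟩ := exists_integralCertificate (f := fun κ => f (i, κ) p.1)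
      (φ := fun r => φ (r.1, p.1, r.2)) (h := o i)
      (fun κ q k l hkl => hmono (i, κ) (p.1, q) k l hkl) (fun κ q => hiff (i, κ) (p.1, q))
      (fun κ => h0 _ _) (hint i p.1) hq
    exact ⟨(k, L), hL⟩
  · rintro ⟨⟨k, L⟩, hL⟩
    refine hL.lt_integral (f := fun κ => f (i, κ) p.1) (fun κ q hq => ?_) (fun κ => h0 _ _)
      (hint i p.1)
    refine (hiff (i, κ) (p.1, q)).2 ⟨k, ?_⟩
    rw [initialSegment_zipSeq]; exact hq

end IntegralBaire

/-! ### Integrals of computable functions over Baire space -/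

section Arithmetic

variable {I α β : Type*} [Primcodable α] [Primcodable β] {o : I → ℕ → ℕ} {f g : I → α → ℝ}

theorem LowerIn.ite {p : α → Prop} [DecidablePred p] (hp : Computable fun a => decide (p a))
    (hf : LowerIn o f) (hg : LowerIn o g) : LowerIn o fun i a => if p a then f i a else g i a := by
  have h1 : SemidecidableIn o fun (_ : I) (q : α × ℚ) => p q.1 :=
    .of_decide (hp.comp (g := fun q : α × ℚ => q.1) (by fun_prop))
  have h2 : SemidecidableIn o fun (_ : I) (q : α × ℚ) => ¬p q.1 :=
    (SemidecidableIn.of_computable (b := fun q : α × ℚ => !decide (p q.1))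
      (computable_not (hp.comp (g := fun q : α × ℚ => q.1) (by fun_prop)))).congr
      fun i q => by simp
  refine ((h1.and hf).or (h2.and hg)).congr fun i q => ?_
  by_cases h : p q.1 <;> simp [h]

theorem LowerIn.mul (hf : LowerIn o f) (hg : LowerIn o g) (hf0 : ∀ i a, 0 ≤ f i a)
    (hg0 : ∀ i a, 0 ≤ g i a) : LowerIn o fun i a => f i a * g i a := by
  have h1 : LowerIn o fun i (p : α × ℕ) => if p.2 = 0 then f i p.1 else g i p.1 :=
    .ite (p := fun p : α × ℕ => p.2 = 0) (computable_decide_eq (by fun_prop) (by fun_prop))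
      (hf.comp (u := fun p : α × ℕ => p.1) (by fun_prop))
      (hg.comp (u := fun p : α × ℕ => p.1) (by fun_prop))
  refine (LowerIn.prod_range (f := fun i a j => if j = 0 then f i a else g i a) h1
    (fun i a j => ?_) (n := fun _ => 2) (by fun_prop)).congr fun i a => ?_
  · split_ifs
    exacts [hf0 i a, hg0 i a]
  · simp [Finset.prod_range_succ]

namespace ComputableRealIn

theorem one_div (hf : ComputableRealIn o f) (h0 : ∀ i a, 0 < f i a) :
    ComputableRealIn o fun i a => 1 / f i a := by
  have h1 : SemidecidableIn o fun (_ : I) (q : α × ℚ) => q.2 ≤ 0 :=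
    .of_decide (computable_rat_decide_le (by fun_prop) (by fun_prop))
  have h2 : SemidecidableIn o fun (_ : I) (q : α × ℚ) => 0 < q.2 :=
    .of_decide (computable_rat_decide_lt (by fun_prop) (by fun_prop))
  have h3 : SemidecidableIn o fun (_ : I) (q : α × ℚ) => q.2 < 0 :=
    .of_decide (computable_rat_decide_lt (by fun_prop) (by fun_prop))
  refine ⟨(h1.or (h2.and (hf.lt (q := fun p : α × ℚ => 1 / p.2) (u := fun p => p.1) (by fun_prop)
      (by fun_prop)))).congr fun i p => ?_,
    (h3.and (hf.1.lt (q := fun p : α × ℚ => 1 / -p.2) (u := fun p => p.1) (by fun_prop)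
      (by fun_prop))).congr fun i p => ?_⟩
  · have hp := h0 i p.1
    push_cast
    constructor
    · intro h
      rcases le_or_gt p.2 0 with h4 | h4
      · exact Or.inl h4
      · exact Or.inr ⟨h4, (lt_one_div (by exact_mod_cast h4) hp).1 h⟩
    · rintro (h4 | ⟨h4, h5⟩)
      · exact lt_of_le_of_lt (b := (0 : ℝ)) (by exact_mod_cast h4) (by positivity)
      · exact (lt_one_div (by exact_mod_cast h4) hp).2 h5
  · have hp := h0 i p.1
    push_cast
    constructor
    · intro h
      have h4 : (p.2 : ℝ) < 0 := h.trans (by have := one_div_pos.2 hp; linarith)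
      exact ⟨by exact_mod_cast h4, (one_div_lt (by linarith) hp).2 (by linarith)⟩
    · rintro ⟨h4, h5⟩
      have h4 : (p.2 : ℝ) < 0 := by exact_mod_cast h4
      have := (one_div_lt (by linarith) hp).1 h5
      linarith

/-- The upper cut of `f * g` is found from the lower cut of the nonnegative product `(M - f) * g`,
because `-f * g = (M - f) * g - M * g`. -/
theorem mul_of_le (hf : ComputableRealIn o f) (hg : ComputableRealIn o g)
    (hf0 : ∀ i a, 0 ≤ f i a) (hg0 : ∀ i a, 0 ≤ g i a) {M : α → ℚ} (hM : Computable M)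
    (hM0 : ∀ a, 0 < M a) (hfM : ∀ i a, f i a ≤ M a) :
    ComputableRealIn o fun i a => f i a * g i a := by
  refine ⟨hf.1.mul hg.1 hf0 hg0, ((LowerIn.mul (f := fun i a => M a - f i a)
    ((ComputableRealIn.of_rat hM).sub hf).1 hg.1
    (fun i a => sub_nonneg.2 (hfM i a)) hg0).add (hg.rat_mul hM hM0).2).congr fun i a => ?_⟩
  ring

/-- Integrals of bounded computable functions over Baire space. -/
theorem integral {ξ : I → Measure (ℕ → ℕ)} [∀ i, IsProbabilityMeasure (ξ i)]
    (hξ : LowerIn o fun i σ => (ξ i).real (cylinderSet σ)) {f : I × (ℕ → ℕ) → α → ℝ}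
    (hf : ComputableRealIn (fun p : I × (ℕ → ℕ) => zipSeq (o p.1) p.2) f) (h0 : ∀ p a, 0 ≤ f p a)
    {M : α → ℚ} (hM : Computable M) (hfM : ∀ p a, f p a ≤ M a)
    (hm : ∀ i a, Measurable fun κ => f (i, κ) a) :
    ComputableRealIn o fun i a => ∫ κ, f (i, κ) a ∂ξ i := by
  have hint : ∀ i a, Integrable (fun κ => f (i, κ) a) (ξ i) := fun i a =>
    (integrable_const (M a : ℝ)).mono' (hm i a).aestronglyMeasurable (ae_of_all _ fun κ => by
      rw [Real.norm_of_nonneg (h0 _ _)]; exact hfM _ _)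
  -- Lower bounds on cylinders are enough for both cuts: since the total mass is `1`, the integral
  -- of `M - f` is `M` minus that of `f`, and `M - f` is nonnegative as well.
  refine ⟨.integral hξ hf.1 h0 hint, ((LowerIn.integral hξ (f := fun p a => M a - f p a)
    ((ComputableRealIn.of_rat hM).sub hf).1 (fun p a => sub_nonneg.2 (hfM p a))
    fun i a => (integrable_const _).sub (hint i a)).add
      (ComputableRealIn.of_rat hM).2).congr fun i a => ?_⟩
  rw [integral_sub (integrable_const _) (hint i a)]
  simp
  ring

end ComputableRealIn

/-- Substituting a computable point in a family of lower semicomputable functions. -/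
theorem LowerIn.subst_named {Z : Type*} [PseudoMetricSpace Z] [BasicPoints Z] {w : Z → β → ℝ}
    (hw : LowerIn (Named.name (K := (Set.univ : Set Z))) fun p b => w p.pt b) {z : I → α → Z}
    (hz : PointIn o z) : LowerIn o fun i (p : α × β) => w (z i p.1) p.2 := by
  obtain ⟨G, hG, hG'⟩ := hz
  exact LowerIn.subst hw (φ := fun i a =>
    (⟨(G i a, z i a), hG' i a, Set.mem_univ _⟩ : Named (Set.univ : Set Z))) hG

theorem zipSeq_fst_graph : SemidecidableIn (fun p : I × (ℕ → ℕ) => zipSeq (o p.1) p.2)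
    fun p (q : α × ℕ × ℕ) => o p.1 q.2.1 = q.2.2 := by
  refine (SemidecidableIn.subst_value (β := ℕ) (R := fun (_ : I × (ℕ → ℕ))
    (q : (α × ℕ × ℕ) × ℕ) => q.2.unpair.1 = q.1.2.2)
    (.of_decide (computable_decide_eq (by fun_prop) (by fun_prop)))
    (g := fun p q => zipSeq (o p.1) p.2 q.2.1) (.apply_eq (n := fun q : (α × ℕ × ℕ) × ℕ => q.1.2.1)
      (v := fun q => q.2) (by fun_prop) (by fun_prop))).congr fun p q => ?_
  simp [zipSeq]

theorem zipSeq_snd_graph : SemidecidableIn (fun p : I × (ℕ → ℕ) => zipSeq (o p.1) p.2)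
    fun p (q : α × ℕ × ℕ) => p.2 q.2.1 = q.2.2 := by
  refine (SemidecidableIn.subst_value (β := ℕ) (R := fun (_ : I × (ℕ → ℕ))
    (q : (α × ℕ × ℕ) × ℕ) => q.2.unpair.2 = q.1.2.2)
    (.of_decide (computable_decide_eq (by fun_prop) (by fun_prop)))
    (g := fun p q => zipSeq (o p.1) p.2 q.2.1) (.apply_eq (n := fun q : (α × ℕ × ℕ) × ℕ => q.1.2.1)
      (v := fun q => q.2) (by fun_prop) (by fun_prop))).congr fun p q => ?_
  simp [zipSeq]

theorem PointIn.zip_fst {Y : Type*} [PseudoMetricSpace Y] [BasicPoints Y] {y : I → α → Y}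
    (hy : PointIn o y) :
    PointIn (fun p : I × (ℕ → ℕ) => zipSeq (o p.1) p.2) fun p a => y p.1 a :=
  (hy.subst (φ := fun (p : I × (ℕ → ℕ)) (_ : Unit) => p.1) zipSeq_fst_graph).comp
    (u := fun a => ((), a)) (by fun_prop)

theorem pointIn_zip_snd :
    PointIn (fun p : I × (ℕ → ℕ) => zipSeq (o p.1) p.2) fun p (_ : α) => p.2 :=
  .of_baire zipSeq_snd_graph

end Arithmetic

/-! ### Continuity of computable functions -/

section Continuity

variable {Y Z : Type*} [PseudoMetricSpace Y] [BasicPoints Y] [PseudoMetricSpace Z] [BasicPoints Z]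

theorem exists_dist_basic_le (hY : DenseRange (basic : ℕ → Y)) (y : Y) :
    ∃ h : ℕ → ℕ, ∀ n, dist (basic (h n) : Y) y ≤ (1 / 2 : ℝ) ^ (n + 2) := by
  have h : ∀ n : ℕ, ∃ m, dist (basic m : Y) y ≤ (1 / 2 : ℝ) ^ (n + 2) := fun n => by
    obtain ⟨m, hm⟩ := hY.exists_dist_lt y (by positivity : (0 : ℝ) < (1 / 2) ^ (n + 2))
    exact ⟨m, by rw [dist_comm]; exact hm.le⟩
  exact ⟨fun n => (h n).choose, fun n => (h n).choose_spec⟩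

theorem exists_isCauchyName (hY : DenseRange (basic : ℕ → Y)) (y : Y) :
    ∃ h : ℕ → ℕ, IsCauchyName h y := by
  obtain ⟨h, hh⟩ := exists_dist_basic_le hY y
  exact ⟨h, isCauchyName_of_dist_le fun n =>
    (hh n).trans (pow_le_pow_of_le_one (by norm_num) (by norm_num) (by omega))⟩

/-- Acceptance uses finitely many terms of a name. If the name has error at most `2⁻⁽ⁿ⁺²⁾`, half of
the tolerance of `isCauchyName_of_dist_le`, its first `k` terms also begin a name of each point
within `2⁻⁽ᵏ⁺²⁾`. -/
theorem isOpen_of_semidecidableIn (hY : DenseRange (basic : ℕ → Y)) {R : Y → Prop}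
    (hR : SemidecidableIn (Named.name (K := (Set.univ : Set Y))) fun p (_ : Unit) => R p.pt) :
    IsOpen {y | R y} := by
  obtain ⟨f, _, _, hf⟩ := hR
  rw [Metric.isOpen_iff]
  intro y hy
  obtain ⟨h, hh⟩ := exists_dist_basic_le hY y
  have hn : IsCauchyName h y := isCauchyName_of_dist_le fun n =>
    (hh n).trans (pow_le_pow_of_le_one (by norm_num) (by norm_num) (by omega))
  obtain ⟨k, hk⟩ := (hf ⟨(h, y), hn, Set.mem_univ _⟩ ()).1 hy
  refine ⟨(1 / 2) ^ (k + 2), by positivity, fun z hz => ?_⟩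
  obtain ⟨g, hg⟩ := exists_dist_basic_le hY z
  have hn' : IsCauchyName (fun n => if n < k then h n else g n) z := by
    refine isCauchyName_of_dist_le fun n => ?_
    split_ifs with hnk
    · have h1 : (1 / 2 : ℝ) ^ (k + 2) ≤ (1 / 2) ^ (n + 2) :=
        pow_le_pow_of_le_one (by norm_num) (by norm_num) (by omega)
      have h2 := dist_triangle (basic (h n) : Y) y z
      rw [dist_comm y z] at h2
      have h3 : (1 / 2 : ℝ) ^ (n + 2) + (1 / 2) ^ (n + 2) = (1 / 2) ^ (n + 1) := by ring
      linarith [hh n, Metric.mem_ball.1 hz]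
    · exact (hg n).trans (pow_le_pow_of_le_one (by norm_num) (by norm_num) (by omega))
  refine (hf ⟨(_, z), hn', Set.mem_univ _⟩ ()).2 ⟨k, ?_⟩
  convert hk using 3
  refine List.map_congr_left fun n hn => ?_
  exact if_pos (List.mem_range.1 hn)

/-- Supplies the measurability of tests and of their integrals that Tonelli's theorem and the almost
everywhere statements require. -/
theorem ComputableMap.continuous (hY : DenseRange (basic : ℕ → Y)) {f : Y → ℝ}
    (hf : ComputableMap f) : Continuous f := by
  have h := PointIn.real_iff.1
    (hf.pointIn (pointIn_named (α := Unit) (Set.univ : Set Y)))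
  have h1 : ∀ q : ℚ, IsOpen {y | (q : ℝ) < f y} := fun q => isOpen_of_semidecidableIn hY
    (h.1.lt (q := fun _ : Unit => q) (u := fun a => a) (by fun_prop) (by fun_prop))
  have h2 : ∀ q : ℚ, IsOpen {y | f y < (q : ℝ)} := fun q => isOpen_of_semidecidableIn hY
    (h.lt (q := fun _ : Unit => q) (u := fun a => a) (by fun_prop) (by fun_prop))
  refine continuous_iff_continuousAt.2 fun y => tendsto_order.2 ⟨fun a ha => ?_, fun a ha => ?_⟩
  · obtain ⟨q, hq, hq'⟩ := exists_rat_btwn ha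
    filter_upwards [(h1 q).mem_nhds hq'] with z hz using hq.trans hz
  · obtain ⟨q, hq, hq'⟩ := exists_rat_btwn ha
    filter_upwards [(h2 q).mem_nhds hq] with z hz using lt_trans hz hq'

theorem ComputableMap.nat_prod_mk {g : ℕ × Y → Z} (hg : ComputableMap g) (n : ℕ) :
    ComputableMap fun y => g (n, y) := by
  refine computableMap_of_pointIn (hg.pointIn (.prodMk (.of_nat (n := fun _ _ => n) ?_)
    (pointIn_named _)))
  exact .of_decide (computable_decide_eq (by fun_prop) (by fun_prop))

theorem denseRange_basic_prod (hY : DenseRange (basic : ℕ → Y)) (hZ : DenseRange (basic : ℕ → Z)) :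
    DenseRange (basic : ℕ → Y × Z) := by
  have h1 : DenseRange fun p : ℕ × ℕ => ((basic p.1 : Y), (basic p.2 : Z)) := hY.prodMap hZ
  have h2 : Function.Surjective Nat.unpair := fun p => ⟨Nat.pair p.1 p.2, by simp⟩
  exact h1.comp h2.denseRange (by fun_prop)

theorem denseRange_basic_baire : DenseRange (basic : ℕ → ℕ → ℕ) := by
  intro κ
  rw [Metric.mem_closure_range_iff]
  intro ε hε
  obtain ⟨k, hk⟩ := exists_pow_lt_of_lt_one hε (by norm_num : (1 / 2 : ℝ) < 1)
  refine ⟨Encodable.encode (initialSegment κ k), lt_of_le_of_lt ?_ hk⟩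
  exact baire_dist_le_iff.2 fun j hj => by
    rw [basic_encode_apply, getD_initialSegment κ hj]

end Continuity

instance instSecondCountableTopologyBaire : SecondCountableTopology (ℕ → ℕ) :=
  inferInstanceAs (@SecondCountableTopology (ℕ → ℕ) Pi.topologicalSpace)

/-! ### Averages of tests over random oracles -/

section TruncSup

/-- The maximum of the first `n + 1` members of a sequence, confined to the interval `[0, n]`. -/
noncomputable def truncSup (g : ℕ → ℝ) (n : ℕ) : ℝ :=
  min n (max 0 ((Finset.range (n + 1)).sup' Finset.nonempty_range_add_one g))

theorem truncSup_nonneg (g : ℕ → ℝ) (n : ℕ) : 0 ≤ truncSup g n :=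
  le_min (Nat.cast_nonneg _) (le_max_left _ _)

theorem truncSup_le (g : ℕ → ℝ) (n : ℕ) : truncSup g n ≤ n := min_le_left _ _

theorem truncSup_mono (g : ℕ → ℝ) : Monotone (truncSup g) := fun m n h =>
  min_le_min (by exact_mod_cast h) (max_le_max le_rfl
    (Finset.sup'_mono g (Finset.range_mono (by omega)) Finset.nonempty_range_add_one))

/-- Replaces an arbitrary computable sequence with supremum `t` by an increasing one of nonnegative
bounded functions. Integration needs the bounds, and as the cap `n` grows the supremum is not
affected. -/
theorem iSup_ofReal_truncSup {g : ℕ → ℝ} {t : ℝ≥0∞} (h : (t : EReal) = ⨆ n, (g n : EReal)) :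
    ⨆ n, ENNReal.ofReal (truncSup g n) = t := by
  refine le_antisymm (iSup_le fun n => ?_) (le_of_forall_lt fun c hc => ?_)
  · rw [← EReal.coe_ennreal_le_coe_ennreal_iff,
      EReal.coe_ennreal_ofReal, max_eq_left (truncSup_nonneg g n)]
    refine le_trans (EReal.coe_le_coe_iff.2 (min_le_right _ _)) ?_
    rcases le_total ((Finset.range (n + 1)).sup' Finset.nonempty_range_add_one g) 0 with h1 | h1
    · rw [max_eq_left h1]; exact EReal.coe_ennreal_nonneg t
    · rw [max_eq_right h1]
      obtain ⟨m, _, hm⟩ := Finset.exists_mem_eq_sup' (Finset.nonempty_range_add_one (n := n)) g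
      rw [hm, h]
      exact le_iSup (fun n => (g n : EReal)) m
  · obtain ⟨d, hcd, hdt⟩ := ENNReal.lt_iff_exists_nnreal_btwn.1 hc
    have h1 : ((d : ℝ≥0∞) : EReal) < ⨆ n, (g n : EReal) := by
      rw [← h]; exact EReal.coe_ennreal_lt_coe_ennreal_iff.2 hdt
    obtain ⟨m, hm⟩ := lt_iSup_iff.1 h1
    have hm' : (d : ℝ) < g m := by
      rw [EReal.coe_nnreal_eq_coe_real] at hm; exact EReal.coe_lt_coe_iff.1 hm
    obtain ⟨N, hN⟩ := exists_nat_gt (d : ℝ)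
    refine hcd.trans_le (le_trans ?_ (le_iSup _ (max m N)))
    rw [← ENNReal.ofReal_coe_nnreal]
    refine ENNReal.ofReal_le_ofReal (le_min (hN.le.trans (by exact_mod_cast le_max_right m N))
      (le_max_of_le_right (hm'.le.trans (Finset.le_sup' g (Finset.mem_range.2 ?_)))))
    have := le_max_left m N
    omega

variable {I α : Type*} [Primcodable α] {o : I → ℕ → ℕ}

theorem ComputableRealIn.truncSup {g : I → α → ℕ → ℝ}
    (hg : ComputableRealIn o fun i (p : α × ℕ) => g i p.1 p.2) {n : α → ℕ} (hn : Computable n) :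
    ComputableRealIn o fun i a => truncSup (g i a) (n a) := by
  have h1 : ComputableRealIn o fun i a =>
      (Finset.range (n a + 1)).sup' Finset.nonempty_range_add_one (g i a) := by
    constructor
    · have h2 : SemidecidableIn o fun i (p : (α × ℚ) × ℕ) => (p.1.2 : ℝ) < g i p.1.1 p.2 :=
        hg.1.lt (q := fun p : (α × ℚ) × ℕ => p.1.2) (u := fun p => (p.1.1, p.2)) (by fun_prop)
          (by fun_prop)
      refine (SemidecidableIn.ex_lt (R := fun i (p : α × ℚ) j => (p.2 : ℝ) < g i p.1 j) h2
        (n := fun p => n p.1 + 1) (by fun_prop)).congr fun i p => ?_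
      simp [Finset.lt_sup'_iff]
    · have h2 : SemidecidableIn o fun i (p : (α × ℚ) × ℕ) => (p.1.2 : ℝ) < -g i p.1.1 p.2 :=
        hg.2.lt (q := fun p : (α × ℚ) × ℕ => p.1.2) (u := fun p => (p.1.1, p.2)) (by fun_prop)
          (by fun_prop)
      refine (SemidecidableIn.ball (R := fun i (p : α × ℚ) j => (p.2 : ℝ) < -g i p.1 j) h2
        (n := fun p => n p.1 + 1) (by fun_prop)).congr fun i p => ?_
      rw [lt_neg, Finset.sup'_lt_iff]
      simp [lt_neg]
  exact ((ComputableRealIn.of_rat (f := fun a => (n a : ℚ)) (by fun_prop)).congr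
    (g := fun _ a => (n a : ℝ)) fun _ _ => by simp).min
    (((ComputableRealIn.of_rat (f := fun _ => (0 : ℚ)) (by fun_prop)).congr
      (g := fun _ _ => (0 : ℝ)) fun _ _ => by simp).max h1)

theorem continuous_truncSup {Y : Type*} [TopologicalSpace Y] {g : Y → ℕ → ℝ}
    (hg : ∀ m, Continuous fun y => g y m) (n : ℕ) : Continuous fun y => truncSup (g y) n :=
  continuous_const.min (continuous_const.max
    (Continuous.finset_sup'_apply (f := fun m y => g y m) _ fun m _ => hg m))

end TruncSup

section Average

variable {A X : Type*} [PseudoMetricSpace A] [BasicPoints A]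
  [MetricSpace X] [BasicPoints X] [MeasurableSpace X] [BorelSpace X]

/-- The average of a normalized test over a family of distributions of the oracle. -/
noncomputable def averageTest (ξ : A × Measures X → Measure (ℕ → ℕ))
    (t : (ℕ → ℕ) × Measures X × X → ℝ≥0∞) (p : A × Measures X × X) : ℝ≥0∞ :=
  ∫⁻ κ, t (κ, p.2) * ENNReal.ofReal
    (1 / (1 + (∫⁻ x, t (κ, p.2.1, x) ∂p.2.1.toMeasure).toReal)) ∂ξ (p.1, p.2.1)

-- The key construction. The factor `U = 1 / (1 + F)` bounds the `ν`-integral of each normalized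
-- test by `1`, so averaging yields a finite integral, and a computable one because the integrand `1
-- - U` is bounded. Without this factor `F` need not even be integrable with respect to `ξ`.
set_option maxHeartbeats 400000 in
theorem IsUniformSchnorrTest.average (hX : DenseRange (basic : ℕ → X))
    {t : (ℕ → ℕ) × Measures X × X → ℝ≥0∞} (ht : IsUniformSchnorrTest t)
    {ξ : A × Measures X → Measure (ℕ → ℕ)} [∀ p, IsProbabilityMeasure (ξ p)]
    (hξ : LowerIn (Named.name (K := (Set.univ : Set (A × Measures X)))) fun p σ =>
      (ξ p.pt).real (cylinderSet σ)) :
    IsUniformSchnorrTest (averageTest ξ t) := by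
  obtain ⟨g, hg, hgt⟩ := ht.lowerSemicomputable
  have : SecondCountableTopology X := by
    have : TopologicalSpace.SeparableSpace X := ⟨Set.range basic, Set.countable_range _, hX⟩
    exact UniformSpace.secondCountable_of_separable X
  have hM := denseRange_basic_measures hX
  set F : (ℕ → ℕ) × Measures X → ℝ := fun q => (∫⁻ x, t (q.1, q.2, x) ∂q.2.toMeasure).toReal
    with hF
  set U : (ℕ → ℕ) × Measures X → ℝ := fun q => 1 / (1 + F q) with hU
  have hF0 : ∀ q, 0 ≤ F q := fun q => ENNReal.toReal_nonneg
  have hU0 : ∀ q, 0 ≤ U q := fun q => by have := hF0 q; positivity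
  have hU1 : ∀ q, U q ≤ 1 := fun q => by
    have := hF0 q
    exact (div_le_one (by linarith)).2 (by linarith)
  have hFc : Continuous F :=
    ht.computable_integral.continuous (denseRange_basic_prod denseRange_basic_baire hM)
  have hUc : Continuous U := continuous_const.div (continuous_const.add hFc) fun q => by
    have := hF0 q; positivity
  have hgc : ∀ n, Continuous fun q => g (n, q) := fun n => (hg.nat_prod_mk n).continuous
    (denseRange_basic_prod denseRange_basic_baire (denseRange_basic_prod hM hX))
  have hUm : ∀ ν, Measurable fun κ => U (κ, ν) := fun ν =>
    (hUc.comp (by fun_prop : Continuous fun κ : ℕ → ℕ => (κ, ν))).measurable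
  have hTc : ∀ n, Continuous fun q => truncSup (fun m => g (m, q)) n :=
    fun n => continuous_truncSup hgc n
  have htm : ∀ ν, Measurable fun q : (ℕ → ℕ) × X => t (q.1, ν, q.2) := fun ν => by
    simp only [← iSup_ofReal_truncSup (hgt _)]
    exact Measurable.iSup fun n => ENNReal.measurable_ofReal.comp ((hTc n).comp
      (by fun_prop : Continuous fun q : (ℕ → ℕ) × X => (q.1, ν, q.2))).measurable
  have hTm : ∀ n r, Measurable fun κ => truncSup (fun m => g (m, κ, r)) n := fun n r =>
    ((hTc n).comp (by fun_prop : Continuous fun κ : ℕ → ℕ => (κ, r))).measurable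
  have hVm : ∀ ν, Measurable fun κ => 1 - U (κ, ν) := fun ν => measurable_const.sub (hUm ν)
  have hTU : ∀ n (r : Measures X × X),
      Measurable fun κ => truncSup (fun m => g (m, κ, r)) n * U (κ, r.1) :=
    fun n r => (hTm n r).mul (hUm r.1)
  -- After exchanging the integrals, the inner one is `F * U = 1 - U`.
  have hint : ∀ (a : A) ν, ∫⁻ x, averageTest ξ t (a, ν, x) ∂ν.toMeasure =
      ENNReal.ofReal (∫ κ, (1 - U (κ, ν)) ∂ξ (a, ν)) := by
    intro a ν
    simp only [averageTest]
    rw [lintegral_lintegral_swap]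
    · have : ∀ κ, ∫⁻ x, t (κ, ν, x) * ENNReal.ofReal (U (κ, ν)) ∂ν.toMeasure =
          ENNReal.ofReal (1 - U (κ, ν)) := by
        intro κ
        have h1 : Measurable fun x => t (κ, ν, x) :=
          (htm ν).comp (by fun_prop : Measurable fun x : X => (κ, x))
        rw [lintegral_mul_const _ h1, ← ENNReal.ofReal_toReal (ht.lintegral_lt_top κ ν).ne,
          ← ENNReal.ofReal_mul ENNReal.toReal_nonneg]
        congr 1
        have h2 : 1 + F (κ, ν) ≠ 0 := by have := hF0 (κ, ν); positivity
        change F (κ, ν) * (1 / (1 + F (κ, ν))) = 1 - 1 / (1 + F (κ, ν))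
        field_simp
        ring
      refine (lintegral_congr this).trans ?_
      rw [ofReal_integral_eq_lintegral_ofReal]
      · exact (integrable_const (1 : ℝ)).mono' (measurable_const.sub (hUm ν)).aestronglyMeasurable
          (ae_of_all _ fun κ => by
            rw [Real.norm_of_nonneg (sub_nonneg.2 (hU1 _))]; linarith [hU0 (κ, ν)])
      · exact ae_of_all _ fun κ => sub_nonneg.2 (hU1 _)
    · refine Measurable.aemeasurable ?_
      have h1 : Measurable fun q : X × (ℕ → ℕ) => t (q.2, ν, q.1) :=
        (htm ν).comp measurable_swap
      exact h1.mul (ENNReal.measurable_ofReal.comp ((hUm ν).comp measurable_snd))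
  constructor
  -- The average is the increasing limit of the averages of the truncations, which are integrals of
  -- bounded computable functions and hence computable reals.
  · refine ⟨fun q => ∫ κ, truncSup (fun m => g (m, κ, q.2.2)) q.1 * U (κ, q.2.2.1)
      ∂ξ (q.2.1, q.2.2.1), computableMap_nat_prod (PointIn.real_iff.2 ?_), fun p => ?_⟩
    · have hy := pointIn_named (α := Unit) (Set.univ : Set (A × Measures X × X))
      have hy' := pointIn_named (α := ℕ) (Set.univ : Set (A × Measures X × X))
      have hy2 := pointIn_named (α := ℕ × ℕ) (Set.univ : Set (A × Measures X × X))
      have h1 := (LowerIn.subst_named (w := fun q σ => (ξ q).real (cylinderSet σ)) hξ (hy.fst.prodMk hy.snd.fst)).comp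
        (u := fun σ : List ℕ => ((), σ)) (by fun_prop)
      have h2 : ComputableRealIn (fun p : Named (Set.univ : Set (A × Measures X × X)) × (ℕ → ℕ) =>
          zipSeq p.1.name p.2) fun p (_ : ℕ) => F (p.2, p.1.pt.2.1) :=
        PointIn.real_iff.1 (ht.computable_integral.pointIn
          (pointIn_zip_snd.prodMk (PointIn.zip_fst hy'.snd.fst)))
      have h3 : ComputableRealIn (fun p : Named (Set.univ : Set (A × Measures X × X)) × (ℕ → ℕ) =>
          zipSeq p.1.name p.2) fun p (_ : ℕ) => U (p.2, p.1.pt.2.1) :=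
        (((ComputableRealIn.of_rat (f := fun _ => (1 : ℚ)) (by fun_prop)).congr
          (g := fun _ _ => (1 : ℝ)) fun _ _ => by simp).add h2).one_div
          fun p _ => by have := hF0 (p.2, p.1.pt.2.1); positivity
      have h4 : ComputableRealIn (fun p : Named (Set.univ : Set (A × Measures X × X)) × (ℕ → ℕ) =>
          zipSeq p.1.name p.2) fun p (n : ℕ × ℕ) => g (n.2, p.2, p.1.pt.2) :=
        PointIn.real_iff.1 (hg.pointIn (.prodMk (.of_nat (n := fun _ (n : ℕ × ℕ) => n.2)
          (.of_decide (computable_decide_eq (by fun_prop) (by fun_prop))))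
          (pointIn_zip_snd.prodMk (PointIn.zip_fst hy2.snd))))
      have h5 : ComputableRealIn (fun p : Named (Set.univ : Set (A × Measures X × X)) × (ℕ → ℕ) =>
          zipSeq p.1.name p.2) fun p (n : ℕ) =>
            truncSup (fun m => g (m, p.2, p.1.pt.2)) n * U (p.2, p.1.pt.2.1) :=
        (ComputableRealIn.truncSup (g := fun p (_ : ℕ) m => g (m, p.2, p.1.pt.2)) h4
          (n := fun n => n) (by fun_prop)).mul_of_le h3 (fun _ _ => truncSup_nonneg _ _)
          (fun _ _ => hU0 _) (M := fun n => (n : ℚ) + 1) (by fun_prop) (fun n => by positivity)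
          fun _ n => (truncSup_le _ n).trans (by push_cast; linarith)
      exact ComputableRealIn.integral
        (o := Named.name (K := (Set.univ : Set (A × Measures X × X))))
        (ξ := fun p => ξ (p.pt.1, p.pt.2.1)) (f := fun p (n : ℕ) =>
          truncSup (fun m => g (m, p.2, p.1.pt.2)) n * U (p.2, p.1.pt.2.1)) h1 h5 (fun _ _ => mul_nonneg (truncSup_nonneg _ _) (hU0 _))
        (M := fun n => (n : ℚ)) (by fun_prop)
        (fun _ n => (mul_le_of_le_one_right (truncSup_nonneg _ _) (hU1 _)).trans
          (by push_cast; exact truncSup_le _ n)) fun i n => hTU n i.pt.2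
    · obtain ⟨a, ν, x⟩ := p
      simp only [averageTest]
      have h1 : ∀ n, Integrable (fun κ => truncSup (fun m => g (m, κ, ν, x)) n * U (κ, ν))
          (ξ (a, ν)) := fun n => (integrable_const (n : ℝ)).mono'
        (hTU n (ν, x)).aestronglyMeasurable (ae_of_all _ fun κ => by
          rw [Real.norm_of_nonneg (mul_nonneg (truncSup_nonneg _ _) (hU0 _))]
          exact (mul_le_of_le_one_right (truncSup_nonneg _ _) (hU1 _)).trans (truncSup_le _ n))
      have h2 : ∫⁻ κ, t (κ, ν, x) * ENNReal.ofReal (U (κ, ν)) ∂ξ (a, ν) =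
          ⨆ n, ENNReal.ofReal
            (∫ κ, truncSup (fun m => g (m, κ, ν, x)) n * U (κ, ν) ∂ξ (a, ν)) := by
        simp only [← iSup_ofReal_truncSup (hgt _), ENNReal.iSup_mul]
        rw [lintegral_iSup]
        · refine iSup_congr fun n => ?_
          rw [ofReal_integral_eq_lintegral_ofReal (h1 n)
            (ae_of_all _ fun κ => mul_nonneg (truncSup_nonneg _ _) (hU0 _))]
          refine lintegral_congr fun κ => ?_
          rw [ENNReal.ofReal_mul (truncSup_nonneg _ _)]
        · exact fun n => (ENNReal.measurable_ofReal.comp (hTm n (ν, x))).mul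
            (ENNReal.measurable_ofReal.comp (hUm ν))
        · intro m n hmn κ
          exact mul_le_mul_left (ENNReal.ofReal_le_ofReal (truncSup_mono _ hmn)) _
      change ((∫⁻ κ, t (κ, ν, x) * ENNReal.ofReal (U (κ, ν)) ∂ξ (a, ν) : ℝ≥0∞) : EReal) = _
      rw [h2]
      have h3 : ∀ n, 0 ≤ ∫ κ, truncSup (fun m => g (m, κ, ν, x)) n * U (κ, ν) ∂ξ (a, ν) :=
        fun n => integral_nonneg fun κ => mul_nonneg (truncSup_nonneg _ _) (hU0 _)
      rw [Monotone.map_ciSup_of_continuousAt continuous_coe_ennreal_ereal.continuousAt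
        EReal.coe_ennreal_strictMono.monotone (OrderTop.bddAbove _)]
      refine iSup_congr fun n => ?_
      rw [EReal.coe_ennreal_ofReal, max_eq_left (h3 n)]
  · intro a ν
    rw [hint]
    exact ENNReal.ofReal_lt_top
  · refine computableMap_of_pointIn (PointIn.real_iff.2 ?_)
    have hy := pointIn_named (α := Unit) (Set.univ : Set (A × Measures X))
    have h2 : ComputableRealIn (fun p : Named (Set.univ : Set (A × Measures X)) × (ℕ → ℕ) =>
        zipSeq p.1.name p.2) fun p (_ : Unit) => F (p.2, p.1.pt.2) :=
      PointIn.real_iff.1 (ht.computable_integral.pointIn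
        (pointIn_zip_snd.prodMk (PointIn.zip_fst hy.snd)))
    have h0 : ComputableRealIn (fun p : Named (Set.univ : Set (A × Measures X)) × (ℕ → ℕ) =>
        zipSeq p.1.name p.2) fun _ (_ : Unit) => (1 : ℝ) :=
      (ComputableRealIn.of_rat (f := fun _ => (1 : ℚ)) (by fun_prop)).congr fun _ _ => by simp
    have h3 : ComputableRealIn (fun p : Named (Set.univ : Set (A × Measures X)) × (ℕ → ℕ) =>
        zipSeq p.1.name p.2) fun p (_ : Unit) => 1 - U (p.2, p.1.pt.2) :=
      h0.sub ((h0.add h2).one_div fun p _ => by have := hF0 (p.2, p.1.pt.2); positivity)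
    have h4 := ComputableRealIn.integral (o := Named.name (K := (Set.univ : Set (A × Measures X))))
      (ξ := fun p => ξ p.pt) (f := fun p (_ : Unit) => 1 - U (p.2, p.1.pt.2)) hξ h3
      (fun _ _ => sub_nonneg.2 (hU1 _)) (M := fun _ => 1) (by fun_prop)
      (fun p _ => by rw [Rat.cast_one]; exact sub_le_self _ (hU0 _))
      fun i _ => hVm i.pt.2
    refine h4.congr fun p _ => ?_
    rw [hint, ENNReal.toReal_ofReal]
    exact integral_nonneg fun κ => sub_nonneg.2 (hU1 _)

end Average

/-! ### There are only countably many tests -/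

section Countable

theorem countable_computableFunctional : {F | ComputableFunctional F}.Countable := by
  refine ((countable_computable (List ℕ × ℕ) (Option ℕ)).image fun φ (h : ℕ → ℕ) (n : ℕ) =>
    Nat.rfindOpt fun k => φ (initialSegment h k, n)).mono ?_
  rintro F ⟨φ, hφ, e⟩
  exact ⟨fun p => φ p.1 p.2, hφ, by ext1 h; ext1 n; exact (e h n).symm⟩

variable {Y : Type*} [PseudoMetricSpace Y] [BasicPoints Y]

theorem denseRange_basic_nat : DenseRange (basic : ℕ → ℕ) :=
  Function.Surjective.denseRange fun n => ⟨n, rfl⟩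

/-- A functional that realizes the approximating sequence determines it, since every point has a
name and limits of reals are unique. So `t` is determined by one of countably many functionals. -/
theorem countable_lowerSemicomputable (hY : DenseRange (basic : ℕ → Y)) :
    {t : Y → ℝ≥0∞ | LowerSemicomputable fun y => (t y : EReal)}.Countable := by
  have h : ∀ t : Y → ℝ≥0∞, LowerSemicomputable (fun y => (t y : EReal)) →
      ∃ F, ComputableFunctional F ∧ ∃ g : ℕ × Y → ℝ, (∀ y, ∀ h, IsCauchyName h y →
        ∃ g' : ℕ → ℕ, (∀ n, g' n ∈ F h n) ∧ IsCauchyName g' (g y)) ∧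
        ∀ y, (t y : EReal) = ⨆ n, ((g (n, y) : ℝ) : EReal) := by
    rintro t ⟨g, ⟨F, hF, h⟩, hg⟩
    exact ⟨F, hF, g, fun y => h y (Set.mem_univ _), hg⟩
  choose! F hF g hg hgt using h
  refine Set.MapsTo.countable_of_injOn (f := F) (t := {F | ComputableFunctional F}) hF
    (fun s hs t ht e => ?_) countable_computableFunctional
  have key : g s = g t := by
    funext y
    obtain ⟨h, hh⟩ := exists_isCauchyName (denseRange_basic_prod denseRange_basic_nat hY) y
    obtain ⟨u, hu, hu'⟩ := hg s hs y h hh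
    obtain ⟨v, hv, hv'⟩ := hg t ht y h hh
    have : u = v := funext fun n => Part.mem_unique (hu n) (e ▸ hv n)
    exact tendsto_nhds_unique hu'.2 (this ▸ hv'.2)
  funext y
  refine EReal.coe_ennreal_injective ?_
  rw [hgt s hs, hgt t ht, key]

end Countable

-- Randomness relative to almost every oracle

section AlmostEverywhere

variable {A X : Type*} [PseudoMetricSpace A] [BasicPoints A]
  [MetricSpace X] [BasicPoints X] [MeasurableSpace X] [BorelSpace X]

/-- For each test, finiteness of the average at `x` forces the integrand to be finite for almost
every `κ`. The normalizing factor is positive, so `t (κ, μ, x)` is then finite, and countably many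
null sets may be discarded together. -/
theorem ae_mem_SR (hX : DenseRange (basic : ℕ → X)) {a : A} {μ : Measures X} {x : X}
    (hx : x ∈ SR μ a) {ξ : A × Measures X → Measure (ℕ → ℕ)} [∀ p, IsProbabilityMeasure (ξ p)]
    (hξ : LowerIn (Named.name (K := (Set.univ : Set (A × Measures X)))) fun p σ =>
      (ξ p.pt).real (cylinderSet σ)) : ∀ᵐ κ ∂ξ (a, μ), x ∈ SR μ κ := by
  have hd : DenseRange (basic : ℕ → (ℕ → ℕ) × Measures X × X) :=
    denseRange_basic_prod denseRange_basic_baire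
      (denseRange_basic_prod (denseRange_basic_measures hX) hX)
  have hc : {t : (ℕ → ℕ) × Measures X × X → ℝ≥0∞ | IsUniformSchnorrTest t}.Countable :=
    (countable_lowerSemicomputable hd).mono fun t ht => ht.lowerSemicomputable
  have : SecondCountableTopology X := by
    have : TopologicalSpace.SeparableSpace X := ⟨Set.range basic, Set.countable_range _, hX⟩
    exact UniformSpace.secondCountable_of_separable X
  change ∀ᵐ κ ∂ξ (a, μ), ∀ t ∈ {t | IsUniformSchnorrTest t}, t (κ, μ, x) < ∞
  rw [ae_ball_iff hc]
  intro t ht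
  have h1 := hx _ (IsUniformSchnorrTest.average hX ht hξ)
  have hm := denseRange_basic_measures hX
  have hF : Continuous fun κ : ℕ → ℕ => (∫⁻ x, t (κ, μ, x) ∂μ.toMeasure).toReal :=
    (ht.computable_integral.continuous (denseRange_basic_prod denseRange_basic_baire hm)).comp
      (by fun_prop : Continuous fun κ : ℕ → ℕ => (κ, μ))
  obtain ⟨g, hg, hgt⟩ := ht.lowerSemicomputable
  have htm : Measurable fun κ : ℕ → ℕ => t (κ, μ, x) := by
    simp only [← iSup_ofReal_truncSup (hgt _)]
    exact Measurable.iSup fun n => ENNReal.measurable_ofReal.comp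
      ((continuous_truncSup (fun m => (hg.nat_prod_mk m).continuous hd) n).comp
        (by fun_prop : Continuous fun κ : ℕ → ℕ => (κ, μ, x))).measurable
  have hU : Measurable fun κ : ℕ → ℕ =>
      ENNReal.ofReal (1 / (1 + (∫⁻ x, t (κ, μ, x) ∂μ.toMeasure).toReal)) :=
    ENNReal.measurable_ofReal.comp (measurable_const.div (measurable_const.add hF.measurable))
  filter_upwards [ae_lt_top (htm.mul hU) h1.ne] with κ hκ
  refine lt_top_iff_ne_top.2 fun e => hκ.ne ?_
  have h2 : 0 < ENNReal.ofReal (1 / (1 + (∫⁻ x, t (κ, μ, x) ∂μ.toMeasure).toReal)) :=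
    ENNReal.ofReal_pos.2 (by positivity)
  change t (κ, μ, x) * _ = ∞
  rw [e]
  exact ENNReal.top_mul h2.ne'

end AlmostEverywhere

/-! ### Random selection -/

section Selection

/-- The probability that `n` is selected, when every `m` is accepted with probability `w m` as long
as no smaller number was. -/
noncomputable def selectionProb (w : ℕ → ℝ) (n : ℕ) : ℝ := w n * ∏ m ∈ Finset.range n, (1 - w m)

/-- Acceptance probabilities that lead to a selection almost surely. -/
structure IsSelector (w : ℕ → ℝ) : Prop where
  nonneg : ∀ k, 0 ≤ w k
  le_one : ∀ k, w k ≤ 1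
  frequently : ∃ ε > 0, ∃ᶠ k in atTop, ε ≤ w k

theorem sum_selectionProb (w : ℕ → ℝ) (n : ℕ) :
    ∑ m ∈ Finset.range n, selectionProb w m = 1 - ∏ m ∈ Finset.range n, (1 - w m) := by
  induction n with
  | zero => simp
  | succ n ih => rw [Finset.sum_range_succ, ih, Finset.prod_range_succ, selectionProb]; ring

namespace IsSelector

variable {w : ℕ → ℝ}

theorem prod_nonneg (hw : IsSelector w) (n : ℕ) : 0 ≤ ∏ m ∈ Finset.range n, (1 - w m) :=
  Finset.prod_nonneg fun m _ => sub_nonneg.2 (hw.le_one m)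

theorem selectionProb_nonneg (hw : IsSelector w) (n : ℕ) : 0 ≤ selectionProb w n :=
  mul_nonneg (hw.nonneg n) (hw.prod_nonneg n)

/-- The products decrease to a limit `l`. Infinitely often one step multiplies them by at most `1 -
ε`, so `l ≤ (1 - ε) * l` and `l = 0`: with probability one some number is selected. -/
theorem tendsto_prod (hw : IsSelector w) :
    Tendsto (fun n => ∏ m ∈ Finset.range n, (1 - w m)) atTop (𝓝 0) := by
  set P : ℕ → ℝ := fun n => ∏ m ∈ Finset.range n, (1 - w m) with hP
  have hanti : Antitone P := antitone_nat_of_succ_le fun n => by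
    rw [hP]
    simp only [Finset.prod_range_succ]
    exact mul_le_of_le_one_right (hw.prod_nonneg n) (by linarith [hw.nonneg n])
  obtain ⟨l, hl⟩ : ∃ l, Tendsto P atTop (𝓝 l) :=
    ⟨_, tendsto_atTop_ciInf hanti ⟨0, by rintro _ ⟨n, rfl⟩; exact hw.prod_nonneg n⟩⟩
  have hl0 : 0 ≤ l := ge_of_tendsto' hl hw.prod_nonneg
  obtain ⟨ε, hε, hfreq⟩ := hw.frequently
  have h1 : Tendsto (fun n => P (n + 1) - (1 - ε) * P n) atTop (𝓝 (l - (1 - ε) * l)) :=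
    (hl.comp (tendsto_add_atTop_nat 1)).sub (hl.const_mul _)
  have h2 : l - (1 - ε) * l ≤ 0 := by
    refine le_of_tendsto_of_frequently h1 (hfreq.mono fun n hn => ?_)
    have : P (n + 1) = P n * (1 - w n) := Finset.prod_range_succ _ _
    have h3 : 0 ≤ P n := hw.prod_nonneg n
    nlinarith
  have h3 : l = 0 := by nlinarith
  rwa [h3] at hl

theorem hasSum_selectionProb (hw : IsSelector w) : HasSum (selectionProb w) 1 := by
  rw [hasSum_iff_tendsto_nat_of_nonneg hw.selectionProb_nonneg]
  simp only [sum_selectionProb]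
  simpa using hw.tendsto_prod.const_sub 1

/-- The distribution of the selected number. -/
noncomputable def pmf (hw : IsSelector w) : PMF ℕ :=
  ⟨fun n => ENNReal.ofReal (selectionProb w n), by
    rw [ENNReal.summable.hasSum_iff, ← ENNReal.ofReal_tsum_of_nonneg hw.selectionProb_nonneg
      hw.hasSum_selectionProb.summable, hw.hasSum_selectionProb.tsum_eq, ENNReal.ofReal_one]⟩

theorem pmf_toMeasure_singleton (hw : IsSelector w) (n : ℕ) :
    hw.pmf.toMeasure {n} = ENNReal.ofReal (selectionProb w n) :=
  PMF.toMeasure_apply_singleton _ _ (measurableSet_singleton n)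

end IsSelector

variable {w : ℕ → ℕ → ℝ}

/-- The distribution of a sequence of independently selected numbers. -/
noncomputable def selectionMeasure (hw : ∀ j, IsSelector (w j)) : Measure (ℕ → ℕ) :=
  Measure.infinitePi fun j => (hw j).pmf.toMeasure

instance (hw : ∀ j, IsSelector (w j)) : IsProbabilityMeasure (selectionMeasure hw) := by
  unfold selectionMeasure; infer_instance

theorem selectionMeasure_cylinderSet (hw : ∀ j, IsSelector (w j)) (σ : List ℕ) :
    (selectionMeasure hw).real (cylinderSet σ) =
      ∏ j ∈ Finset.range σ.length, selectionProb (w j) (σ.getD j 0) := by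
  have h : cylinderSet σ = Set.pi (Finset.range σ.length) fun j => {σ.getD j 0} := by
    rw [cylinderSet_eq]; ext κ; simp
  rw [measureReal_def, h, selectionMeasure,
    Measure.infinitePi_pi _ fun j _ => measurableSet_singleton _, ENNReal.toReal_prod]
  refine Finset.prod_congr rfl fun j _ => ?_
  rw [(hw j).pmf_toMeasure_singleton, ENNReal.toReal_ofReal ((hw j).selectionProb_nonneg _)]

/-- A number of weight zero is selected with probability zero, and there are only countably many
pairs of a position and a number. -/
theorem ae_selectionMeasure_pos (hw : ∀ j, IsSelector (w j)) :
    ∀ᵐ κ ∂selectionMeasure hw, ∀ j, 0 < w j (κ j) := by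
  rw [ae_all_iff]
  intro j
  have h := measurePreserving_eval_infinitePi (fun j => (hw j).pmf.toMeasure) j
  refine h.quasiMeasurePreserving.ae (p := fun n => 0 < w j n) ?_
  rw [ae_iff_of_countable]
  intro n hn
  rw [(hw j).pmf_toMeasure_singleton] at hn
  refine lt_of_le_of_ne ((hw j).nonneg n) fun e => hn ?_
  simp [selectionProb, ← e]

/-- All factors are nonnegative, so lower cuts multiply; the averaging argument needs no more than
lower bounds on cylinders. -/
theorem lowerIn_prod_selectionProb {I : Type*} {o : I → ℕ → ℕ} {W : I → ℕ → ℕ → ℝ}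
    (hW : ComputableRealIn o fun i (p : ℕ × ℕ) => W i p.1 p.2) (h0 : ∀ i j k, 0 ≤ W i j k)
    (h1 : ∀ i j k, W i j k ≤ 1) : LowerIn o fun i (σ : List ℕ) =>
      ∏ j ∈ Finset.range σ.length, selectionProb (W i j) (σ.getD j 0) := by
  have hone : ComputableRealIn o fun _ (_ : (ℕ × ℕ) × ℕ) => (1 : ℝ) :=
    (ComputableRealIn.of_rat (f := fun _ => (1 : ℚ)) (by fun_prop)).congr fun _ _ => by simp
  have h2 : LowerIn o fun i (p : (ℕ × ℕ) × ℕ) => 1 - W i p.1.1 p.2 :=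
    (hone.sub (hW.comp (u := fun p : (ℕ × ℕ) × ℕ => (p.1.1, p.2)) (by fun_prop))).1
  have h3 : LowerIn o fun i (p : ℕ × ℕ) => selectionProb (W i p.1) p.2 :=
    hW.1.mul (LowerIn.prod_range (f := fun i (p : ℕ × ℕ) m => 1 - W i p.1 m) h2
      (fun i p m => sub_nonneg.2 (h1 i _ m)) (n := fun p => p.2) (by fun_prop))
      (fun i p => h0 i _ _) fun i p => Finset.prod_nonneg fun m _ => sub_nonneg.2 (h1 i _ m)
  exact LowerIn.prod_range (f := fun i (σ : List ℕ) j => selectionProb (W i j) (σ.getD j 0))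
    (h3.comp (u := fun p : List ℕ × ℕ => (p.2, p.1.getD p.2 0)) (by fun_prop))
    (fun i σ j => mul_nonneg (h0 _ _ _) (Finset.prod_nonneg fun m _ => sub_nonneg.2 (h1 i _ m)))
    (n := fun σ => σ.length) (by fun_prop)

end Selection

section Oracle

variable {A X : Type*} [PseudoMetricSpace A] [BasicPoints A]
  [MetricSpace X] [BasicPoints X] [MeasurableSpace X] [BorelSpace X]

/-- A point that is random relative to `a` is random relative to some sequence of numbers each of
which has a positive weight. -/
theorem exists_mem_SR_of_weights (hX : DenseRange (basic : ℕ → X)) {a : A} {μ : Measures X} {x : X}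
    (hx : x ∈ SR μ a) {W : A × Measures X → ℕ → ℕ → ℝ} (hW : ∀ p j, IsSelector (W p j))
    (hWc : ComputableRealIn (Named.name (K := (Set.univ : Set (A × Measures X))))
      fun p (q : ℕ × ℕ) => W p.pt q.1 q.2) :
    ∃ κ : ℕ → ℕ, x ∈ SR μ κ ∧ ∀ j, 0 < W (a, μ) j (κ j) := by
  have h1 : ∀ᵐ κ ∂selectionMeasure (hW (a, μ)), x ∈ SR μ κ :=
    ae_mem_SR hX hx (ξ := fun p => selectionMeasure (hW p))
      ((lowerIn_prod_selectionProb hWc (fun p j => (hW p.pt j).nonneg)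
        fun p j => (hW p.pt j).le_one).congr fun p σ => selectionMeasure_cylinderSet _ σ)
  exact (h1.and (ae_selectionMeasure_pos (hW (a, μ)))).exists

end Oracle

/-! ### Basic functions that control tails -/

section Tail

/-- Code of the maximum of the bump functions of size `2⁻ʲ` around the first `N + 1` basic points. -/
def coverCode (j : ℕ) : ℕ → ℕ
  | 0 => bumpCode 0 (Nat.pair 0 (2 ^ j - 1)) (Nat.pair 0 (2 ^ j - 1))
  | N + 1 => maxCode (coverCode j N)
    (bumpCode (N + 1) (Nat.pair 0 (2 ^ j - 1)) (Nat.pair 0 (2 ^ j - 1)))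

/-- Code of a basic function that vanishes near the first `N + 1` basic points, and is equal to `1`
off larger balls around them. -/
def tailCode (j N : ℕ) : ℕ := addCode 0 (mulCode (Nat.pair 0 (Nat.pair 1 0)) (coverCode j N))

theorem computable_tailCode : Computable fun p : ℕ × ℕ => tailCode p.1 p.2 := by
  have h0 : Computable fun p : ℕ × ℕ =>
      bumpCode 0 (Nat.pair 0 (2 ^ p.1 - 1)) (Nat.pair 0 (2 ^ p.1 - 1)) := by
    unfold bumpCode; fun_prop
  have h1 : Computable fun q : (ℕ × ℕ) × ℕ × ℕ => maxCode q.2.2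
      (bumpCode (q.2.1 + 1) (Nat.pair 0 (2 ^ q.1.1 - 1)) (Nat.pair 0 (2 ^ q.1.1 - 1))) := by
    unfold bumpCode maxCode; fun_prop
  have h2 : Computable fun p : ℕ × ℕ => coverCode p.1 p.2 := by
    refine (Computable.nat_rec (f := fun p : ℕ × ℕ => p.2) (g := fun p : ℕ × ℕ =>
      bumpCode 0 (Nat.pair 0 (2 ^ p.1 - 1)) (Nat.pair 0 (2 ^ p.1 - 1)))
      (h := fun p q => maxCode q.2 (bumpCode (q.1 + 1) (Nat.pair 0 (2 ^ p.1 - 1))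
        (Nat.pair 0 (2 ^ p.1 - 1)))) (by fun_prop) h0 h1).of_eq ?_
    rintro ⟨j, N⟩
    induction N with
    | zero => rfl
    | succ N ih => simp only [coverCode] at ih ⊢; rw [← ih]
  unfold tailCode addCode mulCode
  fun_prop

variable {X : Type*} [PseudoMetricSpace X] [BasicPoints X]

theorem posRatOf_half_pow (j : ℕ) : (posRatOf (Nat.pair 0 (2 ^ j - 1)) : ℝ) = (1 / 2) ^ j := by
  have h : ((2 ^ j - 1 : ℕ) : ℝ) + 1 = 2 ^ j := by
    have := Nat.one_le_two_pow (n := j)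
    exact_mod_cast (by omega : 2 ^ j - 1 + 1 = 2 ^ j)
  rw [posRatOf, Nat.unpair_pair]
  push_cast
  rw [h]
  simp

theorem basicFun_bumpCode_half_pow (i j : ℕ) (y : X) :
    basicFun X (bumpCode i (Nat.pair 0 (2 ^ j - 1)) (Nat.pair 0 (2 ^ j - 1))) y =
      bump (basic i) ((1 / 2) ^ j) ((1 / 2) ^ j + (1 / 2) ^ j) y := by
  rw [basicFun_bumpCode, posRatOf_half_pow]

theorem basicFun_coverCode_succ (j N : ℕ) (y : X) : basicFun X (coverCode j (N + 1)) y =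
    max (basicFun X (coverCode j N) y)
      (bump (basic (N + 1)) ((1 / 2) ^ j) ((1 / 2) ^ j + (1 / 2) ^ j) y) := by
  rw [coverCode, basicFun_maxCode]
  exact congrArg _ (basicFun_bumpCode_half_pow _ _ _)

theorem bump_mem_Icc {Y : Type*} [PseudoMetricSpace Y] (x y : Y) {r t : ℝ} (ht : 0 < t) : bump x r (r + t) y ∈ Set.Icc (0 : ℝ) 1 := by
  rw [bump_eq x y ht]
  exact ⟨le_max_left _ _, max_le zero_le_one (min_le_left _ _)⟩

theorem basicFun_coverCode_mem_Icc (j N : ℕ) (y : X) :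
    basicFun X (coverCode j N) y ∈ Set.Icc (0 : ℝ) 1 := by
  have h := fun i : ℕ => bump_mem_Icc (basic i) y (r := (1 / 2) ^ j)
    (by positivity : (0 : ℝ) < (1 / 2) ^ j)
  induction N with
  | zero => rw [coverCode, basicFun_bumpCode_half_pow]; exact h 0
  | succ N ih =>
    rw [basicFun_coverCode_succ]
    exact ⟨ih.1.trans (le_max_left _ _), max_le ih.2 (h _).2⟩

theorem basicFun_coverCode_eq_one {j n N : ℕ} {y : X} (hn : n ≤ N)
    (h : dist (basic n) y ≤ (1 / 2) ^ j) : basicFun X (coverCode j N) y = 1 := by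
  have h1 : bump (basic n) ((1 / 2) ^ j) ((1 / 2) ^ j + (1 / 2) ^ j) y = 1 := if_pos h
  induction N with
  | zero =>
    obtain rfl : n = 0 := by omega
    rw [coverCode, basicFun_bumpCode_half_pow, h1]
  | succ N ih =>
    rw [basicFun_coverCode_succ]
    rcases Nat.le_succ_iff.1 hn with hn | rfl
    · rw [ih hn]
      exact max_eq_left (bump_mem_Icc _ _ (by positivity)).2
    · rw [h1]; exact max_eq_right (basicFun_coverCode_mem_Icc j N y).2

theorem basicFun_coverCode_eq_zero {j N : ℕ} {y : X}
    (h : ∀ n ≤ N, 2 * (1 / 2) ^ j < dist (basic n) y) : basicFun X (coverCode j N) y = 0 := by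
  have hj : (0 : ℝ) < (1 / 2) ^ j := by positivity
  have h1 : ∀ n ≤ N, bump (basic n) ((1 / 2) ^ j) ((1 / 2) ^ j + (1 / 2) ^ j) y = 0 := by
    intro n hn
    have := h n hn
    rw [bump, if_neg (by linarith), if_neg (by linarith)]
  induction N with
  | zero => rw [coverCode, basicFun_bumpCode_half_pow, h1 0 le_rfl]
  | succ N ih =>
    rw [basicFun_coverCode_succ, ih (fun n hn => h n (by omega)) fun n hn => h1 n (by omega),
      h1 _ le_rfl, max_self]

theorem basicFun_tailCode (j N : ℕ) (y : X) :
    basicFun X (tailCode j N) y = 1 - basicFun X (coverCode j N) y := by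
  rw [tailCode, basicFun_addCode, basicFun_mulCode, basicFun_zero]
  simp [ratOf, sub_eq_add_neg]

/-- The union of balls off which the tail function is equal to `1`. -/
def cover (X : Type*) [PseudoMetricSpace X] [BasicPoints X] (j N : ℕ) : Set X :=
  ⋃ n ∈ Finset.range (N + 1), Metric.closedBall (basic n) (2 * (1 / 2) ^ j)

theorem isClosed_cover (j N : ℕ) : IsClosed (cover X j N) :=
  isClosed_biUnion_finset fun _ _ => Metric.isClosed_closedBall

theorem cover_mono (j : ℕ) {M N : ℕ} (h : M ≤ N) : cover X j M ⊆ cover X j N :=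
  Set.biUnion_subset_biUnion_left fun n hn => by
    simp only [Finset.coe_range, Set.mem_Iio] at hn ⊢
    exact lt_of_lt_of_le hn (by omega)

variable [MeasurableSpace X] [BorelSpace X]

/-- The tail function is nonnegative and equal to `1` off the cover. It turns a bound on the mass of
an open set into one on the integral of a basic function, which is computable from the measure. -/
theorem measure_cover_compl_le (ν : Measures X) (j N : ℕ) :
    ν.toMeasure.real (cover X j N)ᶜ ≤ basicIntegral ν (tailCode j N) := by
  rw [basicIntegral, ← integral_indicator_one (isClosed_cover j N).measurableSet.compl]
  refine integral_mono ((integrable_const (1 : ℝ)).indicator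
    (isClosed_cover j N).measurableSet.compl) (integrable_basicFun _ _) fun y => ?_
  simp only
  rw [basicFun_tailCode]
  by_cases hy : y ∈ (cover X j N)ᶜ
  · rw [Set.indicator_of_mem hy, basicFun_coverCode_eq_zero]
    · simp
    · intro n hn
      by_contra hlt
      refine hy (Set.mem_biUnion (x := n) (by simpa using Nat.lt_succ_of_le hn) ?_)
      rw [Metric.mem_closedBall, dist_comm]
      exact not_lt.1 hlt
  · rw [Set.indicator_of_notMem hy]
    exact sub_nonneg.2 (basicFun_coverCode_mem_Icc j N y).2

/-- By density each point is within `2⁻ʲ` of some basic point, from whose index on the tail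
functions vanish there; dominated convergence gives the rest. -/
theorem tendsto_basicIntegral_tailCode (hX : DenseRange (basic : ℕ → X)) (ν : Measures X) (j : ℕ) :
    Tendsto (fun N => basicIntegral ν (tailCode j N)) atTop (𝓝 0) := by
  have h := tendsto_integral_of_dominated_convergence (μ := ν.toMeasure)
    (F := fun N y => basicFun X (tailCode j N) y) (f := fun _ => 0) (fun _ => (1 : ℝ))
    (fun N => (continuous_basicFun _).aestronglyMeasurable) (integrable_const 1)
    (fun N => ae_of_all _ fun y => ?_) (ae_of_all _ fun y => ?_)
  · simpa [basicIntegral] using h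
  · rw [basicFun_tailCode]
    obtain ⟨h1, h2⟩ := basicFun_coverCode_mem_Icc j N y
    rw [Real.norm_of_nonneg (by linarith)]
    linarith
  · obtain ⟨n, hn⟩ := hX.exists_dist_lt y (by positivity : (0 : ℝ) < (1 / 2) ^ j)
    refine tendsto_const_nhds.congr' ?_
    filter_upwards [eventually_ge_atTop n] with N hN
    rw [basicFun_tailCode, basicFun_coverCode_eq_one hN (by rw [dist_comm]; exact hn.le), sub_self]

end Tail

/-! ### Limits of tight sequences of measures -/

section Tight

variable {X : Type*} [MetricSpace X] [BasicPoints X] [MeasurableSpace X] [BorelSpace X]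

/-- Prokhorov's argument: bounded masses and uniformly small tails off compact sets confine the
sequence to a weakly compact set. A weak limit along an ultrafilter is a limit of the integrals of
basic functions, hence a cluster point for the metric, and a Cauchy sequence converges to its
cluster points. -/
theorem exists_tendsto_of_cauchySeq_of_cover [CompleteSpace X] {ν : ℕ → Measures X}
    (hν : CauchySeq ν) {C : ℝ≥0} (hC : ∀ j, FiniteMeasure.mass (ν j) ≤ C) {N : ℕ → ℕ}
    (hN : ∀ k j, (ν j).toMeasure.real (cover X k (N k))ᶜ ≤ 2 * (1 / 2) ^ k) :
    ∃ μ, Tendsto ν atTop (𝓝 μ) := by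
  -- Each cover in the intersection is a finite union of balls of radius `2 · 2⁻ᵏ`, so `S r` is
  -- closed and totally bounded. The mass off it is at most the sum of `2 · 2⁻ᵏ` over `k ≥ r`, which
  -- is `4 · 2⁻ʳ`.
  let S : ℕ → Set X := fun r => ⋂ k ∈ Set.Ici r, cover X k (N k)
  have hS : ∀ r, IsCompact (S r) := by
    intro r
    refine TotallyBounded.isCompact_of_isClosed (Metric.totallyBounded_iff.2 fun ε hε => ?_)
      (isClosed_biInter fun k _ => isClosed_cover k _)
    obtain ⟨k, hk⟩ := (((tendsto_half_pow.const_mul 2).eventually_lt_const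
      (by simpa using hε)).and (eventually_ge_atTop r)).exists
    refine ⟨basic '' (Finset.range (N k + 1) : Set ℕ), (Finset.finite_toSet _).image _, ?_⟩
    refine (Set.biInter_subset_of_mem (Set.mem_Ici.2 hk.2)).trans ?_
    rw [Set.biUnion_image]
    exact Set.iUnion₂_mono fun n _ => Metric.closedBall_subset_ball hk.1
  have hmono : Monotone S := fun r s h => Set.biInter_mono (Set.Ici_subset_Ici.2 h) fun _ _ => le_rfl
  have hu : Tendsto (fun r : ℕ => (4 * (1 / 2) ^ r : ℝ≥0)) atTop (𝓝 0) := by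
    rw [← NNReal.tendsto_coe]
    push_cast
    simpa using tendsto_half_pow.const_mul 4
  have hle : ∀ r j, (ν j).toMeasure (S r)ᶜ ≤ ((4 * (1 / 2) ^ r : ℝ≥0) : ℝ≥0∞) := by
    intro r j
    have h1 : (S r)ᶜ ⊆ ⋃ i : ℕ, (cover X (i + r) (N (i + r)))ᶜ := by
      intro y hy
      simp only [S, Set.mem_compl_iff, Set.mem_iInter, Set.mem_Ici, not_forall] at hy
      obtain ⟨k, hk, hy⟩ := hy
      exact Set.mem_iUnion.2 ⟨k - r, by rwa [Nat.sub_add_cancel hk]⟩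
    have h2 : ∀ i, (ν j).toMeasure (cover X (i + r) (N (i + r)))ᶜ ≤
        ENNReal.ofReal ((1 / 2) ^ i * (2 * (1 / 2) ^ r)) := by
      intro i
      rw [← ofReal_measureReal]
      refine ENNReal.ofReal_le_ofReal ((hN _ _).trans (le_of_eq ?_))
      rw [pow_add]; ring
    calc (ν j).toMeasure (S r)ᶜ ≤ ∑' i, (ν j).toMeasure (cover X (i + r) (N (i + r)))ᶜ :=
          (measure_mono h1).trans (measure_iUnion_le _)
      _ ≤ ∑' i : ℕ, ENNReal.ofReal ((1 / 2) ^ i * (2 * (1 / 2) ^ r)) := ENNReal.tsum_le_tsum h2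
      _ = ENNReal.ofReal (∑' i : ℕ, (1 / 2) ^ i * (2 * (1 / 2) ^ r)) :=
          (ENNReal.ofReal_tsum_of_nonneg (fun i => by positivity)
            (summable_geometric_two.mul_right _)).symm
      _ = _ := by
          rw [tsum_mul_right, tsum_geometric_two, ← ENNReal.ofReal_coe_nnreal]
          congr 1
          push_cast
          ring
  have hcomp := isCompact_setOfPred_finiteMeasure_mass_le_compl_isCompact_le C hu hS (Or.inr hmono)
  let U : Ultrafilter ℕ := hyperfilter ℕ
  let ν' : ℕ → FiniteMeasure X := ν
  obtain ⟨μ, _, hμ⟩ := hcomp.ultrafilter_le_nhds' (U.map ν') (by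
    refine Ultrafilter.mem_map.2 (univ_mem' fun j => ⟨hC j, fun r => ?_⟩)
    have h1 : (ν' j : Measure X) (S r)ᶜ ≤ ((4 * (1 / 2) ^ r : ℝ≥0) : ℝ≥0∞) := hle r j
    rw [← FiniteMeasure.ennreal_coeFn_eq_coeFn_toMeasure] at h1
    exact ENNReal.coe_le_coe.1 h1)
  have h1 : Tendsto ν' U (𝓝 μ) := hμ
  rw [FiniteMeasure.tendsto_iff_forall_integral_tendsto] at h1
  have h2 : Tendsto ν U (𝓝 (μ : Measures X)) := by
    refine tendsto_measures_of_basicIntegral fun m => ?_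
    obtain ⟨c, hc⟩ := exists_bound_basicFun (X := X) m
    exact h1 (BoundedContinuousFunction.ofNormedAddCommGroup (basicFun X m)
      (continuous_basicFun m) c hc)
  exact ⟨μ, tendsto_nhds_of_cauchySeq_of_subseq hν (f := id) (p := (U : Filter ℕ))
    Nat.hyperfilter_le_atTop h2⟩

end Tight

/-! ### Semidecidable sets of sequences are effectively open -/

section EffectivelyOpen

theorem eq_of_baire_dist_lt {g h : ℕ → ℕ} {m j : ℕ} (hd : dist g h < (1 / 2 : ℝ) ^ m)
    (hj : j ≤ m) : g j = h j := by
  by_cases e : g = h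
  · rw [e]
  · have e' : dist g h = (1 / 2 : ℝ) ^ PiNat.firstDiff g h := PiNat.dist_eq_of_ne e
    rw [e', pow_lt_pow_iff_right_of_lt_one₀ (by norm_num) (by norm_num)] at hd
    exact PiNat.apply_eq_of_lt_firstDiff (lt_of_le_of_lt hj hd)

theorem SemidecidableIn.effectivelyOpen {R : (ℕ → ℕ) → Prop}
    (hR : SemidecidableIn (fun h : ℕ → ℕ => h) fun h (_ : Unit) => R h) :
    EffectivelyOpen {h | R h} := by
  obtain ⟨f, hf, hmono, hiff⟩ := hR
  have hb : Computable fun n : ℕ => f (Denumerable.ofNat (List ℕ) n.unpair.1, ()) &&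
      (decide (1 ≤ (Denumerable.ofNat (List ℕ) n.unpair.1).length) &&
      decide (posRatOf n.unpair.2 ≤
        (1 / 2) ^ ((Denumerable.ofNat (List ℕ) n.unpair.1).length - 1))) :=
    computable_and (hf.comp (g := fun n : ℕ => (Denumerable.ofNat (List ℕ) n.unpair.1, ()))
      (by fun_prop)) (computable_and (computable_decide_le (by fun_prop) (by fun_prop))
      (computable_rat_decide_le (by fun_prop) (by fun_prop)))
  refine ⟨fun n => (f (Denumerable.ofNat (List ℕ) n.unpair.1, ()) &&
      (decide (1 ≤ (Denumerable.ofNat (List ℕ) n.unpair.1).length) &&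
      decide (posRatOf n.unpair.2 ≤
        (1 / 2) ^ ((Denumerable.ofNat (List ℕ) n.unpair.1).length - 1)))) = true,
    ⟨inferInstance, by simpa using hb⟩, Set.ext fun h => ?_⟩
  simp only [Set.mem_ofPred_eq, basicBall, Metric.mem_ball, Bool.and_eq_true, decide_eq_true_eq]
  refine (hiff h ()).trans ?_
  constructor
  · rintro ⟨k, hk⟩
    -- The accepted prefix is lengthened by one place, so that `h` has distance at most `2⁻ᵏ⁻¹` from
    -- the centre and lies strictly inside the ball of radius `2⁻ᵏ`. Members of this ball still
    -- agree on all `k + 1` places.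
    have hk := hmono h () k (k + 1) (Nat.le_succ k) hk
    obtain ⟨c, hc⟩ := exists_posRatOf (q := (1 / 2) ^ k) (by positivity)
    refine ⟨Nat.pair (Encodable.encode (initialSegment h (k + 1))) c, ?_, ?_⟩
    · simpa [hc] using hk
    · simp only [Nat.unpair_pair, hc]
      refine lt_of_le_of_lt (b := (1 / 2 : ℝ) ^ (k + 1)) (baire_dist_le_iff.2 fun j hj => ?_) ?_
      · rw [basic_encode_apply, getD_initialSegment h hj]
      · push_cast
        exact pow_lt_pow_right_of_lt_one₀ (by norm_num) (by norm_num) (Nat.lt_succ_self k)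
  · rintro ⟨n, ⟨h1, h2, h3⟩, h4⟩
    refine ⟨(Denumerable.ofNat (List ℕ) n.unpair.1).length, ?_⟩
    convert h1 using 3
    refine ((eq_initialSegment_iff h _).2 fun j hj => ?_).symm
    have h3' : (posRatOf n.unpair.2 : ℝ) ≤
        (1 / 2) ^ ((Denumerable.ofNat (List ℕ) n.unpair.1).length - 1) := by
      have := (Rat.cast_le (K := ℝ)).2 h3
      push_cast at this
      exact this
    exact eq_of_baire_dist_lt (h4.trans_le h3') (by omega)

end EffectivelyOpen

/-! ### Selection of names -/

section Names

variable {A X : Type*} [MetricSpace A] [BasicPoints A]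
  [MetricSpace X] [BasicPoints X] [MeasurableSpace X]

/-- The code of a basic point in a selected number. -/
def pointCode (k : ℕ) : ℕ := k.unpair.1.unpair.1

/-- The size of a cover in a selected number. -/
def coverSize (k : ℕ) : ℕ := k.unpair.1.unpair.2

@[fun_prop] theorem computable_pointCode {α : Type*} [Primcodable α] {k : α → ℕ}
    (hk : Computable k) : Computable fun a => pointCode (k a) := by unfold pointCode; fun_prop

@[fun_prop] theorem computable_coverSize {α : Type*} [Primcodable α] {k : α → ℕ}
    (hk : Computable k) : Computable fun a => coverSize (k a) := by unfold coverSize; fun_prop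

/-- The weight of the number `k` as the `j`-th term of a name of `p` together with sizes of covers:
it is positive if the basic point is close to `p`, and the cover has a small complement. -/
noncomputable def nameWeight (p : A × Measures X) (j k : ℕ) : ℝ :=
  min 1 (max 0 (min ((1 / 2) ^ (j + 1) - dist (basic (pointCode k)) p)
    ((1 / 2) ^ j - basicIntegral p.2 (tailCode j (coverSize k)))))

theorem nameWeight_pos {p : A × Measures X} {j k : ℕ} (h : 0 < nameWeight p j k) :
    dist (basic (pointCode k)) p < (1 / 2) ^ (j + 1) ∧
      basicIntegral p.2 (tailCode j (coverSize k)) < (1 / 2) ^ j := by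
  have h1 := (lt_min_iff.1 h).2
  rcases lt_max_iff.1 h1 with h2 | h2
  · exact absurd h2 (lt_irrefl _)
  · exact ⟨sub_pos.1 (lt_min_iff.1 h2).1, sub_pos.1 (lt_min_iff.1 h2).2⟩

theorem isCauchyName_pointCode {p : A × Measures X} {κ : ℕ → ℕ}
    (h : ∀ j, 0 < nameWeight p j (κ j)) : IsCauchyName (fun j => pointCode (κ j)) p :=
  isCauchyName_of_dist_le fun j => (nameWeight_pos (h j)).1.le

variable (A X) in
/-- The set of sequences that contain a fast Cauchy sequence of basic points, and witnesses of the
tightness of its measures. -/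
def tightNames : Set (ℕ → ℕ) :=
  {h | (∀ i j, i ≤ j → dist (basic (pointCode (h j)) : A × Measures X)
      (basic (pointCode (h i))) ≤ (1 / 2) ^ i) ∧
    ∀ k j, tailCode k (coverSize (h k)) + 1 + k ≤ j →
      basicIntegral (basic (pointCode (h j)) : A × Measures X).2 (tailCode k (coverSize (h k))) ≤
        2 * (1 / 2) ^ k}

/-- The tightness condition concerns the late terms of the sequence, not its limit, because
integrals of basic measures are computable. From the index `tailCode + 1 + k` on, these integrals
differ from that of the limit by at most `2⁻ᵏ`, which accounts for the factor `2`. -/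
theorem mem_tightNames {p : A × Measures X} {κ : ℕ → ℕ} (h : ∀ j, 0 < nameWeight p j (κ j)) :
    κ ∈ tightNames A X := by
  have hn := isCauchyName_pointCode h
  refine ⟨hn.1, fun k j hj => ?_⟩
  have h1 : dist (basic (pointCode (κ j)) : A × Measures X).2 p.2 ≤
      (1 / 2) ^ (tailCode k (coverSize (κ k)) + 1 + k) :=
    (le_max_right _ _).trans ((hn.dist_le j).trans
      (pow_le_pow_of_le_one (by norm_num) (by norm_num) hj))
  have h2 := (abs_le.1 (abs_basicIntegral_sub_le h1)).2
  linarith [(nameWeight_pos (h k)).2]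

variable [IsComputableMetricSpace A] [IsComputableMetricSpace X] [BorelSpace X]

theorem isSelector_nameWeight (p : A × Measures X) (j : ℕ) : IsSelector (nameWeight p j) := by
  have hX : DenseRange (basic : ℕ → X) := IsComputableMetricSpace.dense
  have hA : DenseRange (basic : ℕ → A) := IsComputableMetricSpace.dense
  refine ⟨fun k => le_min zero_le_one (le_max_left _ _), fun k => min_le_left _ _, ?_⟩
  obtain ⟨n, hn⟩ := (denseRange_basic_prod hA (denseRange_basic_measures hX)).exists_dist_lt p
    (by positivity : (0 : ℝ) < (1 / 2) ^ (j + 1))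
  obtain ⟨N, hN⟩ := ((tendsto_basicIntegral_tailCode hX p.2 j).eventually_lt_const
    (by positivity : (0 : ℝ) < (1 / 2) ^ j)).exists
  -- The second component of the number is ignored by the weight. It makes each admissible pair of a
  -- point and a cover recur at arbitrarily large numbers, so a fixed positive weight is met
  -- infinitely often.
  have hw : ∀ l, nameWeight p j (Nat.pair (Nat.pair n N) l) =
      nameWeight p j (Nat.pair (Nat.pair n N) 0) := fun l => by
    simp [nameWeight, pointCode, coverSize]
  refine ⟨nameWeight p j (Nat.pair (Nat.pair n N) 0), ?_, ?_⟩
  · simp only [nameWeight, pointCode, coverSize, Nat.unpair_pair]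
    rw [dist_comm] at hn
    exact lt_min zero_lt_one (lt_max_of_lt_right (lt_min (sub_pos.2 hn) (sub_pos.2 hN)))
  · refine frequently_atTop.2 fun l => ⟨Nat.pair (Nat.pair n N) l, Nat.right_le_pair _ _, ?_⟩
    exact (hw l).ge

theorem computable_nameWeight :
    ComputableRealIn (Named.name (K := (Set.univ : Set (A × Measures X))))
      fun p (q : ℕ × ℕ) => nameWeight p.pt q.1 q.2 := by
  have hd : ComputableDist (A × Measures X) :=
    (computableDist_of_isComputableMetricSpace A).prod (computableDist_measures X)
  have hp := pointIn_named (α := Unit) (Set.univ : Set (A × Measures X))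
  have h1 : ComputableRealIn (Named.name (K := (Set.univ : Set (A × Measures X))))
      fun p (q : ℕ × ℕ) => dist (basic (pointCode q.2)) p.pt :=
    (hd.pointIn hp).comp (u := fun q : ℕ × ℕ => ((), pointCode q.2)) (by fun_prop)
  have h2 : ComputableRealIn (Named.name (K := (Set.univ : Set (A × Measures X))))
      fun p (q : ℕ × ℕ) => basicIntegral p.pt.2 (tailCode q.1 (coverSize q.2)) :=
    (PointIn.basicIntegral hp.snd).comp (u := fun q : ℕ × ℕ => ((), tailCode q.1 (coverSize q.2)))
      (computable_mk (Computable.const _) (computable_tailCode.comp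
        (g := fun q : ℕ × ℕ => (q.1, coverSize q.2)) (by fun_prop)))
  have h3 : ∀ m : ℕ, ComputableRealIn (Named.name (K := (Set.univ : Set (A × Measures X))))
      fun _ (q : ℕ × ℕ) => (1 / 2 : ℝ) ^ (q.1 + m) := fun m =>
    (ComputableRealIn.of_rat (f := fun q : ℕ × ℕ => (1 / 2 : ℚ) ^ (q.1 + m))
      (by fun_prop)).congr fun _ _ => by push_cast; rfl
  have h4 : ∀ c : ℚ, ComputableRealIn (Named.name (K := (Set.univ : Set (A × Measures X))))
      fun _ (_ : ℕ × ℕ) => (c : ℝ) := fun c => ComputableRealIn.of_rat (by fun_prop)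
  exact ((h4 1).min ((h4 0).max (((h3 1).sub h1).min ((h3 0).sub h2)))).congr fun p q => by
    simp [nameWeight]

theorem exists_mem_SR_nameWeight_pos {a : A} {μ : Measures X} {x : X} (hx : x ∈ SR μ a) :
    ∃ κ : ℕ → ℕ, x ∈ SR μ κ ∧ ∀ j, 0 < nameWeight (a, μ) j (κ j) :=
  exists_mem_SR_of_weights IsComputableMetricSpace.dense hx isSelector_nameWeight
    computable_nameWeight

theorem computableMap_pointCode : ComputableMap fun (κ : ℕ → ℕ) (j : ℕ) => pointCode (κ j) :=
  computableMap_baire_unpair_fst.comp computableMap_baire_unpair_fst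

theorem exists_isCauchyName_mem_SR {a : A} {μ : Measures X} {x : X} (hx : x ∈ SR μ a) :
    ∃ h : ℕ → ℕ, IsCauchyName h (a, μ) ∧ x ∈ SR μ h := by
  obtain ⟨κ, h1, h2⟩ := exists_mem_SR_nameWeight_pos hx
  exact ⟨_, isCauchyName_pointCode h2, mem_SR_map h1 computableMap_pointCode⟩

/-- A violation of either condition involves two terms of the sequence and a strict inequality
between a rational and a computable real, so it is eventually detected. -/
theorem effectivelyClosed_tightNames : EffectivelyClosed (tightNames A X) := by
  have hd : ComputableDist (A × Measures X) :=
    (computableDist_of_isComputableMetricSpace A).prod (computableDist_measures X)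
  have h1 : SemidecidableIn (fun h : ℕ → ℕ => h) fun h (q : Unit × (ℕ × ℕ) × ℕ × ℕ) =>
      (h q.2.1.1 = q.2.2.1 ∧ h q.2.1.2 = q.2.2.2) ∧ (q.2.1.1 ≤ q.2.1.2 ∧
        (((1 / 2 : ℚ) ^ q.2.1.1 : ℚ) : ℝ) < dist (basic (pointCode q.2.2.2) : A × Measures X)
          (basic (pointCode q.2.2.1)) ∨
        tailCode q.2.1.1 (coverSize q.2.2.1) + 1 + q.2.1.1 ≤ q.2.1.2 ∧
        ((2 * (1 / 2 : ℚ) ^ q.2.1.1 : ℚ) : ℝ) < basicIntegral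
          (basic (pointCode q.2.2.2).unpair.2 : Measures X)
          (tailCode q.2.1.1 (coverSize q.2.2.1))) := by
    have ht : Computable fun q : Unit × (ℕ × ℕ) × ℕ × ℕ =>
        tailCode q.2.1.1 (coverSize q.2.2.1) :=
      computable_tailCode.comp (g := fun q : Unit × (ℕ × ℕ) × ℕ × ℕ =>
        (q.2.1.1, coverSize q.2.2.1)) (by fun_prop)
    refine ((SemidecidableIn.apply_eq (by fun_prop) (by fun_prop)).and
      (.apply_eq (by fun_prop) (by fun_prop))).and (((SemidecidableIn.of_decide
      (computable_decide_le (by fun_prop) (by fun_prop))).and ?_).or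
      ((SemidecidableIn.of_decide (computable_decide_le (by fun_prop) (by fun_prop))).and ?_))
    · exact (ComputableRealIn.of_const hd).1.lt
        (q := fun q : Unit × (ℕ × ℕ) × ℕ × ℕ => (1 / 2 : ℚ) ^ q.2.1.1)
        (u := fun q => (pointCode q.2.2.2, pointCode q.2.2.1)) (by fun_prop) (by fun_prop)
    · exact (computable_basicIntegral_basic X).1.lt
        (q := fun q : Unit × (ℕ × ℕ) × ℕ × ℕ => 2 * (1 / 2 : ℚ) ^ q.2.1.1)
        (u := fun q => ((pointCode q.2.2.2).unpair.2, tailCode q.2.1.1 (coverSize q.2.2.1)))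
        (by fun_prop) (by fun_prop)
  have h2 : SemidecidableIn (fun h : ℕ → ℕ => h) fun h (_ : Unit) => h ∈ (tightNames A X)ᶜ := by
    refine h1.proj.congr fun h _ => ?_
    simp only [tightNames, Set.mem_compl_iff, Set.mem_ofPred_eq, not_and_or, not_forall, not_le]
    constructor
    · rintro (⟨i, j, hij, hlt⟩ | ⟨k, j, hkj, hlt⟩)
      · exact ⟨((i, j), h i, h j), ⟨rfl, rfl⟩, Or.inl ⟨hij, by push_cast; exact hlt⟩⟩
      · exact ⟨((k, j), h k, h j), ⟨rfl, rfl⟩, Or.inr ⟨hkj, by push_cast; exact hlt⟩⟩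
    · rintro ⟨⟨⟨i, j⟩, u, v⟩, ⟨hu, hv⟩, h3⟩
      simp only at hu hv h3
      subst hu hv
      push_cast at h3
      rcases h3 with ⟨hij, hlt⟩ | ⟨hkj, hlt⟩
      · exact Or.inl ⟨i, j, hij, hlt⟩
      · exact Or.inr ⟨i, j, hkj, hlt⟩
  exact h2.effectivelyOpen

/-- The first coordinates converge by completeness of `A`. For the measures, the recorded covers
control all late terms, and the finitely many earlier ones are each tight, so the Prokhorov argument
applies. -/
theorem exists_isCauchyName_of_mem_tightNames {h : ℕ → ℕ} (hh : h ∈ tightNames A X) :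
    ∃ p : A × Measures X, IsCauchyName (fun j => pointCode (h j)) p := by
  have : CompleteSpace A := IsComputableMetricSpace.complete
  have : CompleteSpace X := IsComputableMetricSpace.complete
  have hX : DenseRange (basic : ℕ → X) := IsComputableMetricSpace.dense
  obtain ⟨h1, h2⟩ := hh
  set p : ℕ → A × Measures X := fun j => basic (pointCode (h j)) with hp
  have hc : CauchySeq p := cauchySeq_of_le_tendsto_0 (fun n => (1 / 2 : ℝ) ^ n + (1 / 2) ^ n)
    (fun i j n hi hj => (dist_triangle_right _ _ (p n)).trans (add_le_add (h1 n i hi) (h1 n j hj)))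
    (by simpa using tendsto_half_pow.add tendsto_half_pow)
  have hcA : CauchySeq fun j => (p j).1 := uniformContinuous_fst.comp_cauchySeq hc
  obtain ⟨a, ha⟩ := cauchySeq_tendsto_of_complete hcA
  have hν : CauchySeq fun j => (p j).2 := uniformContinuous_snd.comp_cauchySeq hc
  have hmass : ∀ ν : Measures X, basicIntegral ν 0 = FiniteMeasure.mass ν := by
    intro ν
    rw [basicIntegral, basicFun_zero]
    simp [measureReal_def, FiniteMeasure.mass]
    rfl
  -- The mass is the integral of the basic function with code `0`. Terms from index `1` on are
  -- within `1 / 2` of the term with index `1`, which bounds the difference of masses by `1`; the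
  -- term with index `0` is added separately.
  have hC : ∀ j, FiniteMeasure.mass (p j).2 ≤
      FiniteMeasure.mass (p 0).2 + (FiniteMeasure.mass (p 1).2 + 1) := by
    intro j
    rcases Nat.eq_zero_or_pos j with rfl | hj
    · exact le_self_add
    · have h3 : dist (p j).2 (p 1).2 ≤ (1 / 2) ^ (0 + 1 + 0) :=
        (le_max_right _ _).trans ((h1 1 j hj).trans (by norm_num))
      have h4 := (abs_le.1 (abs_basicIntegral_sub_le h3)).2
      rw [hmass, hmass, pow_zero] at h4
      rw [← NNReal.coe_le_coe]
      push_cast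
      have : (0 : ℝ) ≤ FiniteMeasure.mass (p 0).2 := NNReal.coe_nonneg _
      linarith
  have hN : ∀ k, ∃ N, ∀ j, (p j).2.toMeasure.real (cover X k N)ᶜ ≤ 2 * (1 / 2) ^ k := by
    intro k
    have h3 : ∀ j, ∃ N, basicIntegral (p j).2 (tailCode k N) ≤ 2 * (1 / 2) ^ k := fun j =>
      ((tendsto_basicIntegral_tailCode hX (p j).2 k).eventually_le_const
        (by positivity : (0 : ℝ) < 2 * (1 / 2) ^ k)).exists
    choose M hM using h3
    set J := tailCode k (coverSize (h k)) + 1 + k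
    have h4 : ∀ j, ∃ N ≤ max (coverSize (h k)) ((Finset.range J).sup M),
        basicIntegral (p j).2 (tailCode k N) ≤ 2 * (1 / 2) ^ k := by
      intro j
      rcases le_or_gt J j with hj | hj
      · exact ⟨_, le_max_left _ _, h2 k j hj⟩
      · exact ⟨M j, le_max_of_le_right (Finset.le_sup (Finset.mem_range.2 hj)), hM j⟩
    refine ⟨max (coverSize (h k)) ((Finset.range J).sup M), fun j => ?_⟩
    obtain ⟨N, hN, hN'⟩ := h4 j
    exact (measureReal_mono (Set.compl_subset_compl.2 (cover_mono k hN))).trans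
      ((measure_cover_compl_le _ _ _).trans hN')
  choose N hN using hN
  obtain ⟨μ, hμ⟩ := exists_tendsto_of_cauchySeq_of_cover hν hC hN
  exact ⟨(a, μ), h1, ha.prodMk_nhds hμ⟩

theorem exists_uniformlyComputes_mem_SR {a : A} {μ : Measures X} {x : X} (hx : x ∈ SR μ a) :
    ∃ h : ℕ → ℕ, UniformlyComputes h (a, μ) ∧ x ∈ SR μ h := by
  classical
  obtain ⟨κ, h1, h2⟩ := exists_mem_SR_nameWeight_pos hx
  -- Limits of measures are used here only in a pseudometric space, where a name need not determine
  -- its point. The first case ensures that the value at `κ` is `(a, μ)` itself and not just some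
  -- limit of the same sequence.
  let f : (ℕ → ℕ) → A × Measures X := fun h =>
    if IsCauchyName (fun j => pointCode (h j)) (a, μ) then (a, μ)
    else if hh : h ∈ tightNames A X then (exists_isCauchyName_of_mem_tightNames hh).choose
    else (a, μ)
  have hf : ∀ h ∈ tightNames A X, IsCauchyName (fun j => pointCode (h j)) (f h) := by
    intro h hh
    by_cases hc : IsCauchyName (fun j => pointCode (h j)) (a, μ)
    · simp only [f, if_pos hc]; exact hc
    · simp only [f, if_neg hc, dif_pos hh]
      exact (exists_isCauchyName_of_mem_tightNames hh).choose_spec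
  refine ⟨κ, ⟨tightNames A X, effectivelyClosed_tightNames, mem_tightNames h2, f,
    computableOn_of_pointIn ⟨fun p _ j => pointCode (p.pt j), ?_, fun p _ => hf _ p.pt_mem⟩,
    if_pos (isCauchyName_pointCode h2)⟩, h1⟩
  have hg := (pointIn_named (α := Unit) (tightNames A X)).baire_graph
  exact SemidecidableIn.subst_value (β := ℕ) (R := fun _ (q : (Unit × ℕ × ℕ) × ℕ) =>
    pointCode q.2 = q.1.2.2) (.of_decide (computable_decide_eq (by fun_prop) (by fun_prop)))
    (g := fun (p : Named (tightNames A X)) (q : Unit × ℕ × ℕ) => p.pt q.2.1)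
    (hg.comp (g := fun q : (Unit × ℕ × ℕ) × ℕ => (q.1.1, q.1.2.1, q.2)) (by fun_prop))

end Names

end SchnorrRandomness

theorem mainTheorem7 {A X : Type*}
    [MetricSpace A] [SchnorrRandomness.BasicPoints A] [SchnorrRandomness.IsComputableMetricSpace A]
    [MetricSpace X] [SchnorrRandomness.BasicPoints X] [SchnorrRandomness.IsComputableMetricSpace X]
    [MeasurableSpace X] [BorelSpace X]
    (a : A) (μ : SchnorrRandomness.Measures X) (x : X) :
    List.TFAE [
      ∃ h : ℕ → ℕ, SchnorrRandomness.IsCauchyName h (a, μ) ∧ x ∈ SchnorrRandomness.SR μ h,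
      ∃ h : ℕ → ℕ, SchnorrRandomness.UniformlyComputes h (a, μ) ∧ x ∈ SchnorrRandomness.SR μ h,
      x ∈ SchnorrRandomness.SR μ a] := by
  tfae_have 1 → 3 := fun ⟨_, h1, h2⟩ => SchnorrRandomness.mem_SR_fst_of_isCauchyName h1 h2
  tfae_have 2 → 3 := fun ⟨_, h1, h2⟩ => SchnorrRandomness.mem_SR_fst_of_uniformlyComputes h1 h2
  tfae_have 3 → 1 := SchnorrRandomness.exists_isCauchyName_mem_SR
  tfae_have 3 → 2 := SchnorrRandomness.exists_uniformlyComputes_mem_SR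
  tfae_finish
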